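/- Let $F$ be a non-archimedean local field of characteristic $2$ with residue field $\mathbb F_q$, and let $E/F$ be a totally (wildly) ramified quadratic Galois extension with discriminant $\mathfrak p_F^{d+1}$, where $d>0$ is odd. Let $\tau$ be the non-trivial element of $\mathrm{Gal}(E/F)$. Choose uniformizers $\varpi$ of $F$ and $\pi$ of $E$ with $\pi^2+\Delta\pi+\varpi=0$, where $\Delta\in F$ and $\mathrm{ord}_F(\Delta)=\frac{d+1}{2}$, and put $\varepsilon=\tau(\pi)/\pi$. Let $\iota\colon E^\times\hookrightarrow \mathrm{GL}_2(F)$ be the restriction of the $F$-algebra embedding $E \hookrightarrow \mathrm{Mat}_{2\times 2}(F)$ with $\iota(\pi)=\begin{pmatrix}\Delta&1\\ \varpi&0\end{pmatrix}$. For $L\in\{E,F\}$ let $$I_L=\begin{pmatrix}\mathcal O_L^\times&\mathcal O_L\\ \mathfrak p_L&\mathcal O_L^\times\end{pmatrix},\qquad I_E^{2m+1}=\begin{pmatrix}1+\mathfrak p_E^{m+1}&\mathfrak p_E^m\\ \mathfrak p_E^{m+1}&1+\mathfrak p_E^{m+1}\end{pmatrix}.$$ Let $m>d$ be even, define $n\ge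 1$ by $m=2n+d-1$, and assume $2n>d$. Put $J=I_E^{2m+1}$, $$\dot w=\begin{pmatrix}0&\pi^{-n}\\ \pi^n&0\end{pmatrix}\begin{pmatrix}\varepsilon^{\lfloor n/2\rfloor}&0\\0&\varepsilon^{-\lfloor (n+1)/2\rfloor}\end{pmatrix},\qquad \dot v=\begin{pmatrix}0&\pi^{-(\frac{d+1}{2}+\lfloor\frac{n+1}{2}\rfloor)}\\ \pi^{\frac{d+1}{2}+\lfloor\frac n2\rfloor}&0\end{pmatrix}.$$ Let $X=\{gJ\in \mathrm{GL}_2(E)/J : g^{-1}\tau(g)\in J\dot wJ\}$, a discrete set. Let $Z$ denote the center of $\mathrm{GL}_2$, and let $\widetilde\Gamma\subseteq Z(E)I_E/J$ be the stabilizer of the double coset $J\dot wJ$ under $i\colon J\dot wJ\mapsto J\,i^{-1}\dot w\tau(i)\,J$; it acts on $X$ by right multiplication. Let $X_{1/2}\subseteq X$ be the subset of those $gJ$ with $gI_E=\begin{pmatrix}1&0\\a&1\end{pmatrix}\dot vI_E$ for some $a\in\mathfrak p_E\smallsetminus\mathfrak p_E^2$, and let $\widetilde X=X_{1/2}\cdot\widetilde\Gamma$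 be the smallest $\widetilde\Gamma$-stable subset of $X$ containing it. It is stable under left multiplication by $\iota(E^\times)I_F$. Let $\ell$ be a prime, let $\theta\colon E^\times\to\overline{\mathbb Q}_\ell^\times$ be a character of level $m$ (that is, $m$ is the smallest integer $\ge 0$ such that $\theta$ is trivial on $U_E^{m+1}=1+\mathfrak p_E^{m+1}$), and let $\tilde\theta\colon\widetilde\Gamma\to\overline{\mathbb Q}_\ell^\times$ be a character lifting $\theta$, that is, $\tilde\theta(\mathrm{diag}(t,\tau(t)))=\theta(t)$ for all $t\in E^\times$. Let $\Xi_{\tilde\theta}$ be the representation of $\iota(E^\times)I_F$ on $H_c^0(\widetilde X,\overline{\mathbb Q}_\ell)[\tilde\theta]$, the largest quotient of the space of finitely supported functions $\widetilde X\to\overline{\mathbb Q}_\ell$ on which $\widetilde\Gamma$, acting by right translation (so that $\gamma$ sends the indicator function of $y$ to that of $y\gamma$), acts through $\tilde\theta$. For $\alpha\ge1$ let $N^\alpha=\left\{\begin{pmatrix}1&0\\u&1\end{pmatrix}: u\in\mathfrak p_F^\alpha\right\}$, and let $B\subseteq\mathrm{GL}_2$ be the Borel subgroup of lower triangular matrices.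 Then, as a representation of $N^1$, $\Xi_{\tilde\theta}$ is isomorphic to the direct sum of all characters $N^1\to\overline{\mathbb Q}_\ell^\times$ that are trivial on $N^{n+d+1}$ and non-trivial on $N^{n+d}$, each occurring exactly once. Moreover, $\Xi_{\tilde\theta}$ is irreducible as a representation of $B(F)\cap I_F$. -/

import Mathlib

open ValuativeRel
open scoped MatrixGroups

namespace WildGL2

set_option linter.unusedSectionVars false

section Iwahori

variable (L : Type*) [Field L] [ValuativeRel L] [TopologicalSpace L]
  [IsNonarchimedeanLocalField L]

/-- The power `𝔭_L ^ j` of the maximal ideal of the ring of integers of `L`. -/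
def maxPow (j : ℕ) : AddSubgroup L where
  carrier := {x | valuation L x ≤ uniformizer L ^ j}
  zero_mem' := by simp
  add_mem' ha hb := (valuation L).map_add_le ha hb
  neg_mem' ha := by simpa using ha

variable {L}

theorem mem_maxPow {j : ℕ} {x : L} : x ∈ maxPow L j ↔ valuation L x ≤ uniformizer L ^ j :=
  Iff.rfl

theorem maxPow_mul {i j : ℕ} {x y : L} (hx : x ∈ maxPow L i) (hy : y ∈ maxPow L j) :
    x * y ∈ maxPow L (i + j) := by
  rw [mem_maxPow] at *
  rw [map_mul, pow_add]
  exact mul_le_mul' hx hy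

theorem maxPow_anti {i j : ℕ} (h : i ≤ j) {x : L} (hx : x ∈ maxPow L j) : x ∈ maxPow L i := by
  rw [mem_maxPow] at *
  exact hx.trans (pow_le_pow_right_of_le_one' uniformizer_lt_one.le h)

theorem maxPow_mul_of_le {i j k : ℕ} {x y : L} (hx : x ∈ maxPow L i) (hy : y ∈ maxPow L j)
    (h : k ≤ i + j) : x * y ∈ maxPow L k :=
  maxPow_anti h (maxPow_mul hx hy)

theorem mem_maxPow_one {x : L} : x ∈ maxPow L 1 ↔ valuation L x < 1 := by
  rw [mem_maxPow, pow_one, le_uniformizer_iff]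

theorem mem_maxPow_zero {x : L} : x ∈ maxPow L 0 ↔ valuation L x ≤ 1 := by
  rw [mem_maxPow, pow_zero]

/-- Membership in the order of matrices over `𝒪_L` that are upper triangular modulo `𝔭_L`. -/
def InOrder (M : Matrix (Fin 2) (Fin 2) L) : Prop :=
  M 0 0 ∈ maxPow L 0 ∧ M 0 1 ∈ maxPow L 0 ∧ M 1 0 ∈ maxPow L 1 ∧ M 1 1 ∈ maxPow L 0

/-- Membership in the two-sided ideal `[𝔭^(m+1), 𝔭^m; 𝔭^(m+1), 𝔭^(m+1)]` of that order. -/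
def InLevel (m : ℕ) (M : Matrix (Fin 2) (Fin 2) L) : Prop :=
  M 0 0 ∈ maxPow L (m + 1) ∧ M 0 1 ∈ maxPow L m ∧ M 1 0 ∈ maxPow L (m + 1) ∧
    M 1 1 ∈ maxPow L (m + 1)

theorem InOrder.mul {M N : Matrix (Fin 2) (Fin 2) L} (hM : InOrder M) (hN : InOrder N) :
    InOrder (M * N) := by
  obtain ⟨a, b, c, d⟩ := hM
  obtain ⟨a', b', c', d'⟩ := hN
  simp only [InOrder, Matrix.mul_apply, Fin.sum_univ_two]
  refine ⟨add_mem ?_ ?_, add_mem ?_ ?_, add_mem ?_ ?_, add_mem ?_ ?_⟩ <;>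
    first
    | exact maxPow_mul_of_le a a' (by omega) | exact maxPow_mul_of_le b c' (by omega)
    | exact maxPow_mul_of_le a b' (by omega) | exact maxPow_mul_of_le b d' (by omega)
    | exact maxPow_mul_of_le c a' (by omega) | exact maxPow_mul_of_le d c' (by omega)
    | exact maxPow_mul_of_le c b' (by omega) | exact maxPow_mul_of_le d d' (by omega)

theorem InOrder.mul_level {m : ℕ} {M N : Matrix (Fin 2) (Fin 2) L} (hM : InOrder M)
    (hN : InLevel m N) : InLevel m (M * N) := by
  obtain ⟨a, b, c, d⟩ := hM
  obtain ⟨a', b', c', d'⟩ := hN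
  simp only [InLevel, Matrix.mul_apply, Fin.sum_univ_two]
  refine ⟨add_mem ?_ ?_, add_mem ?_ ?_, add_mem ?_ ?_, add_mem ?_ ?_⟩ <;>
    first
    | exact maxPow_mul_of_le a a' (by omega) | exact maxPow_mul_of_le b c' (by omega)
    | exact maxPow_mul_of_le a b' (by omega) | exact maxPow_mul_of_le b d' (by omega)
    | exact maxPow_mul_of_le c a' (by omega) | exact maxPow_mul_of_le d c' (by omega)
    | exact maxPow_mul_of_le c b' (by omega) | exact maxPow_mul_of_le d d' (by omega)

theorem InLevel.mul_order {m : ℕ} {M N : Matrix (Fin 2) (Fin 2) L} (hM : InLevel m M)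
    (hN : InOrder N) : InLevel m (M * N) := by
  obtain ⟨a, b, c, d⟩ := hM
  obtain ⟨a', b', c', d'⟩ := hN
  simp only [InLevel, Matrix.mul_apply, Fin.sum_univ_two]
  refine ⟨add_mem ?_ ?_, add_mem ?_ ?_, add_mem ?_ ?_, add_mem ?_ ?_⟩ <;>
    first
    | exact maxPow_mul_of_le a a' (by omega) | exact maxPow_mul_of_le b c' (by omega)
    | exact maxPow_mul_of_le a b' (by omega) | exact maxPow_mul_of_le b d' (by omega)
    | exact maxPow_mul_of_le c a' (by omega) | exact maxPow_mul_of_le d c' (by omega)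
    | exact maxPow_mul_of_le c b' (by omega) | exact maxPow_mul_of_le d d' (by omega)

theorem InLevel.add {m : ℕ} {M N : Matrix (Fin 2) (Fin 2) L} (hM : InLevel m M)
    (hN : InLevel m N) : InLevel m (M + N) :=
  ⟨add_mem hM.1 hN.1, add_mem hM.2.1 hN.2.1, add_mem hM.2.2.1 hN.2.2.1,
    add_mem hM.2.2.2 hN.2.2.2⟩

theorem InLevel.neg {m : ℕ} {M : Matrix (Fin 2) (Fin 2) L} (hM : InLevel m M) :
    InLevel m (-M) :=
  ⟨neg_mem hM.1, neg_mem hM.2.1, neg_mem hM.2.2.1, neg_mem hM.2.2.2⟩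

theorem valuation_add_eq_one {x y : L} (hx : valuation L x = 1) (hy : valuation L y < 1) :
    valuation L (x + y) = 1 := by
  rw [Valuation.map_add_eq_of_lt_left _ (by rwa [hx]), hx]

theorem iwahori_det {g : GL (Fin 2) L} (h0 : valuation L (g 0 0) = 1)
    (h1 : valuation L (g 1 1) = 1) (h2 : g 0 1 ∈ maxPow L 0) (h3 : g 1 0 ∈ maxPow L 1) :
    valuation L (g : Matrix (Fin 2) (Fin 2) L).det = 1 := by
  rw [Matrix.det_fin_two, sub_eq_add_neg]
  refine valuation_add_eq_one (by rw [map_mul, h0, h1, one_mul]) ?_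
  rw [Valuation.map_neg, ← mem_maxPow_one]
  exact maxPow_mul_of_le h2 h3 (by omega)

theorem inv_entries (g : GL (Fin 2) L) :
    (g⁻¹ : GL (Fin 2) L) 0 0 = (g : Matrix (Fin 2) (Fin 2) L).det⁻¹ * g 1 1 ∧
    (g⁻¹ : GL (Fin 2) L) 0 1 = -((g : Matrix (Fin 2) (Fin 2) L).det⁻¹ * g 0 1) ∧
    (g⁻¹ : GL (Fin 2) L) 1 0 = -((g : Matrix (Fin 2) (Fin 2) L).det⁻¹ * g 1 0) ∧
    (g⁻¹ : GL (Fin 2) L) 1 1 = (g : Matrix (Fin 2) (Fin 2) L).det⁻¹ * g 0 0 := by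
  simp [Matrix.coe_units_inv, Matrix.inv_def, Matrix.adjugate_fin_two]

variable (L)

/-- The Iwahori subgroup `[𝒪ˣ, 𝒪; 𝔭, 𝒪ˣ]` of `GL₂(L)`. -/
def iwahori : Subgroup (GL (Fin 2) L) where
  carrier := {g | valuation L (g 0 0) = 1 ∧ valuation L (g 1 1) = 1 ∧
    g 0 1 ∈ maxPow L 0 ∧ g 1 0 ∈ maxPow L 1}
  one_mem' := by simp
  mul_mem' := by
    rintro g h ⟨a, d, b, c⟩ ⟨a', d', b', c'⟩
    have hg : InOrder (g : Matrix (Fin 2) (Fin 2) L) :=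
      ⟨mem_maxPow_zero.2 a.le, b, c, mem_maxPow_zero.2 d.le⟩
    have hh : InOrder (h : Matrix (Fin 2) (Fin 2) L) :=
      ⟨mem_maxPow_zero.2 a'.le, b', c', mem_maxPow_zero.2 d'.le⟩
    refine ⟨?_, ?_, (hg.mul hh).2.1, (hg.mul hh).2.2.1⟩
    · simp only [Units.val_mul, Matrix.mul_apply, Fin.sum_univ_two]
      refine valuation_add_eq_one (by rw [map_mul, a, a', one_mul]) ?_
      rw [← mem_maxPow_one]
      exact maxPow_mul_of_le b c' (by omega)
    · simp only [Units.val_mul, Matrix.mul_apply, Fin.sum_univ_two]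
      rw [add_comm]
      refine valuation_add_eq_one (by rw [map_mul, d, d', one_mul]) ?_
      rw [← mem_maxPow_one]
      exact maxPow_mul_of_le c b' (by omega)
  inv_mem' := by
    rintro g ⟨a, d, b, c⟩
    have hdet := iwahori_det a d b c
    obtain ⟨i, j, k, l⟩ := inv_entries g
    have hd : valuation L (g : Matrix (Fin 2) (Fin 2) L).det⁻¹ = 1 := by
      rw [map_inv₀, hdet, inv_one]
    have hd' := mem_maxPow_zero.2 hd.le
    refine ⟨?_, ?_, ?_, ?_⟩
    · rw [i, map_mul, hd, d, one_mul]
    · rw [l, map_mul, hd, a, one_mul]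
    · rw [j]
      exact neg_mem (maxPow_mul_of_le hd' b (by omega))
    · rw [k]
      exact neg_mem (maxPow_mul_of_le hd' c (by omega))

variable {L}

theorem InOrder.of_iwahori {g : GL (Fin 2) L} (hg : g ∈ iwahori L) :
    InOrder (g : Matrix (Fin 2) (Fin 2) L) :=
  ⟨mem_maxPow_zero.2 hg.1.le, hg.2.2.1, hg.2.2.2, mem_maxPow_zero.2 hg.2.1.le⟩

theorem iwahori_of_inLevel {m : ℕ} {g : GL (Fin 2) L}
    (h : InLevel m ((g : Matrix (Fin 2) (Fin 2) L) - 1)) : g ∈ iwahori L := by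
  obtain ⟨a, b, c, d⟩ := h
  simp only [Matrix.sub_apply, Matrix.one_apply_eq, ne_eq, zero_ne_one, not_false_eq_true,
    Matrix.one_apply_ne, one_ne_zero, sub_zero] at a b c d
  have key : ∀ x : L, x - 1 ∈ maxPow L (m + 1) → valuation L x = 1 := by
    intro x hx
    have : x = 1 + (x - 1) := by ring
    rw [this]
    refine valuation_add_eq_one (map_one _) (mem_maxPow_one.1 (maxPow_anti (by omega) hx))
  exact ⟨key _ a, key _ d, maxPow_anti (by omega) b, maxPow_anti (by omega) c⟩

variable (L)

/-- The level subgroup `I_L^(2m+1) = [1 + 𝔭^(m+1), 𝔭^m; 𝔭^(m+1), 1 + 𝔭^(m+1)]`. -/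
def levelSubgroup (m : ℕ) : Subgroup (GL (Fin 2) L) where
  carrier := {g | InLevel m ((g : Matrix (Fin 2) (Fin 2) L) - 1)}
  one_mem' := by simp [InLevel]
  mul_mem' := by
    intro g h hg hh
    have h1 := InOrder.of_iwahori (iwahori_of_inLevel hg)
    have : ((g * h : GL (Fin 2) L) : Matrix (Fin 2) (Fin 2) L) - 1 =
        (g : Matrix (Fin 2) (Fin 2) L) * ((h : Matrix (Fin 2) (Fin 2) L) - 1) +
          ((g : Matrix (Fin 2) (Fin 2) L) - 1) := by
      rw [Units.val_mul, mul_sub, mul_one]; abel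
    change InLevel m _
    rw [this]
    exact (h1.mul_level hh).add hg
  inv_mem' := by
    intro g hg
    have h1 := InOrder.of_iwahori (inv_mem (iwahori_of_inLevel hg))
    have : ((g⁻¹ : GL (Fin 2) L) : Matrix (Fin 2) (Fin 2) L) - 1 =
        -(((g⁻¹ : GL (Fin 2) L) : Matrix (Fin 2) (Fin 2) L) *
          ((g : Matrix (Fin 2) (Fin 2) L) - 1)) := by
      rw [mul_sub, mul_one, Units.inv_mul]; abel
    change InLevel m _
    rw [this]
    exact (h1.mul_level hg).neg

variable {L}

theorem levelSubgroup_le_iwahori (m : ℕ) : levelSubgroup L m ≤ iwahori L :=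
  fun _ h => iwahori_of_inLevel h

variable (L)

/-- The group `Z(L) I_L`. -/
def centerIwahori : Subgroup (GL (Fin 2) L) := Subgroup.center (GL (Fin 2) L) ⊔ iwahori L

variable {L}

theorem conj_mem_levelSubgroup {m : ℕ} {g j : GL (Fin 2) L} (hg : g ∈ centerIwahori L)
    (hj : j ∈ levelSubgroup L m) : g * j * g⁻¹ ∈ levelSubgroup L m := by
  obtain ⟨z, hz, i, hi, rfl⟩ := Subgroup.mem_sup_of_normal_left.1 hg
  have hz' := Subgroup.mem_center_iff.1 hz
  have e : z * i * j * (z * i)⁻¹ = i * j * i⁻¹ := by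
    rw [_root_.mul_inv_rev, mul_assoc z, mul_assoc z, ← hz']
    group
  rw [e]
  have e2 : ((i * j * i⁻¹ : GL (Fin 2) L) : Matrix (Fin 2) (Fin 2) L) - 1 =
      (i : Matrix (Fin 2) (Fin 2) L) * ((j : Matrix (Fin 2) (Fin 2) L) - 1) *
        ((i⁻¹ : GL (Fin 2) L) : Matrix (Fin 2) (Fin 2) L) := by
    rw [mul_sub, sub_mul, mul_one, Units.mul_inv, Units.val_mul, Units.val_mul]
  change InLevel m _
  rw [e2]
  exact ((InOrder.of_iwahori hi).mul_level hj).mul_order (InOrder.of_iwahori (inv_mem hi))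

theorem conj_mem_levelSubgroup_inv {m : ℕ} {g j : GL (Fin 2) L} (hg : g ∈ centerIwahori L)
    (hj : j ∈ levelSubgroup L m) : g⁻¹ * j * g ∈ levelSubgroup L m := by
  simpa using conj_mem_levelSubgroup (inv_mem hg) hj

/-- The lower triangular unipotent matrix `e₋(a)`. -/
def eMinus (a : L) : GL (Fin 2) L :=
  Matrix.GeneralLinearGroup.mkOfDetNeZero !![1, 0; a, 1] (by simp)

/-- The diagonal matrix `e₀(c, d)`. -/
def eZero (c d : Lˣ) : GL (Fin 2) L :=
  Matrix.GeneralLinearGroup.mkOfDetNeZero !![(c : L), 0; 0, (d : L)] (by simp)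

variable (L)

/-- The group `N^α` of lower triangular unipotent matrices with lower left entry in `𝔭^α`. -/
def lowerUnipotent (α : ℕ) : Subgroup (GL (Fin 2) L) where
  carrier := {g | g 0 0 = 1 ∧ g 1 1 = 1 ∧ g 0 1 = 0 ∧ g 1 0 ∈ maxPow L α}
  one_mem' := by simp
  mul_mem' := by
    rintro g h ⟨a, d, b, c⟩ ⟨a', d', b', c'⟩
    refine ⟨?_, ?_, ?_, ?_⟩ <;>
      simp only [Units.val_mul, Matrix.mul_apply, Fin.sum_univ_two, a, b, d, a', b', d'] <;>
      simp
    exact add_mem c c'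
  inv_mem' := by
    rintro g ⟨a, d, b, c⟩
    obtain ⟨i, j, k, l⟩ := inv_entries g
    have hd : (g : Matrix (Fin 2) (Fin 2) L).det = 1 := by
      rw [Matrix.det_fin_two, a, b, d]; simp
    rw [hd] at i j k l
    refine ⟨?_, ?_, ?_, ?_⟩
    · rw [i, d]; simp
    · rw [l, a]; simp
    · rw [j, b]; simp
    · rw [k]; simpa using c

/-- The Borel subgroup `B(L)` of lower triangular matrices. -/
def lowerBorel : Subgroup (GL (Fin 2) L) where
  carrier := {g | g 0 1 = 0}
  one_mem' := by simp
  mul_mem' := by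
    intro g h (hg : g 0 1 = 0) (hh : h 0 1 = 0)
    simp [Matrix.mul_apply, hg, hh]
  inv_mem' := by
    intro g (hg : g 0 1 = 0)
    have := (inv_entries g).2.1
    rw [hg] at this
    simpa using this

variable {L}

theorem lowerUnipotent_le_iwahori : lowerUnipotent L 1 ≤ iwahori L := by
  rintro g ⟨a, d, b, c⟩
  exact ⟨by rw [a, map_one], by rw [d, map_one], by rw [b]; exact zero_mem _, c⟩

end Iwahori

section Datum

variable (F E : Type*) [Field F] [ValuativeRel F] [TopologicalSpace F]
  [IsNonarchimedeanLocalField F] [Field E] [ValuativeRel E] [TopologicalSpace E]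
  [IsNonarchimedeanLocalField E] [Algebra F E] [ValuativeExtension F E]

/-- A totally (wildly) ramified quadratic Galois extension `E / F` of local fields of
characteristic two, with uniformizers `ϖ` of `F` and `π` of `E` such that `π ^ 2 + Δ π + ϖ = 0`,
where `Δ` has valuation `(d + 1) / 2`. Since `𝒪_E = 𝒪_F[π]`, the discriminant of `E / F` is
`Δ ^ 2 𝒪_F = 𝔭_F ^ (d + 1)`. The nontrivial element of the Galois group is `τ`. -/
structure WildDatum where
  finrank_eq : Module.finrank F E = 2
  d : ℕ
  odd_d : Odd d
  ϖ : F
  π : E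
  Δ : F
  valuation_ϖ : valuation F ϖ = uniformizer F
  valuation_π : valuation E π = uniformizer E
  valuation_Δ : valuation F Δ = uniformizer F ^ ((d + 1) / 2)
  equation : π ^ 2 + algebraMap F E Δ * π + algebraMap F E ϖ = 0
  τ : E ≃ₐ[F] E
  τ_ne_one : τ ≠ 1

theorem valuation_eq_zpow (K : Type*) [Field K] [ValuativeRel K] [TopologicalSpace K]
    [IsNonarchimedeanLocalField K] {x : K} (hx : x ≠ 0) :
    ∃ k : ℤ, valuation K x = uniformizer K ^ k := by
  let e := IsNonarchimedeanLocalField.valueGroupWithZeroIsoInt K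
  have hu0 : e (uniformizer K) ≠ 0 := by
    simp [uniformizer_ne_zero]
  have hx0 : e (valuation K x) ≠ 0 := by simpa using hx
  obtain ⟨a, ha⟩ : ∃ a : ℤ, e (uniformizer K) = WithZero.exp a :=
    ⟨WithZero.log (e (uniformizer K)), (WithZero.exp_log hu0).symm⟩
  obtain ⟨b, hb⟩ : ∃ b : ℤ, e (valuation K x) = WithZero.exp b :=
    ⟨WithZero.log (e (valuation K x)), (WithZero.exp_log hx0).symm⟩
  have h1 : e (uniformizer K) < 1 := by
    rw [← map_one e]; exact e.strictMono uniformizer_lt_one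
  have ha1 : a < 0 := by
    rw [ha, ← WithZero.exp_zero, WithZero.exp_lt_exp] at h1; exact h1
  have h2 : e.symm (WithZero.exp (-1)) ≤ uniformizer K := by
    rw [le_uniformizer_iff, ← map_one e.symm]
    refine e.symm.strictMono ?_
    rw [← WithZero.exp_zero, WithZero.exp_lt_exp]; norm_num
  have h3 : WithZero.exp (-1 : ℤ) ≤ e (uniformizer K) := by
    rw [← e.apply_symm_apply (WithZero.exp (-1 : ℤ))]
    exact e.strictMono.monotone h2
  rw [ha, WithZero.exp_le_exp] at h3
  have ha2 : a = -1 := by omega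
  refine ⟨-b, e.injective ?_⟩
  change e (valuation K x) = e (uniformizer K ^ (-b))
  rw [map_zpow₀, ha, hb, ← WithZero.exp_zsmul, ha2]
  simp

namespace WildDatum

variable {F E} (D : WildDatum F E)

theorem valuation_algebraMap_le {x y : F} :
    valuation E (algebraMap F E x) ≤ valuation E (algebraMap F E y) ↔
      valuation F x ≤ valuation F y := by
  rw [← ValuativeExtension.mapValueGroupWithZero_valuation,
    ← ValuativeExtension.mapValueGroupWithZero_valuation]
  exact ValuativeExtension.mapValueGroupWithZero_strictMono.le_iff_le

theorem valuation_algebraMap_le_one {x : F} :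
    valuation E (algebraMap F E x) ≤ 1 ↔ valuation F x ≤ 1 := by
  simpa using valuation_algebraMap_le (E := E) (x := x) (y := 1)

theorem valuation_algebraMap_lt_one {x : F} :
    valuation E (algebraMap F E x) < 1 ↔ valuation F x < 1 := by
  simpa using (valuation_algebraMap_le (E := E) (x := 1) (y := x)).not

theorem valuation_algebraMap_eq_one {x : F} (hx : valuation F x = 1) :
    valuation E (algebraMap F E x) = 1 := by
  rw [← ValuativeExtension.mapValueGroupWithZero_valuation, hx, map_one]

theorem pi_ne_zero : D.π ≠ 0 := by
  intro h
  have := D.valuation_π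
  rw [h, map_zero] at this
  exact uniformizer_ne_zero this.symm

theorem valuation_delta_le : valuation E (algebraMap F E D.Δ) ≤
    valuation E (algebraMap F E D.ϖ) := by
  rw [valuation_algebraMap_le, D.valuation_Δ, D.valuation_ϖ]
  obtain ⟨k, hk⟩ := D.odd_d
  have : (D.d + 1) / 2 = k + 1 := by omega
  rw [this]
  simpa using pow_le_pow_right_of_le_one' (uniformizer_lt_one (R := F)).le (show 1 ≤ k + 1 by omega)

theorem valuation_varpi : valuation E (algebraMap F E D.ϖ) = uniformizer E ^ 2 := by
  have h0 : valuation E (algebraMap F E D.ϖ) ≠ 0 := by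
    have : D.ϖ ≠ 0 := by
      intro h
      have := D.valuation_ϖ
      rw [h, map_zero] at this
      exact uniformizer_ne_zero this.symm
    simpa using this
  have h1 : valuation E (algebraMap F E D.Δ * D.π) < valuation E (algebraMap F E D.ϖ) := by
    rw [map_mul, D.valuation_π]
    calc _ ≤ valuation E (algebraMap F E D.ϖ) * uniformizer E :=
          mul_le_mul_left D.valuation_delta_le _
      _ < valuation E (algebraMap F E D.ϖ) * 1 :=
          mul_lt_mul_of_pos_left uniformizer_lt_one (zero_lt_iff.2 h0)
      _ = _ := mul_one _
  have h2 : D.π ^ 2 = -(algebraMap F E D.Δ * D.π + algebraMap F E D.ϖ) := by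
    linear_combination D.equation
  rw [← D.valuation_π, ← map_pow, h2, Valuation.map_neg, Valuation.map_add_eq_of_lt_right _ h1]

theorem valuation_delta_le_sq : valuation E (algebraMap F E D.Δ) ≤ uniformizer E ^ 2 :=
  D.valuation_delta_le.trans_eq D.valuation_varpi

theorem valuation_algebraMap (D : WildDatum F E) {x : F} (hx : x ≠ 0) :
    ∃ k : ℤ, valuation E (algebraMap F E x) = uniformizer E ^ (2 * k) := by
  obtain ⟨k, hk⟩ := valuation_eq_zpow F hx
  refine ⟨k, ?_⟩
  rw [← ValuativeExtension.mapValueGroupWithZero_valuation, hk, map_zpow₀, ← D.valuation_ϖ,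
    ValuativeExtension.mapValueGroupWithZero_valuation, D.valuation_varpi, _root_.zpow_mul]
  norm_cast

theorem zpow_uniformizer_inj {a b : ℤ} (h : uniformizer E ^ a = uniformizer E ^ b) : a = b :=
  zpow_right_injective₀ uniformizer_pos uniformizer_lt_one.ne h

/-- The valuation of `α + β y` for `y` of the valuation of a uniformizer. -/
theorem valuation_comb (D : WildDatum F E) (α β : F) {y : E} (hy : valuation E y = uniformizer E) :
    valuation E (algebraMap F E α + algebraMap F E β * y) =
      max (valuation E (algebraMap F E α)) (valuation E (algebraMap F E β) * uniformizer E) := by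
  by_cases ha : α = 0
  · simp [ha, hy]
  by_cases hb : β = 0
  · simp [hb]
  rw [Valuation.map_add_of_distinct_val, map_mul, hy]
  rw [map_mul, hy]
  obtain ⟨k, hk⟩ := D.valuation_algebraMap ha
  obtain ⟨l, hl⟩ := D.valuation_algebraMap hb
  rw [hk, hl, ← zpow_add_one₀ uniformizer_ne_zero]
  intro h
  have := zpow_uniformizer_inj h
  omega

theorem linearIndependent_pi_one : LinearIndependent F ![D.π, 1] := by
  rw [LinearIndependent.pair_iff]
  intro s t h
  have h2 := D.valuation_comb t s D.valuation_π
  rw [Algebra.smul_def, Algebra.smul_def, mul_one, add_comm] at h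
  rw [h, map_zero] at h2
  have h3 := le_antisymm (h2 ▸ le_max_left _ _) zero_le
  have h4 := le_antisymm (h2 ▸ le_max_right _ _) zero_le
  have := uniformizer_ne_zero (R := E)
  simp_all

/-- The `F`-basis `(π, 1)` of `E`. -/
noncomputable def basis : Module.Basis (Fin 2) F E :=
  basisOfLinearIndependentOfCardEqFinrank D.linearIndependent_pi_one
    (by rw [D.finrank_eq, Fintype.card_fin])

theorem basis_zero : D.basis 0 = D.π := by simp [basis]

theorem basis_one : D.basis 1 = 1 := by simp [basis]

theorem exists_comb (x : E) : ∃ α β : F, x = algebraMap F E α + algebraMap F E β * D.π := by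
  refine ⟨D.basis.repr x 1, D.basis.repr x 0, ?_⟩
  conv_lhs => rw [← D.basis.sum_repr x, Fin.sum_univ_two, D.basis_zero, D.basis_one]
  rw [Algebra.smul_def, Algebra.smul_def, mul_one, add_comm]

variable [CharP F 2]

theorem two_eq_zero (_D : WildDatum F E) : (2 : E) = 0 := by
  have : ((2 : ℕ) : F) = 0 := CharP.cast_eq_zero F 2
  have h2 := congrArg (algebraMap F E) this
  rw [map_natCast, map_zero] at h2
  exact_mod_cast h2

theorem add_self (D : WildDatum F E) (x : E) : x + x = 0 := by
  rw [← two_mul, D.two_eq_zero, zero_mul]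

/-- The `F`-algebra embedding `ι : E → Mat₂(F)` given by multiplication on `E = F π ⊕ F`. -/
noncomputable def iota : E →ₐ[F] Matrix (Fin 2) (Fin 2) F := Algebra.leftMulMatrix D.basis

theorem iota_pi : D.iota D.π = !![D.Δ, 1; D.ϖ, 0] := by
  have h : D.π * D.π = D.Δ • D.basis 0 + D.ϖ • D.basis 1 := by
    rw [D.basis_zero, D.basis_one, Algebra.smul_def, Algebra.smul_def]
    have := D.equation
    have h2 := D.two_eq_zero
    linear_combination this - (algebraMap F E D.Δ * D.π + algebraMap F E D.ϖ) * h2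
  ext i j
  rw [iota, Algebra.leftMulMatrix_eq_repr_mul]
  fin_cases j
  · simp only [Fin.zero_eta]
    rw [D.basis_zero, h, map_add, map_smul, map_smul, Module.Basis.repr_self,
      Module.Basis.repr_self]
    fin_cases i <;> simp
  · simp only [Fin.mk_one, D.basis_one, mul_one]
    rw [← D.basis_zero, Module.Basis.repr_self]
    fin_cases i <;> simp

theorem iota_comb (α β : F) : D.iota (algebraMap F E α + algebraMap F E β * D.π) =
    !![α + β * D.Δ, β; β * D.ϖ, α] := by
  rw [map_add, map_mul, AlgHom.commutes, AlgHom.commutes, D.iota_pi]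
  ext i j
  fin_cases i <;> fin_cases j <;> simp [Matrix.algebraMap_eq_diagonal]

theorem tau_pi : D.τ D.π = D.π + algebraMap F E D.Δ := by
  have h1 := congrArg D.τ D.equation
  simp only [map_add, map_mul, map_pow, AlgEquiv.commutes, map_zero] at h1
  have h2 := D.two_eq_zero
  have h3 : (D.τ D.π - D.π) * (D.τ D.π - (D.π + algebraMap F E D.Δ)) = 0 := by
    linear_combination h1 - D.equation + (D.π ^ 2 - D.τ D.π * D.π + D.π * algebraMap F E D.Δ
      - D.τ D.π * algebraMap F E D.Δ) * h2
  rcases mul_eq_zero.1 h3 with h | h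
  · exfalso
    refine D.τ_ne_one (AlgEquiv.ext fun x => ?_)
    obtain ⟨α, β, rfl⟩ := D.exists_comb x
    simp [sub_eq_zero.1 h]
  · exact sub_eq_zero.1 h

theorem valuation_pi_add {y : E} (hy : valuation E y = uniformizer E) :
    valuation E (y + algebraMap F E D.Δ) = uniformizer E := by
  rw [Valuation.map_add_eq_of_lt_left _, hy]
  rw [hy]
  refine D.valuation_delta_le_sq.trans_lt ?_
  calc uniformizer E ^ 2 = uniformizer E * uniformizer E := pow_two _
    _ < uniformizer E * 1 := mul_lt_mul_of_pos_left uniformizer_lt_one uniformizer_pos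
    _ = _ := mul_one _

theorem tau_tau (x : E) : D.τ (D.τ x) = x := by
  obtain ⟨α, β, rfl⟩ := D.exists_comb x
  simp [D.tau_pi, add_assoc, D.add_self]

theorem valuation_tau (x : E) : valuation E (D.τ x) = valuation E x := by
  obtain ⟨α, β, rfl⟩ := D.exists_comb x
  rw [map_add, map_mul, AlgEquiv.commutes, AlgEquiv.commutes, D.valuation_comb _ _ D.valuation_π,
    D.tau_pi, D.valuation_comb _ _ (D.valuation_pi_add D.valuation_π)]

/-- The quotient `ε = τ(π) / π`, a unit of `𝒪_E`. -/
def eps : E := D.τ D.π / D.π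

theorem eps_ne_zero : D.eps ≠ 0 := by
  have h : D.τ D.π ≠ 0 := (map_ne_zero D.τ).2 D.pi_ne_zero
  exact div_ne_zero h D.pi_ne_zero

/-- The entrywise action of `τ` on `GL₂(E)`. -/
def tauGL : GL (Fin 2) E →* GL (Fin 2) E :=
  Matrix.GeneralLinearGroup.map (D.τ : E →+* E)

theorem tauGL_apply (g : GL (Fin 2) E) (i j : Fin 2) : D.tauGL g i j = D.τ (g i j) := rfl

/-- The lift `v̇` of the affine Weyl group element of length `n + d`. -/
def vDot (n : ℕ) : GL (Fin 2) E :=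
  Matrix.GeneralLinearGroup.mkOfDetNeZero
    !![0, D.π ^ (-((((D.d + 1) / 2 + (n + 1) / 2 : ℕ)) : ℤ)); D.π ^ ((D.d + 1) / 2 + n / 2), 0]
    (by
      have h := D.pi_ne_zero
      rw [Matrix.det_fin_two_of, zero_mul, zero_sub]
      exact neg_ne_zero.2 (mul_ne_zero (zpow_ne_zero _ h) (pow_ne_zero _ h)))

/-- The lift `ẇ = [0, π^(-n); π^n, 0] · diag(ε^⌊n/2⌋, ε^(-⌊(n+1)/2⌋))` of the affine Weyl group
element of length `2n - 1`. -/
def wDot (n : ℕ) : GL (Fin 2) E :=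
  Matrix.GeneralLinearGroup.mkOfDetNeZero
    (!![0, D.π ^ (-(n : ℤ)); D.π ^ n, 0] *
      !![D.eps ^ (n / 2), 0; 0, D.eps ^ (-(((n + 1) / 2 : ℕ) : ℤ))])
    (by
      have h := D.pi_ne_zero
      have h' := D.eps_ne_zero
      rw [Matrix.det_mul, Matrix.det_fin_two_of, Matrix.det_fin_two_of, zero_mul, zero_sub,
        sub_zero]
      exact mul_ne_zero (neg_ne_zero.2 (mul_ne_zero (zpow_ne_zero _ h) (pow_ne_zero _ h)))
        (mul_ne_zero (pow_ne_zero _ h') (zpow_ne_zero _ h')))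

/-- The extended affine Deligne-Lusztig variety
`X_w^J(b) = {g J | g⁻¹ b τ(g) ∈ J w J} ⊆ GL₂(E) / J`. -/
def adlv (J : Subgroup (GL (Fin 2) E)) (w b : GL (Fin 2) E) : Set (GL (Fin 2) E ⧸ J) :=
  {y | ∃ g : GL (Fin 2) E, (g : GL (Fin 2) E ⧸ J) = y ∧
    g⁻¹ * b * D.tauGL g ∈ DoubleCoset.doubleCoset w (J : Set (GL (Fin 2) E)) J}

/-- The part `C_v(a₁ ≠ 0)` of the Schubert cell `C_v ⊆ GL₂(E) / I_E`: the alcoves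
`e₋(a) v̇ I_E` with `a ∈ 𝔭_E` and `a ∉ 𝔭_E ^ 2`. -/
def cellStar (n : ℕ) : Set (GL (Fin 2) E ⧸ iwahori E) :=
  {y | ∃ a : E, a ∈ maxPow E 1 ∧ a ∉ maxPow E 2 ∧
    y = ((eMinus a * D.vDot n : GL (Fin 2) E) : GL (Fin 2) E ⧸ iwahori E)}

/-- The part of `X_ẇ^m(1)` lying over `C_v(a₁ ≠ 0)`, that is, over the alcoves of the Schubert
cell whose vertex of departure from the building of `F` is `P_{1/2}`. -/
def adlvHalf (n m : ℕ) : Set (GL (Fin 2) E ⧸ levelSubgroup E m) :=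
  {y | y ∈ D.adlv (levelSubgroup E m) (D.wDot n) 1 ∧
    Subgroup.quotientMapOfLE (levelSubgroup_le_iwahori m) y ∈ D.cellStar n}

theorem tauGL_mem_levelSubgroup {m : ℕ} {g : GL (Fin 2) E} (hg : g ∈ levelSubgroup E m) :
    D.tauGL g ∈ levelSubgroup E m := by
  have key : ∀ {j : ℕ} {x : E}, x ∈ maxPow E j → D.τ x ∈ maxPow E j := by
    intro j x hx
    rw [mem_maxPow, D.valuation_tau]
    exact hx
  obtain ⟨a, b, c, d⟩ := hg
  have e : ((D.tauGL g : GL (Fin 2) E) : Matrix (Fin 2) (Fin 2) E) - 1 =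
      ((g : Matrix (Fin 2) (Fin 2) E) - 1).map D.τ := by
    ext i j
    rw [Matrix.sub_apply, D.tauGL_apply, Matrix.map_apply, Matrix.sub_apply, map_sub]
    congr 1
    rw [Matrix.one_apply]
    split_ifs <;> simp
  change InLevel m _
  rw [e]
  exact ⟨key a, key b, key c, key d⟩

theorem tauGL_mem_centerIwahori {g : GL (Fin 2) E} (hg : g ∈ centerIwahori E) :
    D.tauGL g ∈ centerIwahori E := by
  obtain ⟨z, hz, i, hi, rfl⟩ := Subgroup.mem_sup_of_normal_left.1 hg
  rw [map_mul]
  refine Subgroup.mul_mem_sup ?_ ?_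
  · rw [Subgroup.mem_center_iff] at hz ⊢
    intro x
    have hx : D.tauGL (D.tauGL x) = x := by
      ext k l
      rw [D.tauGL_apply, D.tauGL_apply, D.tau_tau]
    rw [← hx, ← map_mul, ← map_mul, hz]
  · obtain ⟨a, d, b, c⟩ := hi
    refine ⟨?_, ?_, ?_, ?_⟩
    · rw [D.tauGL_apply, D.valuation_tau, a]
    · rw [D.tauGL_apply, D.valuation_tau, d]
    · rw [mem_maxPow, D.tauGL_apply, D.valuation_tau]; exact b
    · rw [mem_maxPow, D.tauGL_apply, D.valuation_tau]; exact c

/-- Elements of `Z(E) I_E` act by `τ`-conjugation on double cosets of the level subgroup. -/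
theorem twisted_conj_mem {m : ℕ} {w g x : GL (Fin 2) E} (hg : g ∈ centerIwahori E)
    (hw : g⁻¹ * w * D.tauGL g ∈
      DoubleCoset.doubleCoset w (levelSubgroup E m : Set (GL (Fin 2) E)) (levelSubgroup E m))
    (hx : x ∈
      DoubleCoset.doubleCoset w (levelSubgroup E m : Set (GL (Fin 2) E)) (levelSubgroup E m)) :
    g⁻¹ * x * D.tauGL g ∈
      DoubleCoset.doubleCoset w (levelSubgroup E m : Set (GL (Fin 2) E)) (levelSubgroup E m) := by
  rw [DoubleCoset.mem_doubleCoset] at *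
  obtain ⟨j, hj, k, hk, rfl⟩ := hx
  obtain ⟨j', hj', k', hk', e⟩ := hw
  refine ⟨g⁻¹ * j * g * j', mul_mem (conj_mem_levelSubgroup_inv hg hj) hj',
    k' * ((D.tauGL g)⁻¹ * k * D.tauGL g),
    mul_mem hk' (conj_mem_levelSubgroup_inv (D.tauGL_mem_centerIwahori hg) hk), ?_⟩
  calc g⁻¹ * (j * w * k) * D.tauGL g
      = g⁻¹ * j * g * (g⁻¹ * w * D.tauGL g) * ((D.tauGL g)⁻¹ * k * D.tauGL g) := by group
    _ = _ := by rw [e]; group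

/-- The preimage in `Z(E) I_E` of the group `Γ̃`, that is, the stabilizer of the double coset
`J ẇ J`, `J = I_E^(2m+1)`, for the action `i ↦ J i⁻¹ ẇ τ(i) J`. -/
def gammaPre (n m : ℕ) : Subgroup (GL (Fin 2) E) where
  carrier := {i | i ∈ centerIwahori E ∧ i⁻¹ * D.wDot n * D.tauGL i ∈
    DoubleCoset.doubleCoset (D.wDot n) (levelSubgroup E m : Set (GL (Fin 2) E))
      (levelSubgroup E m)}
  one_mem' := ⟨one_mem _, by simpa using DoubleCoset.mem_doubleCoset_self _ _ _⟩
  mul_mem' := by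
    rintro g h ⟨hg, hg'⟩ ⟨hh, hh'⟩
    refine ⟨mul_mem hg hh, ?_⟩
    have := D.twisted_conj_mem hh hh' hg'
    rwa [show (g * h)⁻¹ * D.wDot n * D.tauGL (g * h) =
      h⁻¹ * (g⁻¹ * D.wDot n * D.tauGL g) * D.tauGL h by rw [map_mul]; group]
  inv_mem' := by
    rintro g ⟨hg, hg'⟩
    refine ⟨inv_mem hg, ?_⟩
    rw [DoubleCoset.mem_doubleCoset] at *
    obtain ⟨j, hj, k, hk, e⟩ := hg'
    refine ⟨g * j⁻¹ * g⁻¹, conj_mem_levelSubgroup hg (inv_mem hj),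
      D.tauGL g * k⁻¹ * (D.tauGL g)⁻¹,
      conj_mem_levelSubgroup (D.tauGL_mem_centerIwahori hg) (inv_mem hk), ?_⟩
    have e' : D.wDot n = j⁻¹ * (g⁻¹ * D.wDot n * D.tauGL g) * k⁻¹ := by rw [e]; group
    rw [map_inv, inv_inv]
    nth_rewrite 1 [e']
    group

theorem levelSubgroup_le_gammaPre (n m : ℕ) : levelSubgroup E m ≤ D.gammaPre n m := by
  intro j hj
  refine ⟨(le_sup_right : iwahori E ≤ _) (levelSubgroup_le_iwahori m hj), ?_⟩
  rw [DoubleCoset.mem_doubleCoset]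
  exact ⟨j⁻¹, inv_mem hj, D.tauGL j, D.tauGL_mem_levelSubgroup hj, rfl⟩

/-- The kernel of the projection from the preimage of `Γ̃` to `Γ̃ ⊆ Z(E) I_E / I_E^(2m+1)`. -/
def gammaKer (n m : ℕ) : Subgroup (D.gammaPre n m) :=
  (levelSubgroup E m).subgroupOf (D.gammaPre n m)

instance gammaKer_normal (n m : ℕ) : (D.gammaKer n m).Normal where
  conj_mem := by
    intro j hj g
    exact conj_mem_levelSubgroup g.2.1 hj

/-- The group `Γ̃ ⊆ Z(E) I_E / I_E^(2m+1)`. -/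
abbrev Gamma (n m : ℕ) : Type _ := D.gammaPre n m ⧸ D.gammaKer n m

/-- Right translation `x J ↦ x γ J` on `GL₂(E) / J`, `J = I_E^(2m+1)`, by an element `γ` of the
preimage of `Γ̃`. -/
def rightMul {n m : ℕ} (γ : D.gammaPre n m) :
    GL (Fin 2) E ⧸ levelSubgroup E m → GL (Fin 2) E ⧸ levelSubgroup E m :=
  Quotient.map' (fun x => x * γ) (by
    intro x y h
    rw [QuotientGroup.leftRel_apply] at h ⊢
    have := conj_mem_levelSubgroup_inv γ.2.1 h
    simpa [mul_assoc] using this)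

theorem rightMul_mk {n m : ℕ} (γ : D.gammaPre n m) (x : GL (Fin 2) E) :
    D.rightMul γ (x : GL (Fin 2) E ⧸ levelSubgroup E m) =
      ((x * γ : GL (Fin 2) E) : GL (Fin 2) E ⧸ levelSubgroup E m) := rfl

theorem rightMul_mul {n m : ℕ} (γ δ : D.gammaPre n m)
    (y : GL (Fin 2) E ⧸ levelSubgroup E m) :
    D.rightMul (γ * δ) y = D.rightMul δ (D.rightMul γ y) := by
  induction y using QuotientGroup.induction_on with
  | H x => rw [rightMul_mk, rightMul_mk, rightMul_mk, Subgroup.coe_mul, mul_assoc]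

theorem rightMul_one {n m : ℕ} (y : GL (Fin 2) E ⧸ levelSubgroup E m) :
    D.rightMul (1 : D.gammaPre n m) y = y := by
  induction y using QuotientGroup.induction_on with
  | H x => rw [rightMul_mk, Subgroup.coe_one, mul_one]

theorem rightMul_smul {n m : ℕ} (γ : D.gammaPre n m) (g : GL (Fin 2) E)
    (y : GL (Fin 2) E ⧸ levelSubgroup E m) :
    D.rightMul γ (g • y) = g • D.rightMul γ y := by
  induction y using QuotientGroup.induction_on with
  | H x => exact congrArg _ (mul_assoc g x γ)

/-- The variety `X_ẇ^m(1)` is stable under right translation by `Γ̃`. -/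
theorem rightMul_mem_adlv {n m : ℕ} (γ : D.gammaPre n m)
    {y : GL (Fin 2) E ⧸ levelSubgroup E m} (hy : y ∈ D.adlv (levelSubgroup E m) (D.wDot n) 1) :
    D.rightMul γ y ∈ D.adlv (levelSubgroup E m) (D.wDot n) 1 := by
  obtain ⟨x, rfl, hx⟩ := hy
  refine ⟨x * γ, rfl, ?_⟩
  have := D.twisted_conj_mem γ.2.1 γ.2.2 hx
  rwa [show (x * (γ : GL (Fin 2) E))⁻¹ * 1 * D.tauGL (x * γ) =
    (γ : GL (Fin 2) E)⁻¹ * (x⁻¹ * 1 * D.tauGL x) * D.tauGL γ by rw [map_mul]; group]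

/-- The smallest `Γ̃`-stable subset `X̃` of `X_ẇ^m(1)` containing the part over
`C_v(a₁ ≠ 0)`. -/
def adlvTilde (n m : ℕ) : Set (GL (Fin 2) E ⧸ levelSubgroup E m) :=
  {y | ∃ x ∈ D.adlvHalf n m, ∃ γ : D.gammaPre n m, y = D.rightMul γ x}

theorem rightMul_mem {n m : ℕ} (γ : D.gammaPre n m) {y : GL (Fin 2) E ⧸ levelSubgroup E m}
    (hy : y ∈ D.adlvTilde n m) : D.rightMul γ y ∈ D.adlvTilde n m := by
  obtain ⟨x, hx, δ, rfl⟩ := hy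
  exact ⟨x, hx, δ * γ, (D.rightMul_mul δ γ x).symm⟩

/-- The inclusion `GL₂(F) → GL₂(E)`. -/
def inclGL (_D : WildDatum F E) : GL (Fin 2) F →* GL (Fin 2) E :=
  Matrix.GeneralLinearGroup.map (algebraMap F E)

theorem tauGL_inclGL (g : GL (Fin 2) F) : D.tauGL (D.inclGL g) = D.inclGL g := by
  ext i j
  exact D.τ.commutes (g i j)

theorem inclGL_smul_mem_adlv {J : Subgroup (GL (Fin 2) E)} {w : GL (Fin 2) E}
    (g : GL (Fin 2) F) {y : GL (Fin 2) E ⧸ J} (hy : y ∈ D.adlv J w 1) :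
    D.inclGL g • y ∈ D.adlv J w 1 := by
  obtain ⟨x, rfl, hx⟩ := hy
  refine ⟨D.inclGL g * x, rfl, ?_⟩
  rw [map_mul, tauGL_inclGL]
  convert hx using 1
  group

/-- The subgroup `ι(Eˣ)` of `GL₂(F)`. -/
noncomputable def iotaRange : Subgroup (GL (Fin 2) F) :=
  (Units.map (D.iota : E →* Matrix (Fin 2) (Fin 2) F)).range

/-- The subgroup `ι(Eˣ) I_F` of `GL₂(F)`. -/
noncomputable def cuspGroup : Subgroup (GL (Fin 2) F) := D.iotaRange ⊔ iwahori F

theorem iwahori_le_cuspGroup : iwahori F ≤ D.cuspGroup := le_sup_right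

theorem wDot_apply (n : ℕ) : ∃ b c : E, (D.wDot n : Matrix (Fin 2) (Fin 2) E) = !![0, b; c, 0] := by
  refine ⟨D.π ^ (-(n : ℤ)) * D.eps ^ (-(((n + 1) / 2 : ℕ) : ℤ)), D.π ^ n * D.eps ^ (n / 2),
    (Matrix.mul_fin_two _ _ _ _ _ _ _ _).trans ?_⟩
  simp only [zero_mul, mul_zero, add_zero, zero_add]

/-- The torus element `i(t, 0) = diag(t, τ(t))`. -/
def torusElt (t : Eˣ) : GL (Fin 2) E := eZero t (Units.map (D.τ : E →* E) t)

theorem scalar_mem_center (s : Eˣ) : eZero s s ∈ Subgroup.center (GL (Fin 2) E) := by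
  rw [Subgroup.mem_center_iff]
  intro g
  ext i j
  fin_cases i <;> fin_cases j <;>
    simp [eZero, Matrix.GeneralLinearGroup.mkOfDetNeZero, Matrix.mul_apply, mul_comm]

/-- The diagonal unit matrix relating `diag(s, τ(s))` to the scalar `s`. -/
def torusUnit (s : Eˣ) : GL (Fin 2) E := eZero 1 (Units.map (D.τ : E →* E) s * s⁻¹)

theorem torusElt_eq (s : Eˣ) : D.torusElt s = eZero s s * D.torusUnit s := by
  ext i j
  fin_cases i <;> fin_cases j <;>
    simp [torusElt, torusUnit, eZero, Matrix.GeneralLinearGroup.mkOfDetNeZero, Matrix.mul_apply]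
  field_simp

theorem torusUnit_mem (s : Eˣ) : D.torusUnit s ∈ iwahori E := by
  have hs : valuation E (s : E) ≠ 0 := by simp
  refine ⟨?_, ?_, ?_, ?_⟩ <;>
    simp [torusUnit, eZero, Matrix.GeneralLinearGroup.mkOfDetNeZero, D.valuation_tau, hs]

theorem torusElt_mem (n m : ℕ) (s : Eˣ) : D.torusElt s ∈ D.gammaPre n m := by
  refine ⟨?_, ?_⟩
  · rw [torusElt_eq]
    exact Subgroup.mul_mem_sup (scalar_mem_center s) (D.torusUnit_mem s)
  · have : (D.torusElt s)⁻¹ * D.wDot n * D.tauGL (D.torusElt s) = D.wDot n := by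
      rw [mul_assoc, inv_mul_eq_iff_eq_mul]
      obtain ⟨b, c, h⟩ := D.wDot_apply n
      ext i j
      rw [Units.val_mul, Units.val_mul, h]
      fin_cases i <;> fin_cases j <;>
        simp [torusElt, eZero, Matrix.GeneralLinearGroup.mkOfDetNeZero, Matrix.mul_apply,
          tauGL_apply, D.tau_tau, mul_comm]
    rw [this]
    exact DoubleCoset.mem_doubleCoset_self _ _ _

/-- The element `i(t, 0)` of `Γ̃`, for `t ∈ Eˣ`. -/
def iDiag (n m : ℕ) (t : Eˣ) : D.Gamma n m :=
  QuotientGroup.mk ⟨D.torusElt t, D.torusElt_mem n m t⟩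

theorem cell_move (n : ℕ) {g : GL (Fin 2) E} {a : E} {s : Eˣ}
    (h1 : valuation E (g 0 0 + g 0 1 * a) = valuation E (s : E))
    (h2 : valuation E (g 1 0 + g 1 1 * a) = uniformizer E * valuation E (s : E))
    (h3 : valuation E (g : Matrix (Fin 2) (Fin 2) E).det = valuation E (s : E) ^ 2)
    (h4 : valuation E (g 0 1) * uniformizer E ≤ valuation E (s : E)) :
    ∃ a' : E, ∃ k ∈ iwahori E, valuation E a' = uniformizer E ∧
      g * (eMinus a * D.vDot n) = eMinus a' * D.vDot n * (eZero s s * k) := by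
  set p := g 0 0 + g 0 1 * a with hp
  have hs : valuation E (s : E) ≠ 0 := by simp
  have hp0 : p ≠ 0 := by
    intro h
    rw [h, map_zero] at h1
    exact hs h1.symm
  have hd0 : (g : Matrix (Fin 2) (Fin 2) E).det ≠ 0 := by
    intro h
    rw [h, map_zero] at h3
    exact pow_ne_zero 2 hs h3.symm
  have hpi := D.pi_ne_zero
  obtain ⟨A, B, hAB, hv⟩ : ∃ A B : ℕ, 2 ≤ A + B ∧
      (D.vDot n : Matrix (Fin 2) (Fin 2) E) = !![0, D.π ^ (-(A : ℤ)); D.π ^ B, 0] := by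
    refine ⟨_, _, ?_, rfl⟩
    obtain ⟨k, hk⟩ := D.odd_d
    omega
  let K : GL (Fin 2) E := Matrix.GeneralLinearGroup.mkOfDetNeZero
    !![(g : Matrix (Fin 2) (Fin 2) E).det / (p * s), 0; g 0 1 * D.π ^ (A + B) / s, p / s]
    (by
      rw [Matrix.det_fin_two_of, zero_mul, sub_zero]
      exact mul_ne_zero (div_ne_zero hd0 (mul_ne_zero hp0 s.ne_zero))
        (div_ne_zero hp0 s.ne_zero))
  refine ⟨(g 1 0 + g 1 1 * a) / p, K, ⟨?_, ?_, ?_, ?_⟩, ?_, ?_⟩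
  · change valuation E ((g : Matrix (Fin 2) (Fin 2) E).det / (p * s)) = 1
    rw [map_div₀, map_mul, h1, h3, pow_two, div_self (mul_ne_zero hs hs)]
  · change valuation E (p / s) = 1
    rw [map_div₀, h1, div_self hs]
  · change (0 : E) ∈ _
    exact zero_mem _
  · change g 0 1 * D.π ^ (A + B) / s ∈ _
    rw [mem_maxPow, pow_one, map_div₀, map_mul, map_pow, D.valuation_π,
      div_le_iff₀ (zero_lt_iff.2 hs)]
    obtain ⟨r, hr⟩ := Nat.exists_eq_add_of_le hAB
    rw [hr, show 2 + r = 1 + (r + 1) by ring, pow_add, pow_one, ← mul_assoc, mul_comm (uniformizer E)]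
    refine mul_le_mul' h4 ?_
    simpa using pow_le_pow_right_of_le_one' (uniformizer_lt_one (R := E)).le
      (show 1 ≤ r + 1 by omega)
  · rw [map_div₀, h1, h2, mul_div_assoc, div_self hs, mul_one]
  · have c1 : ∀ x : E, (eMinus x : Matrix (Fin 2) (Fin 2) E) = !![1, 0; x, 1] := fun _ => rfl
    have c2 : (eZero s s : Matrix (Fin 2) (Fin 2) E) = !![(s : E), 0; 0, (s : E)] := rfl
    have c3 : (K : Matrix (Fin 2) (Fin 2) E) =
      !![(g : Matrix (Fin 2) (Fin 2) E).det / (p * s), 0; g 0 1 * D.π ^ (A + B) / s, p / s] := rfl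
    have hdet := Matrix.det_fin_two (g : Matrix (Fin 2) (Fin 2) E)
    refine Units.ext ?_
    simp only [Units.val_mul]
    rw [hv, c1, c1, c2, c3, hdet, Matrix.eta_fin_two (g : Matrix (Fin 2) (Fin 2) E)]
    have hs0 := s.ne_zero
    simp only [Matrix.mul_fin_two, Matrix.of_apply, Matrix.cons_val', Matrix.cons_val_zero,
      Matrix.cons_val_one, Matrix.cons_val_fin_one]
    ext i j
    fin_cases i <;> fin_cases j <;> simp [zpow_neg, pow_add] <;> field_simp <;>
      (try simp only [hp]) <;> ring

theorem mem_uniformizer {a : E} (h1 : a ∈ maxPow E 1) (h2 : a ∉ maxPow E 2) :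
    valuation E a = uniformizer E := by
  have h0 : a ≠ 0 := by
    rintro rfl
    exact h2 (zero_mem _)
  obtain ⟨k, hk⟩ := valuation_eq_zpow E h0
  have h3 : k = 1 := by
    rw [mem_maxPow, hk, ← zpow_natCast, zpow_le_zpow_iff_right_of_lt_one₀ uniformizer_pos
      uniformizer_lt_one] at h1 h2
    push_cast at h1 h2
    omega
  rw [hk, h3, zpow_one]

theorem uniformizer_mem {a : E} (h : valuation E a = uniformizer E) :
    a ∈ maxPow E 1 ∧ a ∉ maxPow E 2 := by
  refine ⟨by rw [mem_maxPow, h, pow_one], ?_⟩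
  rw [mem_maxPow, h, not_le, pow_two]
  exact mul_lt_of_lt_one_right uniformizer_pos uniformizer_lt_one

theorem smul_mem_adlvTilde_of {n m : ℕ} {g : GL (Fin 2) F}
    (hg : ∀ a : E, valuation E a = uniformizer E → ∃ s : Eˣ,
      valuation E (D.inclGL g 0 0 + D.inclGL g 0 1 * a) = valuation E (s : E) ∧
      valuation E (D.inclGL g 1 0 + D.inclGL g 1 1 * a) = uniformizer E * valuation E (s : E) ∧
      valuation E (D.inclGL g : Matrix (Fin 2) (Fin 2) E).det = valuation E (s : E) ^ 2 ∧
      valuation E (D.inclGL g 0 1) * uniformizer E ≤ valuation E (s : E))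
    {y : GL (Fin 2) E ⧸ levelSubgroup E m} (hy : y ∈ D.adlvTilde n m) :
    D.inclGL g • y ∈ D.adlvTilde n m := by
  obtain ⟨x, ⟨hx1, a, ha1, ha2, hx2⟩, δ, rfl⟩ := hy
  induction x using QuotientGroup.induction_on with
  | H x =>
    obtain ⟨s, h1, h2, h3, h4⟩ := hg a (mem_uniformizer ha1 ha2)
    obtain ⟨a', k, hk, ha', e⟩ := D.cell_move n h1 h2 h3 h4
    have hx3 := QuotientGroup.eq.1 hx2.symm
    let γ : D.gammaPre n m := ⟨D.torusElt s, D.torusElt_mem n m s⟩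
    refine ⟨D.rightMul γ⁻¹ (D.inclGL g • (x : GL (Fin 2) E ⧸ levelSubgroup E m)),
      ⟨D.rightMul_mem_adlv _ (D.inclGL_smul_mem_adlv g hx1), a', (uniformizer_mem ha').1,
        (uniformizer_mem ha').2, ?_⟩, γ * δ, ?_⟩
    · change ((D.inclGL g * x * (D.torusElt s)⁻¹ : GL (Fin 2) E) : GL (Fin 2) E ⧸ iwahori E) = _
      refine (QuotientGroup.eq.2 ?_).symm
      have hc := Subgroup.mem_center_iff.1 (scalar_mem_center s)
      have e1 : (eMinus a' * D.vDot n)⁻¹ * (D.inclGL g * x * (D.torusElt s)⁻¹) =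
          k * ((eMinus a * D.vDot n)⁻¹ * x) * (D.torusUnit s)⁻¹ := by
        have e2 : D.inclGL g * x =
            eMinus a' * D.vDot n * (eZero s s * k) * ((eMinus a * D.vDot n)⁻¹ * x) := by
          rw [← e]; group
        rw [e2, torusElt_eq, mul_inv_rev]
        have e3 : k * ((eMinus a * D.vDot n)⁻¹ * x) * (D.torusUnit s)⁻¹ =
            eZero s s * (k * ((eMinus a * D.vDot n)⁻¹ * x) * (D.torusUnit s)⁻¹) *
              (eZero s s)⁻¹ := by
          rw [← hc]; group
        rw [e3]
        group
      rw [e1]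
      exact mul_mem (mul_mem hk hx3) (inv_mem (D.torusUnit_mem s))
    · rw [← D.rightMul_smul, D.rightMul_mul, ← D.rightMul_mul γ⁻¹ γ, inv_mul_cancel,
        D.rightMul_one]

theorem smul_mem_of_iwahori {n m : ℕ} {g : GL (Fin 2) F} (hg : g ∈ iwahori F)
    {y : GL (Fin 2) E ⧸ levelSubgroup E m} (hy : y ∈ D.adlvTilde n m) :
    D.inclGL g • y ∈ D.adlvTilde n m := by
  refine D.smul_mem_adlvTilde_of (fun a ha => ⟨1, ?_⟩) hy
  have a00 : valuation E (algebraMap F E (g 0 0)) = 1 := valuation_algebraMap_eq_one hg.1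
  have a11 : valuation E (algebraMap F E (g 1 1)) = 1 := valuation_algebraMap_eq_one hg.2.1
  have a01 : valuation E (algebraMap F E (g 0 1)) ≤ 1 :=
    valuation_algebraMap_le_one.2 (mem_maxPow_zero.1 hg.2.2.1)
  have a10 : valuation E (algebraMap F E (g 1 0)) ≤ uniformizer E ^ 2 := by
    rw [← D.valuation_varpi, valuation_algebraMap_le, D.valuation_ϖ]
    simpa [mem_maxPow] using hg.2.2.2
  have hu : uniformizer E ^ 2 < uniformizer E := by
    rw [pow_two]
    exact mul_lt_of_lt_one_right uniformizer_pos uniformizer_lt_one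
  change valuation E (algebraMap F E (g 0 0) + algebraMap F E (g 0 1) * a) = _ ∧
    valuation E (algebraMap F E (g 1 0) + algebraMap F E (g 1 1) * a) = _ ∧
    _ ∧ valuation E (algebraMap F E (g 0 1)) * uniformizer E ≤ _
  simp only [Units.val_one, map_one, mul_one, one_pow]
  refine ⟨valuation_add_eq_one a00 ?_, ?_, ?_, ?_⟩
  · rw [map_mul, ha]
    exact (mul_le_of_le_one_left' a01).trans_lt uniformizer_lt_one
  · rw [Valuation.map_add_eq_of_lt_right, map_mul, a11, one_mul, ha]
    rw [map_mul, a11, one_mul, ha]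
    exact a10.trans_lt hu
  · rw [Matrix.det_fin_two, sub_eq_add_neg]
    change valuation E (algebraMap F E (g 0 0) * algebraMap F E (g 1 1) +
      -(algebraMap F E (g 0 1) * algebraMap F E (g 1 0))) = 1
    refine valuation_add_eq_one (by rw [map_mul, a00, a11, one_mul]) ?_
    rw [Valuation.map_neg, map_mul]
    exact (mul_le_of_le_one_left' a01).trans_lt ((a10.trans_lt hu).trans uniformizer_lt_one)
  · exact (mul_le_of_le_one_left' a01).trans uniformizer_lt_one.le

theorem smul_mem_of_iota {n m : ℕ} (x : Eˣ) {g : GL (Fin 2) F}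
    (hg : (g : Matrix (Fin 2) (Fin 2) F) = D.iota x)
    {y : GL (Fin 2) E ⧸ levelSubgroup E m} (hy : y ∈ D.adlvTilde n m) :
    D.inclGL g • y ∈ D.adlvTilde n m := by
  refine D.smul_mem_adlvTilde_of (fun a ha => ⟨x, ?_⟩) hy
  obtain ⟨α, β, hx⟩ := D.exists_comb (x : E)
  rw [hx, D.iota_comb] at hg
  have hvx := D.valuation_comb α β D.valuation_π
  have g00 : (D.inclGL g : Matrix (Fin 2) (Fin 2) E) 0 0 = algebraMap F E (α + β * D.Δ) := by
    change algebraMap F E ((g : Matrix (Fin 2) (Fin 2) F) 0 0) = _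
    rw [hg]; rfl
  have g01 : (D.inclGL g : Matrix (Fin 2) (Fin 2) E) 0 1 = algebraMap F E β := by
    change algebraMap F E ((g : Matrix (Fin 2) (Fin 2) F) 0 1) = _
    rw [hg]; rfl
  have g10 : (D.inclGL g : Matrix (Fin 2) (Fin 2) E) 1 0 = algebraMap F E (β * D.ϖ) := by
    change algebraMap F E ((g : Matrix (Fin 2) (Fin 2) F) 1 0) = _
    rw [hg]; rfl
  have g11 : (D.inclGL g : Matrix (Fin 2) (Fin 2) E) 1 1 = algebraMap F E α := by
    change algebraMap F E ((g : Matrix (Fin 2) (Fin 2) F) 1 1) = _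
    rw [hg]; rfl
  have ha0 : a ≠ 0 := by
    rintro rfl
    rw [map_zero] at ha
    exact uniformizer_ne_zero ha.symm
  rw [Matrix.det_fin_two, g00, g01, g10, g11, hx]
  simp only [map_add, map_mul]
  refine ⟨?_, ?_, ?_, ?_⟩
  · have e : algebraMap F E α + algebraMap F E β * algebraMap F E D.Δ + algebraMap F E β * a =
        algebraMap F E α + algebraMap F E β * (a + algebraMap F E D.Δ) := by ring
    rw [e, D.valuation_comb α β (D.valuation_pi_add ha), hvx]
  · have hy' : valuation E (algebraMap F E D.ϖ / a) = uniformizer E := by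
      rw [map_div₀, ha, D.valuation_varpi, pow_two, mul_div_assoc,
        div_self uniformizer_ne_zero, mul_one]
    have e : algebraMap F E β * algebraMap F E D.ϖ + algebraMap F E α * a =
        a * (algebraMap F E α + algebraMap F E β * (algebraMap F E D.ϖ / a)) := by
      field_simp
      ring
    rw [e, Valuation.map_mul, ha, D.valuation_comb α β hy', hvx]
  · have e : (algebraMap F E α + algebraMap F E β * algebraMap F E D.Δ) * algebraMap F E α -
        algebraMap F E β * (algebraMap F E β * algebraMap F E D.ϖ) =
        (algebraMap F E α + algebraMap F E β * D.π) *
          D.τ (algebraMap F E α + algebraMap F E β * D.π) := by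
      rw [map_add, map_mul, AlgEquiv.commutes, AlgEquiv.commutes, D.tau_pi]
      have h2 := D.two_eq_zero
      linear_combination (-(algebraMap F E β) ^ 2) * D.equation -
        algebraMap F E α * algebraMap F E β * D.π * h2
    rw [e, Valuation.map_mul, D.valuation_tau, pow_two]
  · rw [hvx]
    exact le_max_right _ _

/-- The subset `X̃` is stable under `ι(Eˣ) I_F`. -/
theorem smul_mem {n m : ℕ} {g : GL (Fin 2) F} (hg : g ∈ D.cuspGroup)
    {y : GL (Fin 2) E ⧸ levelSubgroup E m} (hy : y ∈ D.adlvTilde n m) :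
    D.inclGL g • y ∈ D.adlvTilde n m := by
  let S : Subgroup (GL (Fin 2) F) :=
    { carrier := {g | (∀ y ∈ D.adlvTilde n m, D.inclGL g • y ∈ D.adlvTilde n m) ∧
        ∀ y ∈ D.adlvTilde n m, D.inclGL g⁻¹ • y ∈ D.adlvTilde n m}
      one_mem' := by
        constructor <;> intro y hy <;> simpa using hy
      mul_mem' := by
        rintro g h ⟨hg, hg'⟩ ⟨hh, hh'⟩
        constructor <;> intro y hy
        · rw [map_mul, mul_smul]
          exact hg _ (hh _ hy)
        · rw [_root_.mul_inv_rev, map_mul, mul_smul]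
          exact hh' _ (hg' _ hy)
      inv_mem' := by
        rintro g ⟨hg, hg'⟩
        exact ⟨hg', by simpa using hg⟩ }
  have h1 : D.iotaRange ≤ S := by
    intro g hg
    refine ⟨fun y hy => ?_, fun y hy => ?_⟩
    · obtain ⟨x, rfl⟩ := hg
      exact D.smul_mem_of_iota x rfl hy
    · obtain ⟨x, hx⟩ := inv_mem hg
      rw [← hx]
      exact D.smul_mem_of_iota x rfl hy
  have h2 : iwahori F ≤ S := fun g hg =>
    ⟨fun y hy => D.smul_mem_of_iwahori hg hy, fun y hy => D.smul_mem_of_iwahori (inv_mem hg) hy⟩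
  exact (sup_le h1 h2 hg).1 y hy

/-- The action of `ι(Eˣ) I_F` on `X̃` by left multiplication. -/
noncomputable instance instMulActionTilde (n m : ℕ) :
    MulAction D.cuspGroup (D.adlvTilde n m) where
  smul g y := ⟨D.inclGL g • (y : GL (Fin 2) E ⧸ levelSubgroup E m), D.smul_mem g.2 y.2⟩
  one_smul y := Subtype.ext (by
    change D.inclGL (1 : GL (Fin 2) F) • (y : GL (Fin 2) E ⧸ levelSubgroup E m) = y
    rw [map_one, one_smul])
  mul_smul g h y := Subtype.ext (by
    change D.inclGL ((g : GL (Fin 2) F) * h) • (y : GL (Fin 2) E ⧸ levelSubgroup E m) =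
      D.inclGL g • D.inclGL h • (y : GL (Fin 2) E ⧸ levelSubgroup E m)
    rw [map_mul, mul_smul])

/-- Right translation by an element of the preimage of `Γ̃`, as a self-map of `X̃`. -/
def rightMulTilde {n m : ℕ} (γ : D.gammaPre n m) (y : D.adlvTilde n m) : D.adlvTilde n m :=
  ⟨D.rightMul γ y, D.rightMul_mem γ y.2⟩

section Cohomology

variable (k : Type*) [Field k] (n m : ℕ)

/-- The space `H_c^0(X̃, k)` of compactly supported (that is, finitely supported) functions on the
discrete set `X̃`. -/
abbrev HcZero : Type _ := D.adlvTilde n m →₀ k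

/-- The action `(g f)(x) = f(g⁻¹ x)` of `ι(Eˣ) I_F` on `H_c^0(X̃, k)`. -/
noncomputable def leftRep : Representation k D.cuspGroup (D.HcZero k n m) where
  toFun g := Finsupp.lmapDomain k k (fun y => g • y)
  map_one' := by
    ext y
    simp
  map_mul' g h := by
    ext y
    simp [mul_smul]

variable {k n m}

/-- The action of `γ` on `H_c^0(X̃, k)` induced by right translation; it maps the indicator
function of `y` to the one of `y γ`. -/
noncomputable def rightOp (γ : D.gammaPre n m) : D.HcZero k n m →ₗ[k] D.HcZero k n m :=
  Finsupp.lmapDomain k k (D.rightMulTilde γ)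

/-- The kernel of the projection of `H_c^0(X̃, k)` to its `χ`-isotypic quotient. -/
noncomputable def isotypicKer (χ : D.Gamma n m →* kˣ) : Submodule k (D.HcZero k n m) :=
  Submodule.span k {v | ∃ (γ : D.gammaPre n m) (f : D.HcZero k n m),
    v = D.rightOp γ f - (χ (QuotientGroup.mk γ) : k) • f}

theorem isotypicKer_le (χ : D.Gamma n m →* kˣ) (g : D.cuspGroup) :
    D.isotypicKer χ ≤ (D.isotypicKer χ).comap (D.leftRep k n m g) := by
  refine Submodule.span_le.2 ?_
  rintro v ⟨γ, f, rfl⟩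
  refine Submodule.subset_span ⟨γ, D.leftRep k n m g f, ?_⟩
  rw [map_sub, map_smul]
  congr 1
  rw [← LinearMap.comp_apply, ← LinearMap.comp_apply]
  congr 1
  ext1 y
  refine LinearMap.ext fun c => ?_
  simp only [leftRep, rightOp, MonoidHom.coe_mk, OneHom.coe_mk, LinearMap.comp_apply,
    Finsupp.lsingle_apply, Finsupp.lmapDomain_apply, Finsupp.mapDomain_single]
  congr 1
  exact Subtype.ext (D.rightMul_smul γ (D.inclGL g) y).symm

/-- The space `V_χ = H_c^0(X̃, k)[χ]`, the largest quotient of `H_c^0(X̃, k)` on which `Γ̃` acts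
through the character `χ`. -/
abbrev VSpace (χ : D.Gamma n m →* kˣ) : Type _ := D.HcZero k n m ⧸ D.isotypicKer χ

/-- The representation `Ξ_χ` of `ι(Eˣ) I_F` on `V_χ`. -/
noncomputable def Xi (χ : D.Gamma n m →* kˣ) : Representation k D.cuspGroup (D.VSpace χ) :=
  (D.leftRep k n m).quotient (D.isotypicKer χ) (D.isotypicKer_le χ)

end Cohomology

theorem lowerUnipotent_le_cuspGroup : lowerUnipotent F 1 ≤ D.cuspGroup :=
  lowerUnipotent_le_iwahori.trans D.iwahori_le_cuspGroup

theorem borel_inf_iwahori_le_cuspGroup : lowerBorel F ⊓ iwahori F ≤ D.cuspGroup :=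
  inf_le_right.trans D.iwahori_le_cuspGroup

end WildDatum
end Datum

/-- The group of `j`-units `U_L^j`: units of `𝒪_L` congruent to one modulo `𝔭_L ^ j`. -/
def unitLevel (L : Type*) [Field L] [ValuativeRel L] [TopologicalSpace L]
    [IsNonarchimedeanLocalField L] (j : ℕ) : Set Lˣ :=
  {u | valuation L (u : L) = 1 ∧ (u : L) - 1 ∈ maxPow L j}

/-- The level of `θ` is `m`: the smallest `j ≥ 0` such that `θ` is trivial on `U_L^(j+1)`. -/
def HasLevel {L : Type*} [Field L] [ValuativeRel L] [TopologicalSpace L]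
    [IsNonarchimedeanLocalField L] {k : Type*} [Field k] (θ : Lˣ →* kˣ) (m : ℕ) : Prop :=
  IsLeast {j : ℕ | ∀ u ∈ unitLevel L (j + 1), θ u = 1} m

/-- The one-dimensional representation attached to a character. -/
def charRep {G k : Type*} [Group G] [Field k] (ψ : G →* kˣ) : Representation k G k where
  toFun g := (ψ g : k) • LinearMap.id
  map_one' := by simp [Module.End.one_eq_id]
  map_mul' g h := by
    ext
    simp [mul_comm]

/-- The characters of `N^1` that are trivial on `N^(j+1)` and nontrivial on `N^j`. -/
def unipotentChars (F k : Type*) [Field F] [ValuativeRel F] [TopologicalSpace F]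
    [IsNonarchimedeanLocalField F] [Field k] (j : ℕ) : Set (lowerUnipotent F 1 →* kˣ) :=
  {ψ | (∀ g : lowerUnipotent F 1, (g : GL (Fin 2) F) ∈ lowerUnipotent F (j + 1) → ψ g = 1) ∧
    ∃ g : lowerUnipotent F 1, (g : GL (Fin 2) F) ∈ lowerUnipotent F j ∧ ψ g ≠ 1}

end WildGL2

namespace WildGL2

set_option linter.unusedSectionVars false

/-! ### Integer valuations and the powers of the maximal ideal -/

section Iwahori

variable {L : Type*} [Field L] [ValuativeRel L] [TopologicalSpace L]
  [IsNonarchimedeanLocalField L]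

/-! Write `g_a` for `cellPoint n a`, where `a` is a uniformizer of `E`. This explicit matrix
satisfies `g_a⁻¹ τ(g_a) = ẇ` exactly and lies in the alcove `e₋(a) v̇ I_E`. Any other point of `X`
in that alcove has the form `g_a γ J` with `γ ∈ Γ̃`, so `V_χ` is spanned by the classes `[a]` of the
`g_a` (`span_cellVec`). They are nonzero because `Γ̃` acts freely (`tildeVec_ne_zero`).

The action is easy to read on these vectors. In characteristic 2 the trace vanishes on `F`, which
gives `e₋(u) g_a = g_{a+u}` for `u ∈ 𝔭_F`; and `diag(1, x)` sends `[a]` to a multiple of `[xa]`. The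
kernel of the trace being exactly `F`, any two uniformizers are related by such an affine map
(`exists_affine`). If `a ≡ b` modulo `𝔭_E^(n+d+1)`, the alcoves agree and `[a]`, `[b]` are
proportional.

Conductor: for `u ∈ 𝔭_F^(n+d)` the matrix `g_a⁻¹ e₋(u) g_a` is `diag(t, τ(t))` times `[1, q; ϖ^n
τ(q), 1]`, with `t = 1 + u / tr(a)` and `q ∈ 𝔭_E^d`. Modulo `J` the second factor is a commutator
with `diag(π, τ(π))`, so every character of `Γ̃` ignores it (`apply_quatUnit`) and `e₋(u)`
multiplies `[a]` by `θ(t)`. Since `tr(a)` has valuation exactly `d + 1`, `t` lies in `U_E^m`. As `θ`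
has level `m`, `N^(n+d+1)` acts trivially; as `m` is even, these `t` fill `U_E^m` modulo
`U_E^(m+1)`, and `N^(n+d)` acts nontrivially on every `[a]`.

Multiplicity one (`exists_proj_cellVec_eq_smul`): let `P` project to the `ψ`-eigenspace. Up to a
translation, any `[b]` with `P[b] ≠ 0` may be replaced by `[xa]`, `x` a unit. If `xa` and `a` are
not congruent modulo `𝔭_E^(n+d+1)`, conjugation by `diag(1, x)` compares the scalars of `e₋(y)` on
`[a]` and of `e₋(xy)` on `[xa]`, and forces `ψ` to be trivial on `N^(n+d)`. So the `P[b]` span a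
line.

Finally `diag(1, x)`, `x ∈ 𝒪_F^×`, permutes the characters of exact conductor transitively
(`exists_unit_mul_eq`). So all of them occur, and any nonzero `B ∩ I_F`-stable subspace contains
every eigenline (`equiv_directSum_and_isIrreducible`). -/

theorem mem_maxPow_of_eq_zpow {x : L} {k : ℤ} {j : ℕ} (hx : valuation L x = uniformizer L ^ k)
    (h : (j : ℤ) ≤ k) : x ∈ maxPow L j := by
  rw [mem_maxPow, hx, ← zpow_natCast]
  exact (zpow_le_zpow_iff_right_of_lt_one₀ uniformizer_pos uniformizer_lt_one).2 h

theorem mem_maxPow_iff_of_eq_zpow {x : L} {k : ℤ} {j : ℕ}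
    (hx : valuation L x = uniformizer L ^ k) : x ∈ maxPow L j ↔ (j : ℤ) ≤ k := by
  rw [mem_maxPow, hx, ← zpow_natCast]
  exact zpow_le_zpow_iff_right_of_lt_one₀ uniformizer_pos uniformizer_lt_one

/-- Multiplying an element of `𝔭 ^ i` by an element of valuation `k`. -/
theorem mul_mem_maxPow_of_zpow {x y : L} {i j : ℕ} {k : ℤ} (hx : x ∈ maxPow L i)
    (hy : valuation L y = uniformizer L ^ k) (h : (j : ℤ) ≤ i + k) : x * y ∈ maxPow L j := by
  by_cases hx0 : x = 0
  · rw [hx0, zero_mul]; exact zero_mem _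
  obtain ⟨l, hl⟩ := valuation_eq_zpow L hx0
  rw [mem_maxPow_iff_of_eq_zpow hl] at hx
  refine mem_maxPow_of_eq_zpow (k := l + k) ?_ (by omega)
  rw [map_mul, hl, hy, zpow_add₀ uniformizer_ne_zero]

theorem valuation_one_add {x : L} (hx : x ∈ maxPow L 1) : valuation L (1 + x) = 1 :=
  valuation_add_eq_one (map_one _) (mem_maxPow_one.1 hx)

end Iwahori

/-! ### Valuations and traces in the ramified quadratic extension -/

namespace WildDatum

variable {F E : Type*} [Field F] [ValuativeRel F] [TopologicalSpace F]
  [IsNonarchimedeanLocalField F] [Field E] [ValuativeRel E] [TopologicalSpace E]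
  [IsNonarchimedeanLocalField E] [Algebra F E] [ValuativeExtension F E]

theorem valuation_algebraMap_zpow (D : WildDatum F E) {x : F} {k : ℤ}
    (hx : valuation F x = uniformizer F ^ k) :
    valuation E (algebraMap F E x) = uniformizer E ^ (2 * k) := by
  rw [← ValuativeExtension.mapValueGroupWithZero_valuation, hx, map_zpow₀, ← D.valuation_ϖ,
    ValuativeExtension.mapValueGroupWithZero_valuation, D.valuation_varpi, _root_.zpow_mul]
  norm_cast

theorem algebraMap_mem_maxPow (D : WildDatum F E) {x : F} {i j : ℕ} (h : i ≤ 2 * j)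
    (hx : x ∈ maxPow F j) :
    algebraMap F E x ∈ maxPow E i := by
  by_cases hx0 : x = 0
  · rw [hx0, map_zero]; exact zero_mem _
  obtain ⟨k, hk⟩ := valuation_eq_zpow F hx0
  rw [mem_maxPow_iff_of_eq_zpow hk] at hx
  exact mem_maxPow_of_eq_zpow (D.valuation_algebraMap_zpow hk) (by omega)

/-- Elements of `F` have even valuation in `E`, so an odd bound `i` improves to `i + 1` for free. -/
theorem mem_maxPow_of_algebraMap (D : WildDatum F E) {x : F} {i j : ℕ} (h : 2 * j ≤ i + 1)
    (hx : algebraMap F E x ∈ maxPow E i) : x ∈ maxPow F j := by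
  by_cases hx0 : x = 0
  · rw [hx0]; exact zero_mem _
  obtain ⟨k, hk⟩ := valuation_eq_zpow F hx0
  rw [mem_maxPow_iff_of_eq_zpow (D.valuation_algebraMap_zpow hk)] at hx
  exact mem_maxPow_of_eq_zpow hk (by omega)

theorem tau_mem_maxPow (D : WildDatum F E) [CharP F 2] {x : E} {j : ℕ} (hx : x ∈ maxPow E j) :
    D.τ x ∈ maxPow E j := by
  rwa [mem_maxPow, D.valuation_tau]

variable [CharP F 2] (D : WildDatum F E)

theorem pi_mul_tau_pi : D.π * D.τ D.π = algebraMap F E D.ϖ := by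
  rw [D.tau_pi]
  have := D.equation
  linear_combination this - algebraMap F E D.ϖ * D.two_eq_zero

theorem tau_pi_ne_zero : D.τ D.π ≠ 0 := (map_ne_zero D.τ).2 D.pi_ne_zero

theorem valuation_tau_pi : valuation E (D.τ D.π) = uniformizer E := by
  rw [D.valuation_tau, D.valuation_π]

theorem valuation_algebraMap_delta :
    valuation E (algebraMap F E D.Δ) = uniformizer E ^ ((D.d : ℤ) + 1) := by
  have h : valuation F D.Δ = uniformizer F ^ (((D.d + 1) / 2 : ℕ) : ℤ) := by
    rw [D.valuation_Δ, zpow_natCast]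
  rw [D.valuation_algebraMap_zpow h]
  obtain ⟨k, hk⟩ := D.odd_d
  congr 1
  omega

/-- The trace of an element of `E`. -/
noncomputable def trace (a : E) : F := (D.exists_comb a).choose_spec.choose * D.Δ

theorem algebraMap_trace (a : E) : algebraMap F E (D.trace a) = a + D.τ a := by
  have h := (D.exists_comb a).choose_spec.choose_spec
  rw [trace]
  generalize (D.exists_comb a).choose_spec.choose = β at *
  generalize (D.exists_comb a).choose = α at *
  rw [h, map_add, map_mul (D.τ), AlgEquiv.commutes, AlgEquiv.commutes, D.tau_pi, map_mul]
  linear_combination -(algebraMap F E α + algebraMap F E β * D.π) * D.two_eq_zero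

/-- In `a = α + βπ` the term `α` has even valuation, so the valuation `1` of `a` comes from `βπ` and
`β` is a unit. The trace is `βΔ`, whose valuation therefore does not depend on `a`. -/
theorem valuation_trace {a : E} (ha : valuation E a = uniformizer E) :
    valuation E (algebraMap F E (D.trace a)) = uniformizer E ^ ((D.d : ℤ) + 1) := by
  have h := (D.exists_comb a).choose_spec.choose_spec
  rw [trace]
  generalize (D.exists_comb a).choose_spec.choose = β at *
  generalize (D.exists_comb a).choose = α at *
  have h2 := D.valuation_comb α β D.valuation_π
  rw [← h, ha] at h2
  have h3 : valuation E (algebraMap F E α) ≠ uniformizer E := by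
    intro h4
    have h0 : α ≠ 0 := by
      rintro rfl
      rw [map_zero, map_zero] at h4
      exact uniformizer_ne_zero h4.symm
    obtain ⟨k, hk⟩ := D.valuation_algebraMap h0
    rw [h4, ← zpow_one (uniformizer E), ← _root_.zpow_mul] at hk
    have := zpow_uniformizer_inj hk
    omega
  have h4 : valuation E (algebraMap F E β) * uniformizer E = uniformizer E := by
    rcases max_choice (valuation E (algebraMap F E α))
      (valuation E (algebraMap F E β) * uniformizer E) with h5 | h5
    · exact absurd (h2.trans h5).symm h3
    · exact (h2.trans h5).symm
  have h5 : valuation E (algebraMap F E β) = 1 :=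
    (mul_eq_right₀ uniformizer_ne_zero).1 h4
  rw [map_mul, map_mul, h5, one_mul, D.valuation_algebraMap_delta]

theorem trace_ne_zero {a : E} (ha : valuation E a = uniformizer E) :
    algebraMap F E (D.trace a) ≠ 0 := by
  intro h
  have := D.valuation_trace ha
  rw [h, map_zero] at this
  exact zpow_ne_zero _ uniformizer_ne_zero this.symm

/-- The trace of `u ∈ F` is `2u = 0`. This is what makes the points `cellPoint n a` compatible with
translations by `F`. -/
theorem trace_add_algebraMap (a : E) (u : F) : D.trace (a + algebraMap F E u) = D.trace a := by
  apply (algebraMap F E).injective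
  rw [algebraMap_trace, algebraMap_trace, map_add, AlgEquiv.commutes]
  linear_combination algebraMap F E u * D.two_eq_zero

theorem trace_algebraMap_mul (a : E) (x : F) :
    D.trace (algebraMap F E x * a) = x * D.trace a := by
  apply (algebraMap F E).injective
  rw [algebraMap_trace, map_mul, map_mul, algebraMap_trace, AlgEquiv.commutes]
  ring

/-- With first row `(x, y)` the determinant is `xy(a - τ(a))`, which in characteristic 2 is `xy
tr(a)`. -/
theorem det_ne_zero_of_trace {n : ℕ} {a : E} (ha : valuation E a = uniformizer E) :
    (!![D.π ^ ((D.d + 1) / 2 + n / 2) / algebraMap F E (D.trace a),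
        D.τ D.π ^ ((D.d + 1) / 2) / D.π ^ ((n + 1) / 2) / algebraMap F E (D.trace a);
      D.π ^ ((D.d + 1) / 2 + n / 2) / algebraMap F E (D.trace a) * D.τ a,
        D.τ D.π ^ ((D.d + 1) / 2) / D.π ^ ((n + 1) / 2) / algebraMap F E (D.trace a) * a] :
        Matrix (Fin 2) (Fin 2) E).det ≠ 0 := by
  have h := D.trace_ne_zero ha
  rw [Matrix.det_fin_two_of]
  have e : ∀ x y : E, x * (y * a) - y * (x * D.τ a) = x * y * algebraMap F E (D.trace a) := by
    intro x y
    rw [algebraMap_trace]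
    linear_combination -(x * y * D.τ a) * D.two_eq_zero
  rw [e]
  have h1 := D.pi_ne_zero
  have h2 := D.tau_pi_ne_zero
  simp [h, h1, h2]

end WildDatum
-- Explicit points of `X` over the alcoves
theorem mkOfDetNeZero_coe {L : Type*} [Field L] (M : Matrix (Fin 2) (Fin 2) L) (h : M.det ≠ 0) :
    (Matrix.GeneralLinearGroup.mkOfDetNeZero M h : Matrix (Fin 2) (Fin 2) L) = M := rfl

theorem eMinus_add {L : Type*} [Field L] [ValuativeRel L] [TopologicalSpace L]
    [IsNonarchimedeanLocalField L] (a b : L) : eMinus (a + b) = eMinus a * eMinus b := by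
  refine Units.ext ?_
  rw [Units.val_mul, eMinus, eMinus, eMinus, mkOfDetNeZero_coe, mkOfDetNeZero_coe,
    mkOfDetNeZero_coe, Matrix.mul_fin_two]
  simp

namespace WildDatum

variable {F E : Type*} [Field F] [ValuativeRel F] [TopologicalSpace F]
  [IsNonarchimedeanLocalField F] [Field E] [ValuativeRel E] [TopologicalSpace E]
  [IsNonarchimedeanLocalField E] [Algebra F E] [ValuativeExtension F E]
  [CharP F 2] (D : WildDatum F E)

/-- The powers of `ε` in `ẇ` serve to split each `π^n` into powers of `π` and `τ(π)`. In this form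
`ẇ τ(ẇ) = 1` is visible, a necessary condition for solving `g⁻¹ τ(g) = ẇ`. -/
theorem coe_wDot (n : ℕ) : (D.wDot n : Matrix (Fin 2) (Fin 2) E) =
    !![0, (D.π ^ (n / 2) * D.τ D.π ^ ((n + 1) / 2))⁻¹;
      D.π ^ ((n + 1) / 2) * D.τ D.π ^ (n / 2), 0] := by
  have h1 := D.pi_ne_zero
  have h2 := D.tau_pi_ne_zero
  have e : (D.wDot n : Matrix (Fin 2) (Fin 2) E) = !![0, D.π ^ (-(n : ℤ)); D.π ^ n, 0] *
    !![D.eps ^ (n / 2), 0; 0, D.eps ^ (-(((n + 1) / 2 : ℕ) : ℤ))] := rfl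
  have hn : n = n / 2 + (n + 1) / 2 := by omega
  rw [e, Matrix.mul_fin_two]
  simp only [zpow_neg, zpow_natCast, eps, div_pow]
  generalize (n + 1) / 2 = j at *
  generalize n / 2 = i at *
  subst hn
  ext k l
  fin_cases k <;> fin_cases l <;> simp [pow_add] <;> field_simp

theorem coe_vDot (n : ℕ) : (D.vDot n : Matrix (Fin 2) (Fin 2) E) =
    !![0, (D.π ^ ((D.d + 1) / 2 + (n + 1) / 2))⁻¹; D.π ^ ((D.d + 1) / 2 + n / 2), 0] := by
  change !![0, D.π ^ (-((((D.d + 1) / 2 + (n + 1) / 2 : ℕ)) : ℤ)); D.π ^ ((D.d + 1) / 2 + n / 2), 0]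
    = _
  rw [zpow_neg, zpow_natCast]

/-- A representative `g` of the alcove `e₋(a) v̇ I_E` with `g⁻¹ τ(g) = ẇ`. -/
noncomputable def cellPoint (n : ℕ) (a : E) (ha : valuation E a = uniformizer E) : GL (Fin 2) E :=
  Matrix.GeneralLinearGroup.mkOfDetNeZero _ (D.det_ne_zero_of_trace (n := n) ha)

theorem coe_cellPoint (n : ℕ) (a : E) (ha : valuation E a = uniformizer E) :
    (D.cellPoint n a ha : Matrix (Fin 2) (Fin 2) E) =
    !![D.π ^ ((D.d + 1) / 2 + n / 2) / algebraMap F E (D.trace a),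
        D.τ D.π ^ ((D.d + 1) / 2) / D.π ^ ((n + 1) / 2) / algebraMap F E (D.trace a);
      D.π ^ ((D.d + 1) / 2 + n / 2) / algebraMap F E (D.trace a) * D.τ a,
        D.τ D.π ^ ((D.d + 1) / 2) / D.π ^ ((n + 1) / 2) / algebraMap F E (D.trace a) * a] := rfl

theorem coe_tauGL (g : GL (Fin 2) E) : (D.tauGL g : Matrix (Fin 2) (Fin 2) E) =
    !![D.τ (g 0 0), D.τ (g 0 1); D.τ (g 1 0), D.τ (g 1 1)] := by
  rw [Matrix.eta_fin_two (D.tauGL g : Matrix (Fin 2) (Fin 2) E)]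
  rfl

/-- Both `τ` and right multiplication by `ẇ` exchange the two columns `(1, τ(a))` and `(1, a)` up to
scalars; since `tr(a)` is fixed, only the exponents of `π` and `τ(π)` have to match. -/
theorem tauGL_cellPoint (n : ℕ) (a : E) (ha : valuation E a = uniformizer E) :
    D.tauGL (D.cellPoint n a ha) = D.cellPoint n a ha * D.wDot n := by
  have h1 := D.pi_ne_zero
  have h2 := D.tau_pi_ne_zero
  have h3 := D.trace_ne_zero ha
  refine Units.ext ?_
  rw [Units.val_mul, coe_wDot, coe_tauGL, coe_cellPoint]
  simp only [Matrix.of_apply, Matrix.cons_val', Matrix.cons_val_zero,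
      Matrix.cons_val_one, Matrix.cons_val_fin_one, map_mul, map_div₀, map_pow, D.tau_tau,
      AlgEquiv.commutes, Matrix.mul_fin_two]
  ext k l
  fin_cases k <;> fin_cases l <;> simp [pow_add] <;> field_simp

theorem cellPoint_inv_mul_tauGL (n : ℕ) (a : E) (ha : valuation E a = uniformizer E) :
    (D.cellPoint n a ha)⁻¹ * D.tauGL (D.cellPoint n a ha) = D.wDot n := by
  rw [tauGL_cellPoint, inv_mul_cancel_left]

theorem exists_cellPoint_eq (n : ℕ) (hn : 1 ≤ n) (a : E) (ha : valuation E a = uniformizer E) :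
    ∃ i ∈ iwahori E, D.cellPoint n a ha = eMinus a * D.vDot n * i := by
  have h1 := D.pi_ne_zero
  have h2 := D.tau_pi_ne_zero
  have h3 := D.trace_ne_zero ha
  have hv : valuation E (D.π ^ (D.d + 1 + n) / algebraMap F E (D.trace a)) =
      uniformizer E ^ (n : ℤ) := by
    rw [map_div₀, map_pow, D.valuation_π, D.valuation_trace ha, ← zpow_natCast,
      ← zpow_sub₀ uniformizer_ne_zero]
    congr 1
    push_cast
    ring
  obtain ⟨e, he⟩ : ∃ e, D.d + 1 = 2 * e := by
    obtain ⟨k, hk⟩ := D.odd_d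
    exact ⟨k + 1, by omega⟩
  have he2 : (D.d + 1) / 2 = e := by omega
  have hv' : valuation E ((D.π * D.τ D.π) ^ ((D.d + 1) / 2) / algebraMap F E (D.trace a)) = 1 := by
    rw [map_div₀, map_pow, map_mul, D.valuation_tau_pi, D.valuation_π, D.valuation_trace ha,
      ← pow_two, ← pow_mul, he2, ← he]
    norm_cast
    exact div_self (pow_ne_zero _ uniformizer_ne_zero)
  -- The first row of `cellPoint` dictates the second row of this factor, and `τ(a) = a + tr(a)`
  -- then settles the lower left entry. That `tr(a)` has valuation exactly `d + 1` makes the factor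
  -- lie in `I_E`: its lower entries have valuations `n` and `0`.
  refine ⟨Matrix.GeneralLinearGroup.mkOfDetNeZero
    !![1, 0; D.π ^ (D.d + 1 + n) / algebraMap F E (D.trace a),
      (D.π * D.τ D.π) ^ ((D.d + 1) / 2) / algebraMap F E (D.trace a)] (by simp [h1, h2, h3]),
    ⟨map_one _, hv', zero_mem _, mem_maxPow_of_eq_zpow hv (by exact_mod_cast hn)⟩,
    Units.ext ?_⟩
  have hn : n = n / 2 + (n + 1) / 2 := by omega
  have ht := D.algebraMap_trace a
  have h4 := D.two_eq_zero
  rw [Units.val_mul, Units.val_mul, coe_vDot, coe_cellPoint, mkOfDetNeZero_coe, eMinus,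
    mkOfDetNeZero_coe, Matrix.mul_fin_two,
    Matrix.mul_fin_two, he2, he]
  have ht' : D.τ a = a + algebraMap F E (D.trace a) := by
    rw [ht]; linear_combination - a * h4
  rw [ht']
  generalize algebraMap F E (D.trace a) = s at *
  generalize (n + 1) / 2 = j at *
  generalize n / 2 = i at *
  subst hn
  ext k l
  fin_cases k <;> fin_cases l <;> simp [pow_add, mul_pow, two_mul] <;> field_simp <;> ring

theorem cellPoint_mem_adlvHalf {n : ℕ} (hn : 1 ≤ n) (m : ℕ) (a : E)
    (ha : valuation E a = uniformizer E) :
    (D.cellPoint n a ha : GL (Fin 2) E ⧸ levelSubgroup E m) ∈ D.adlvHalf n m := by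
  refine ⟨⟨_, rfl, ?_⟩, a, (uniformizer_mem ha).1, (uniformizer_mem ha).2, ?_⟩
  · rw [mul_one, cellPoint_inv_mul_tauGL]
    exact DoubleCoset.mem_doubleCoset_self _ _ _
  · obtain ⟨i, hi, h⟩ := D.exists_cellPoint_eq n hn a ha
    rw [h]
    change ((eMinus a * D.vDot n * i : GL (Fin 2) E) : GL (Fin 2) E ⧸ iwahori E) = _
    rw [QuotientGroup.eq]
    simpa [mul_assoc] using hi

theorem cellPoint_mem_adlvTilde {n : ℕ} (hn : 1 ≤ n) (m : ℕ) (a : E)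
    (ha : valuation E a = uniformizer E) :
    (D.cellPoint n a ha : GL (Fin 2) E ⧸ levelSubgroup E m) ∈ D.adlvTilde n m :=
  ⟨_, D.cellPoint_mem_adlvHalf hn m a ha, 1, (D.rightMul_one _).symm⟩

/-- Points of `X_ẇ^m(1)` in the same coset of `Z(E) I_E` differ by an element of `Γ̃`. -/
theorem inv_mul_mem_gammaPre {n m : ℕ} {a : E} {ha : valuation E a = uniformizer E}
    {g : GL (Fin 2) E} (hg : g⁻¹ * D.tauGL g ∈
      DoubleCoset.doubleCoset (D.wDot n) (levelSubgroup E m : Set (GL (Fin 2) E))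
        (levelSubgroup E m))
    (h : (D.cellPoint n a ha)⁻¹ * g ∈ centerIwahori E) :
    (D.cellPoint n a ha)⁻¹ * g ∈ D.gammaPre n m := by
  refine ⟨h, ?_⟩
  convert hg using 1
  rw [← D.cellPoint_inv_mul_tauGL n a ha, map_mul, map_inv]
  group

/-- Two points of `X` in one alcove differ by some `i ∈ I_E`, and `i` must stabilize `J ẇ J` because
the point `cellPoint n a` has value exactly `ẇ`. So each alcove contributes a single `Γ̃`-orbit. -/
theorem exists_eq_rightMul {n m : ℕ} (hn : 1 ≤ n) {y : GL (Fin 2) E ⧸ levelSubgroup E m}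
    (hy : y ∈ D.adlvTilde n m) : ∃ (a : E) (ha : valuation E a = uniformizer E)
      (γ : D.gammaPre n m), y = D.rightMul γ (D.cellPoint n a ha : GL (Fin 2) E) := by
  obtain ⟨x, ⟨⟨g, rfl, hg⟩, a, h1, h2, h3⟩, δ, rfl⟩ := hy
  have ha := mem_uniformizer h1 h2
  obtain ⟨i, hi, h⟩ := D.exists_cellPoint_eq n hn a ha
  have h4 : (eMinus a * D.vDot n)⁻¹ * g ∈ iwahori E := QuotientGroup.eq.1 h3.symm
  have h5 : (D.cellPoint n a ha)⁻¹ * g ∈ iwahori E := by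
    rw [h]
    simpa [mul_assoc] using mul_mem (inv_mem hi) h4
  rw [mul_one] at hg
  let γ : D.gammaPre n m :=
    ⟨_, D.inv_mul_mem_gammaPre hg ((le_sup_right : iwahori E ≤ centerIwahori E) h5)⟩
  refine ⟨a, ha, γ * δ, ?_⟩
  rw [rightMul_mul, rightMul_mk, rightMul_mk, rightMul_mk, mul_inv_cancel_left]

/-- Conjugation by `v̇` turns `e₋(c)` into the upper unipotent matrix with entry `c / π^(n+d+1)`.
Hence the alcove `e₋(a) v̇ I_E` depends only on `a` modulo `𝔭_E^(n+d+1)`. -/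
theorem vDot_conj_mem {n : ℕ} {c : E} (hc : c ∈ maxPow E (n + D.d + 1)) :
    (D.vDot n)⁻¹ * eMinus c * D.vDot n ∈ iwahori E := by
  have h1 := D.pi_ne_zero
  obtain ⟨e, he⟩ : ∃ e, D.d + 1 = 2 * e := by
    obtain ⟨k, hk⟩ := D.odd_d
    exact ⟨k + 1, by omega⟩
  have he2 : (D.d + 1) / 2 = e := by omega
  have h : (D.vDot n)⁻¹ * eMinus c * D.vDot n = Matrix.GeneralLinearGroup.mkOfDetNeZero
      !![1, c / D.π ^ (n + D.d + 1); 0, 1] (by simp) := by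
    rw [mul_assoc, inv_mul_eq_iff_eq_mul]
    refine Units.ext ?_
    have hn : n = n / 2 + (n + 1) / 2 := by omega
    rw [Units.val_mul, Units.val_mul, coe_vDot, eMinus, mkOfDetNeZero_coe, mkOfDetNeZero_coe,
      Matrix.mul_fin_two, Matrix.mul_fin_two, add_assoc n, he2, he]
    generalize (n + 1) / 2 = j at *
    generalize n / 2 = i at *
    subst hn
    ext k l
    fin_cases k <;> fin_cases l <;> simp [pow_add, two_mul] <;> field_simp
  rw [h]
  refine ⟨map_one _, map_one _, ?_, zero_mem _⟩
  change c / D.π ^ (n + D.d + 1) ∈ maxPow E 0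
  rw [div_eq_mul_inv]
  refine mul_mem_maxPow_of_zpow (k := -((n + D.d + 1 : ℕ) : ℤ)) hc ?_ (by push_cast; omega)
  rw [map_inv₀, map_pow, D.valuation_π, zpow_neg, zpow_natCast]

/-- Representatives of neighbouring alcoves differ by an element of `Γ̃`. -/
theorem cellPoint_inv_mul_cellPoint_mem {n m : ℕ} (hn : 1 ≤ n) {a b : E}
    (ha : valuation E a = uniformizer E) (hb : valuation E b = uniformizer E)
    (hab : b - a ∈ maxPow E (n + D.d + 1)) :
    (D.cellPoint n a ha)⁻¹ * D.cellPoint n b hb ∈ D.gammaPre n m := by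
  refine D.inv_mul_mem_gammaPre ?_ ((le_sup_right : iwahori E ≤ centerIwahori E) ?_)
  · rw [cellPoint_inv_mul_tauGL]
    exact DoubleCoset.mem_doubleCoset_self _ _ _
  obtain ⟨i, hi, h⟩ := D.exists_cellPoint_eq n hn a ha
  obtain ⟨j, hj, h'⟩ := D.exists_cellPoint_eq n hn b hb
  have e : eMinus b = eMinus a * eMinus (b - a) := by rw [← eMinus_add, add_sub_cancel]
  rw [h, h', e]
  have := mul_mem (mul_mem (inv_mem hi) (D.vDot_conj_mem hab)) hj
  convert this using 1
  group

/-- Translation by `u` leaves `tr(a)`, hence the first row, unchanged and shifts both `a` and `τ(a)`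
by `u`. The equality holds on the nose, with no factor from `Γ̃`. -/
theorem eMinus_mul_cellPoint (n : ℕ) {a : E} (ha : valuation E a = uniformizer E) (u : F)
    (h : valuation E (a + algebraMap F E u) = uniformizer E) :
    eMinus (algebraMap F E u) * D.cellPoint n a ha =
      D.cellPoint n (a + algebraMap F E u) h := by
  refine Units.ext ?_
  rw [Units.val_mul, coe_cellPoint, coe_cellPoint, eMinus, mkOfDetNeZero_coe, Matrix.mul_fin_two,
    trace_add_algebraMap, map_add, AlgEquiv.commutes]
  ext k l
  fin_cases k <;> fin_cases l <;> simp <;> ring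

/-- The matrix `diag(1, x)` is fixed by `τ`, so it preserves the value `ẇ`; moving it past `e₋(a)
v̇` replaces `a` by `xa` and leaves the factor `diag(x, 1) ∈ I_E`. -/
theorem cellPoint_inv_mul_diag_mem {n m : ℕ} (hn : 1 ≤ n) {a : E}
    (ha : valuation E a = uniformizer E) {x : Fˣ} (hx : valuation F (x : F) = 1)
    (h : valuation E (algebraMap F E x * a) = uniformizer E) :
    (D.cellPoint n (algebraMap F E x * a) h)⁻¹ * (D.inclGL (eZero 1 x) * D.cellPoint n a ha) ∈
      D.gammaPre n m := by
  refine D.inv_mul_mem_gammaPre ?_ ((le_sup_right : iwahori E ≤ centerIwahori E) ?_)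
  · rw [map_mul, tauGL_inclGL, tauGL_cellPoint]
    convert DoubleCoset.mem_doubleCoset_self _ _ _ using 1
    group
  obtain ⟨i, hi, h2⟩ := D.exists_cellPoint_eq n hn a ha
  obtain ⟨j, hj, h3⟩ := D.exists_cellPoint_eq n hn _ h
  set X : Eˣ := Units.map (algebraMap F E : F →* E) x with hX
  have e : D.inclGL (eZero 1 x) * (eMinus a * D.vDot n) =
      eMinus (algebraMap F E x * a) * D.vDot n * eZero X 1 := by
    have e1 : (D.inclGL (eZero 1 x) : Matrix (Fin 2) (Fin 2) E) =
        !![1, 0; 0, algebraMap F E x] := by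
      rw [Matrix.eta_fin_two (D.inclGL (eZero 1 x) : Matrix (Fin 2) (Fin 2) E)]
      simp [inclGL, eZero, Matrix.GeneralLinearGroup.mkOfDetNeZero]
    refine Units.ext ?_
    simp only [Units.val_mul]
    rw [e1, coe_vDot, eZero, eMinus, eMinus, mkOfDetNeZero_coe, mkOfDetNeZero_coe,
      mkOfDetNeZero_coe]
    simp only [Matrix.mul_fin_two]
    ext k l
    fin_cases k <;> fin_cases l <;> simp [hX] <;> ring
  have hX1 : eZero X 1 ∈ iwahori E := by
    refine ⟨?_, ?_, ?_, ?_⟩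
    · change valuation E (algebraMap F E x) = 1
      exact valuation_algebraMap_eq_one hx
    · exact map_one _
    · exact zero_mem _
    · exact zero_mem _
  have := mul_mem (mul_mem (inv_mem hj) hX1) hi
  convert this using 1
  rw [h3, h2]
  calc _ = j⁻¹ * ((eMinus (algebraMap F E x * a) * D.vDot n)⁻¹ *
        (D.inclGL (eZero 1 x) * (eMinus a * D.vDot n))) * i := by group
    _ = _ := by rw [e]; group

end WildDatum
-- Unipotent translations inside `Γ̃`, and a commutator killed by characters
namespace WildDatum

variable {F E : Type*} [Field F] [ValuativeRel F] [TopologicalSpace F]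
  [IsNonarchimedeanLocalField F] [Field E] [ValuativeRel E] [TopologicalSpace E]
  [IsNonarchimedeanLocalField E] [Algebra F E] [ValuativeExtension F E]
  [CharP F 2] (D : WildDatum F E)

theorem mul_tau_mul_varpi_mem {n j l : ℕ} {x y : E} (hx : x ∈ maxPow E j) (hy : y ∈ maxPow E 0)
    (h : l ≤ 2 * n + j) : x * (algebraMap F E D.ϖ ^ n * D.τ y) ∈ maxPow E l := by
  have h1 : algebraMap F E D.ϖ ^ n ∈ maxPow E (2 * n) := by
    rw [mem_maxPow, map_pow, D.valuation_varpi, pow_mul]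
  exact maxPow_mul_of_le hx (maxPow_mul h1 (D.tau_mem_maxPow hy)) (by omega)

/-- The matrix `[1, q; ϖ^n τ(q), 1]`, for `q` integral and `n` positive. -/
noncomputable def quatUnit {n : ℕ} (hn : 1 ≤ n) (q : E) (hq : q ∈ maxPow E 0) : GL (Fin 2) E :=
  Matrix.GeneralLinearGroup.mkOfDetNeZero !![1, q; algebraMap F E D.ϖ ^ n * D.τ q, 1] (by
    rw [Matrix.det_fin_two_of, mul_one, sub_eq_add_neg]
    intro h
    have := valuation_one_add (neg_mem (D.mul_tau_mul_varpi_mem (n := n) (l := 1) hq hq (by omega)))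
    rw [h, map_zero] at this
    exact zero_ne_one this)

theorem quatUnit_mem_iwahori {n : ℕ} (hn : 1 ≤ n) (q : E) (hq : q ∈ maxPow E 0) :
    D.quatUnit hn q hq ∈ iwahori E := by
  refine ⟨map_one _, map_one _, hq, ?_⟩
  change algebraMap F E D.ϖ ^ n * D.τ q ∈ maxPow E 1
  rw [← one_mul (_ * _)]
  exact D.mul_tau_mul_varpi_mem (j := 0) (by simp [mem_maxPow]) hq (by omega)

/-- The factor `ϖ^n = π^n τ(π)^n` is the quotient of the two nonzero entries of `ẇ`, so that `A ẇ =
ẇ τ(A)` holds exactly for this matrix `A`. -/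
theorem quatUnit_mem {n : ℕ} (hn : 1 ≤ n) (m : ℕ) (q : E) (hq : q ∈ maxPow E 0) :
    D.quatUnit hn q hq ∈ D.gammaPre n m := by
  refine ⟨(le_sup_right : iwahori E ≤ centerIwahori E) (D.quatUnit_mem_iwahori hn q hq), ?_⟩
  have h1 := D.pi_ne_zero
  have h2 := D.tau_pi_ne_zero
  have h : (D.quatUnit hn q hq)⁻¹ * D.wDot n * D.tauGL (D.quatUnit hn q hq) = D.wDot n := by
    rw [mul_assoc, inv_mul_eq_iff_eq_mul]
    refine Units.ext ?_
    rw [Units.val_mul, Units.val_mul, coe_wDot, coe_tauGL, quatUnit, mkOfDetNeZero_coe,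
      ← D.pi_mul_tau_pi]
    have hn : n = n / 2 + (n + 1) / 2 := by omega
    simp only [Matrix.of_apply, Matrix.cons_val', Matrix.cons_val_zero,
      Matrix.cons_val_one, Matrix.cons_val_fin_one, map_mul, map_pow, D.tau_tau,
      map_one, Matrix.mul_fin_two]
    generalize (n + 1) / 2 = j at *
    generalize n / 2 = i at *
    subst hn
    ext k l
    fin_cases k <;> fin_cases l <;> simp [pow_add, mul_pow] <;> field_simp
  rw [h]
  exact DoubleCoset.mem_doubleCoset_self _ _ _

theorem coe_torusElt (t : Eˣ) : (D.torusElt t : Matrix (Fin 2) (Fin 2) E) =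
    !![(t : E), 0; 0, D.τ t] := rfl

/-- The commutator of `diag(π, τ(π))` with the element attached to `q` is, modulo the level
subgroup, the element attached to `q (π / τ(π) - 1)`. -/
theorem exists_commutator {n m : ℕ} (hn : 1 ≤ n) (hmn : m + 1 = 2 * n + D.d) {q q' : E}
    (hq : q ∈ maxPow E 0) (hq' : q' ∈ maxPow E D.d) (h0 : q' ∈ maxPow E 0)
    (h : (q + q') * D.τ D.π = q * D.π) :
    ∃ j ∈ levelSubgroup E m, D.torusElt (Units.mk0 D.π D.pi_ne_zero) * D.quatUnit hn q hq =
      D.quatUnit hn q' h0 * D.quatUnit hn q hq * j *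
        D.torusElt (Units.mk0 D.π D.pi_ne_zero) := by
  set T := D.torusElt (Units.mk0 D.π D.pi_ne_zero)
  set A := D.quatUnit hn q hq with hA
  set B := D.quatUnit hn q' h0 with hB
  have h1 := D.pi_ne_zero
  have h2 := D.tau_pi_ne_zero
  have hT : ((T⁻¹ : GL (Fin 2) E) : Matrix (Fin 2) (Fin 2) E) =
      !![D.π⁻¹, 0; 0, (D.τ D.π)⁻¹] := by
    have : T⁻¹ = D.torusElt (Units.mk0 D.π D.pi_ne_zero)⁻¹ := by
      rw [inv_eq_iff_mul_eq_one]
      refine Units.ext ?_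
      rw [Units.val_mul, coe_torusElt, coe_torusElt, Matrix.mul_fin_two]
      simp [h1, Matrix.one_fin_two]
    rw [this, coe_torusElt]
    simp
  -- Off the diagonal, `B A` and `T A T⁻¹` agree by the choice of `q'`. On the diagonal they differ
  -- by `w` and `τ(w)`, of valuation at least `2n + d = m + 1`.
  set w := q' * (algebraMap F E D.ϖ ^ n * D.τ q) with hw
  have hww : w ∈ maxPow E (m + 1) := D.mul_tau_mul_varpi_mem hq' hq (by omega)
  have hww' : D.τ w ∈ maxPow E (m + 1) := D.tau_mem_maxPow hww
  have hqq : q * D.π / D.τ D.π = q + q' := by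
    rw [← h]; field_simp
  have hqq' : algebraMap F E D.ϖ ^ n * D.τ q * D.τ D.π / D.π =
      algebraMap F E D.ϖ ^ n * (D.τ q + D.τ q') := by
    have := congrArg D.τ h
    rw [map_mul, map_mul, map_add, D.tau_tau] at this
    field_simp
    linear_combination -algebraMap F E D.ϖ ^ n * this
  have key : ((T * A * T⁻¹ : GL (Fin 2) E) : Matrix (Fin 2) (Fin 2) E) -
      ((B * A : GL (Fin 2) E) : Matrix (Fin 2) (Fin 2) E) = !![-w, 0; 0, -D.τ w] := by
    have e1 : (T : Matrix (Fin 2) (Fin 2) E) = !![D.π, 0; 0, D.τ D.π] := rfl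
    have e2 : (A : Matrix (Fin 2) (Fin 2) E) =
      !![1, q; algebraMap F E D.ϖ ^ n * D.τ q, 1] := rfl
    have e3 : (B : Matrix (Fin 2) (Fin 2) E) =
      !![1, q'; algebraMap F E D.ϖ ^ n * D.τ q', 1] := rfl
    simp only [Units.val_mul]
    rw [hT, e1, e2, e3]
    simp only [Matrix.mul_fin_two, hw, map_mul, map_pow, AlgEquiv.commutes, D.tau_tau]
    ext k l
    fin_cases k <;> fin_cases l
    · simp [h1]
    · have : D.π * q * (D.τ D.π)⁻¹ = q + q' := by rw [← hqq]; ring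
      simp [this]
    · have : D.τ D.π * (algebraMap F E D.ϖ ^ n * D.τ q) * D.π⁻¹ =
        algebraMap F E D.ϖ ^ n * (D.τ q + D.τ q') := by rw [← hqq']; ring
      simp [this]
      ring
    · simp [h2]
      ring
  refine ⟨(B * A)⁻¹ * (T * A * T⁻¹), ?_, by group⟩
  -- A difference in the ideal defining `J` stays there after multiplication by the Iwahori element
  -- `(B A)⁻¹`.
  have e : (((B * A)⁻¹ * (T * A * T⁻¹) : GL (Fin 2) E) : Matrix (Fin 2) (Fin 2) E) - 1 =
      (((B * A)⁻¹ : GL (Fin 2) E) : Matrix (Fin 2) (Fin 2) E) *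
      (((T * A * T⁻¹ : GL (Fin 2) E) : Matrix (Fin 2) (Fin 2) E) -
      ((B * A : GL (Fin 2) E) : Matrix (Fin 2) (Fin 2) E)) := by
    rw [mul_sub, Units.inv_mul, ← Units.val_mul]
  change InLevel m _
  rw [e, key]
  refine (InOrder.of_iwahori (inv_mem (mul_mem (D.quatUnit_mem_iwahori hn q' h0)
    (D.quatUnit_mem_iwahori hn q hq)))).mul_level ⟨?_, ?_, ?_, ?_⟩
  · exact neg_mem hww
  · exact zero_mem _
  · exact zero_mem _
  · exact neg_mem hww'

/-- Modulo `J` this element is the commutator of `diag(π, τ(π))` and another element of `Γ̃`, so any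
character with commutative values kills it. -/
theorem apply_quatUnit {k : Type*} [Field k] {n m : ℕ} (hn : 1 ≤ n) (hmn : m + 1 = 2 * n + D.d)
    (χ : D.Gamma n m →* kˣ) {q : E} (hq : q ∈ maxPow E D.d) (h0 : q ∈ maxPow E 0) :
    χ (QuotientGroup.mk ⟨D.quatUnit hn q h0, D.quatUnit_mem hn m q h0⟩) = 1 := by
  have h1 := D.pi_ne_zero
  have h2 := D.tau_pi_ne_zero
  have hΔ : algebraMap F E D.Δ ≠ 0 := by
    intro h
    have := D.valuation_algebraMap_delta
    rw [h, map_zero] at this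
    exact zpow_ne_zero _ uniformizer_ne_zero this.symm
  -- This product solves `q₀ (π / τ(π) - 1) = q`, since `π - τ(π) = Δ` in characteristic 2. As `τ(π)
  -- / Δ` has valuation `-d`, it is integral precisely because `q ∈ 𝔭_E^d`.
  have hp : q * (D.τ D.π / algebraMap F E D.Δ) ∈ maxPow E 0 := by
    refine mul_mem_maxPow_of_zpow (k := -(D.d : ℤ)) hq ?_ (by simp)
    rw [map_div₀, D.valuation_tau_pi, D.valuation_algebraMap_delta, zpow_neg,
      zpow_add_one₀ uniformizer_ne_zero]
    have := uniformizer_ne_zero (R := E)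
    field_simp
  obtain ⟨j, hj, e⟩ := D.exists_commutator (n := n) (m := m) hn hmn hp hq h0 (by
    rw [D.tau_pi]
    field_simp
    linear_combination (D.π + algebraMap F E D.Δ) * algebraMap F E D.Δ * q * D.two_eq_zero)
  set T : D.gammaPre n m := ⟨_, D.torusElt_mem n m (Units.mk0 D.π D.pi_ne_zero)⟩ with hT
  set A : D.gammaPre n m := ⟨_, D.quatUnit_mem hn m _ hp⟩ with hA
  set B : D.gammaPre n m := ⟨_, D.quatUnit_mem hn m q h0⟩ with hB
  set J : D.gammaPre n m := ⟨j, D.levelSubgroup_le_gammaPre n m hj⟩ with hJ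
  have e1 : T * A = B * A * J * T := Subtype.ext e
  have e2 : (QuotientGroup.mk J : D.Gamma n m) = 1 := (QuotientGroup.eq_one_iff J).2 hj
  have e3 := congrArg (fun x : D.gammaPre n m => χ (QuotientGroup.mk x)) e1
  simp only [QuotientGroup.mk_mul, map_mul, e2, mul_one] at e3
  have : χ (QuotientGroup.mk B) * (χ (QuotientGroup.mk A) * χ (QuotientGroup.mk T)) =
      1 * (χ (QuotientGroup.mk A) * χ (QuotientGroup.mk T)) := by
    rw [one_mul, ← mul_assoc, ← e3, mul_comm]
  exact mul_right_cancel this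

/-- Conjugation of `e₋(u)` into `Γ̃`. -/
theorem eMinus_mul_cellPoint_eq {n m : ℕ} (hn : 1 ≤ n) (hmn : m + 1 = 2 * n + D.d) {a : E}
    (ha : valuation E a = uniformizer E) {u : F} (hu : u ∈ maxPow F (n + D.d)) :
    ∃ (t : Eˣ) (q : E) (h0 : q ∈ maxPow E 0),
      (t : E) = 1 + algebraMap F E u / algebraMap F E (D.trace a) ∧ q ∈ maxPow E D.d ∧
      eMinus (algebraMap F E u) * D.cellPoint n a ha =
        D.cellPoint n a ha * (D.torusElt t * D.quatUnit hn q h0) := by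
  have h1 := D.pi_ne_zero
  have h2 := D.tau_pi_ne_zero
  have h3 := D.trace_ne_zero ha
  set s := algebraMap F E (D.trace a) with hs
  -- The valuation is at least `2(n + d) - (d + 1) = m`.
  have hus : algebraMap F E u / s ∈ maxPow E m := by
    rw [div_eq_mul_inv]
    refine mul_mem_maxPow_of_zpow (k := -((D.d : ℤ) + 1))
      (D.algebraMap_mem_maxPow le_rfl hu) ?_ (by push_cast; omega)
    rw [map_inv₀, D.valuation_trace ha, zpow_neg]
  have hd : 1 ≤ D.d := D.odd_d.pos
  set p := 1 + algebraMap F E u / s with hp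
  have hpv : valuation E p = 1 := valuation_one_add (maxPow_anti (by omega) hus)
  have hp0 : p ≠ 0 := by
    intro h
    rw [h, map_zero] at hpv
    exact zero_ne_one hpv
  have hpτ : D.τ p = p := by
    rw [hp, hs, map_add, map_one, map_div₀, AlgEquiv.commutes, AlgEquiv.commutes]
  -- With `(x, y)` the first row of `cellPoint n a` and `s = tr(a)`, the conjugate of `e₋(u)` is `1
  -- + (u/s) [1, y/x; x/y, 1]`. Its diagonal entries are `p`; dividing the rows by `p` leaves the
  -- upper right entry `(u/s)(y/x)/p`, and `c = (y/x)/p`.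
  set c := D.τ D.π ^ ((D.d + 1) / 2) / (D.π ^ ((D.d + 1) / 2) * D.π ^ n) / p with hc
  have hq : algebraMap F E u / s * c ∈ maxPow E D.d := by
    refine mul_mem_maxPow_of_zpow (k := -(n : ℤ)) hus ?_ (by omega)
    rw [hc, map_div₀, hpv, div_one, map_div₀, map_mul, map_pow, map_pow, map_pow,
      D.valuation_tau_pi, D.valuation_π, zpow_neg, zpow_natCast]
    have := uniformizer_ne_zero (R := E)
    field_simp
  refine ⟨Units.mk0 p hp0, _, maxPow_anti (Nat.zero_le _) hq, rfl, hq, ?_⟩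
  refine Units.ext ?_
  have hcτ : D.τ (algebraMap F E u / s * c) = algebraMap F E u / s *
      (D.π ^ ((D.d + 1) / 2) / (D.τ D.π ^ ((D.d + 1) / 2) * D.τ D.π ^ n) / p) := by
    simp only [hc, hs, map_mul, map_div₀, map_pow, D.tau_tau, hpτ, AlgEquiv.commutes]
  simp only [Units.val_mul]
  rw [coe_cellPoint, eMinus, quatUnit, mkOfDetNeZero_coe, mkOfDetNeZero_coe, coe_torusElt, hcτ,
    ← D.pi_mul_tau_pi]
  simp only [Units.val_mk0, hpτ, Matrix.mul_fin_two, ← hs]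
  have ht : D.τ a = a + s := by
    rw [hs, D.algebraMap_trace]
    linear_combination -a * D.two_eq_zero
  rw [ht]
  have hn : n = n / 2 + (n + 1) / 2 := by omega
  have hpu : algebraMap F E u = (p - 1) * s := by rw [hp]; field_simp; ring
  rw [hc, hpu]
  have h4 := D.two_eq_zero
  clear_value p s
  clear hc hcτ hq hpu hp hs hu hus
  generalize (D.d + 1) / 2 = e at *
  generalize (n + 1) / 2 = j at *
  generalize n / 2 = i at *
  subst hn
  generalize D.τ D.π = y at *
  generalize D.π = x at *
  ext k l
  fin_cases k <;> fin_cases l <;> simp [pow_add, mul_pow] <;> field_simp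
  · linear_combination (1 - p) * h4
  · linear_combination (1 - p) * h4
  · linear_combination a * (1 - p) * h4
  · linear_combination a * (1 - p) * h4

end WildDatum
-- The spanning vectors of `V_χ` and the action on them
/-- The element `e₋(u)` of `N^1`. -/
def lowerElt {L : Type*} [Field L] [ValuativeRel L] [TopologicalSpace L]
    [IsNonarchimedeanLocalField L] (u : L) (hu : u ∈ maxPow L 1) : lowerUnipotent L 1 :=
  ⟨eMinus u, rfl, rfl, rfl, hu⟩

/-- The diagonal matrix `diag(1, x)` in `B ∩ I`, for a unit `x`. -/
def diagElt {L : Type*} [Field L] [ValuativeRel L] [TopologicalSpace L]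
    [IsNonarchimedeanLocalField L] (x : Lˣ) (hx : valuation L (x : L) = 1) :
    (lowerBorel L ⊓ iwahori L : Subgroup (GL (Fin 2) L)) :=
  ⟨eZero 1 x, rfl, map_one _, hx, zero_mem _, zero_mem _⟩

namespace WildDatum

variable {F E : Type*} [Field F] [ValuativeRel F] [TopologicalSpace F]
  [IsNonarchimedeanLocalField F] [Field E] [ValuativeRel E] [TopologicalSpace E]
  [IsNonarchimedeanLocalField E] [Algebra F E] [ValuativeExtension F E]
  [CharP F 2] (D : WildDatum F E)

section Vectors

variable {k : Type*} [Field k] {n m : ℕ} (χ : D.Gamma n m →* kˣ)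

/-- The image in `V_χ` of the indicator function of a point of `X̃`. -/
noncomputable def tildeVec (y : D.adlvTilde n m) : D.VSpace χ :=
  Submodule.Quotient.mk (Finsupp.single y 1)

theorem tildeVec_rightMul (γ : D.gammaPre n m) (y : D.adlvTilde n m) :
    D.tildeVec χ (D.rightMulTilde γ y) = (χ (QuotientGroup.mk γ) : k) • D.tildeVec χ y := by
  rw [tildeVec, tildeVec, ← Submodule.Quotient.mk_smul, Submodule.Quotient.eq]
  refine Submodule.subset_span ⟨γ, Finsupp.single y 1, ?_⟩
  rw [rightOp, Finsupp.lmapDomain_apply, Finsupp.mapDomain_single]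

theorem Xi_tildeVec (g : D.cuspGroup) (y : D.adlvTilde n m) :
    D.Xi χ g (D.tildeVec χ y) = D.tildeVec χ (g • y) := by
  change Submodule.Quotient.mk (Finsupp.mapDomain _ (Finsupp.single y 1)) = _
  rw [Finsupp.mapDomain_single]
  rfl

theorem span_tildeVec : Submodule.span k (Set.range (D.tildeVec χ)) = ⊤ := by
  have h : Set.range (D.tildeVec χ) = (D.isotypicKer χ).mkQ ''
      Set.range (Finsupp.basisSingleOne (R := k) (ι := D.adlvTilde n m)) := by
    rw [← Set.range_comp, Finsupp.coe_basisSingleOne]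
    rfl
  rw [h, Submodule.span_image, Module.Basis.span_eq, Submodule.map_top, Submodule.range_mkQ]

theorem rightMul_injective {γ δ : D.gammaPre n m} {y : GL (Fin 2) E ⧸ levelSubgroup E m}
    (h : D.rightMul γ y = D.rightMul δ y) :
    (QuotientGroup.mk γ : D.Gamma n m) = QuotientGroup.mk δ := by
  induction y using QuotientGroup.induction_on with
  | H x =>
    rw [rightMul_mk, rightMul_mk, QuotientGroup.eq] at h
    rw [QuotientGroup.eq]
    change (γ : GL (Fin 2) E)⁻¹ * δ ∈ levelSubgroup E m
    simpa [mul_assoc] using h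

/-- Since `Γ̃` acts freely, the function `yγ ↦ χ(γ)`, extended by zero off the orbit of `y`, is well
defined. The linear functional it induces kills all relations defining `V_χ` and takes the value `1`
at `y`. -/
theorem tildeVec_ne_zero (y : D.adlvTilde n m) : D.tildeVec χ y ≠ 0 := by
  classical
  let c : D.adlvTilde n m → k := fun z =>
    if h : ∃ γ : D.gammaPre n m, z = D.rightMulTilde γ y then
      (χ (QuotientGroup.mk h.choose) : k) else 0
  have hc : ∀ γ : D.gammaPre n m, c (D.rightMulTilde γ y) = (χ (QuotientGroup.mk γ) : k) := by
    intro γ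
    have h : ∃ δ : D.gammaPre n m, D.rightMulTilde γ y = D.rightMulTilde δ y := ⟨γ, rfl⟩
    simp only [c, dif_pos h]
    rw [D.rightMul_injective (congrArg Subtype.val h.choose_spec)]
  have hmul : ∀ (γ δ : D.gammaPre n m) (z : D.adlvTilde n m),
      D.rightMulTilde (γ * δ) z = D.rightMulTilde δ (D.rightMulTilde γ z) :=
    fun γ δ z => Subtype.ext (D.rightMul_mul γ δ z)
  have hc' : ∀ (γ : D.gammaPre n m) (z : D.adlvTilde n m),
      c (D.rightMulTilde γ z) = (χ (QuotientGroup.mk γ) : k) * c z := by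
    intro γ z
    by_cases h : ∃ δ : D.gammaPre n m, z = D.rightMulTilde δ y
    · obtain ⟨δ, rfl⟩ := h
      rw [← hmul, hc, hc, QuotientGroup.mk_mul, map_mul, Units.val_mul, mul_comm]
    · have h' : ¬ ∃ δ : D.gammaPre n m, D.rightMulTilde γ z = D.rightMulTilde δ y := by
        rintro ⟨δ, hδ⟩
        refine h ⟨δ * γ⁻¹, ?_⟩
        rw [hmul, ← hδ, ← hmul, mul_inv_cancel]
        exact Subtype.ext (D.rightMul_one _).symm
      simp only [c, dif_neg h, dif_neg h', mul_zero]
  let φ : D.HcZero k n m →ₗ[k] k := Finsupp.linearCombination k c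
  have hφ : D.isotypicKer χ ≤ LinearMap.ker φ := by
    refine Submodule.span_le.2 ?_
    rintro v ⟨γ, f, rfl⟩
    change φ _ = 0
    rw [map_sub, sub_eq_zero, map_smul, rightOp, Finsupp.lmapDomain_apply]
    have : φ ∘ₗ Finsupp.lmapDomain k k (D.rightMulTilde γ) =
        (χ (QuotientGroup.mk γ) : k) • φ := by
      ext z
      simp [φ, hc']
    exact LinearMap.congr_fun this f
  intro h
  have h1 : φ (Finsupp.single y 1) = 0 := hφ ((Submodule.Quotient.mk_eq_zero _).1 h)
  have h2 := hc 1
  have h3 : D.rightMulTilde (1 : D.gammaPre n m) y = y := Subtype.ext (D.rightMul_one _)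
  rw [h3] at h2
  simp [φ, h2] at h1

/-- The vector of `V_χ` attached to the alcove `e₋(a) v̇ I_E`. -/
noncomputable def cellVec (hn : 1 ≤ n) (a : E) (ha : valuation E a = uniformizer E) :
    D.VSpace χ :=
  D.tildeVec χ ⟨_, D.cellPoint_mem_adlvTilde hn m a ha⟩

variable (hn : 1 ≤ n)

/-- One point per alcove is enough: its `Γ̃`-translates become multiples of it in `V_χ`. -/
theorem span_cellVec :
    Submodule.span k {v | ∃ a ha, v = D.cellVec χ hn a ha} = ⊤ := by
  rw [eq_top_iff, ← D.span_tildeVec χ, Submodule.span_le]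
  rintro _ ⟨y, rfl⟩
  obtain ⟨a, ha, γ, h⟩ := D.exists_eq_rightMul hn y.2
  have : y = D.rightMulTilde γ ⟨_, D.cellPoint_mem_adlvTilde hn m a ha⟩ := Subtype.ext h
  rw [this, tildeVec_rightMul]
  exact Submodule.smul_mem _ _ (Submodule.subset_span ⟨a, ha, rfl⟩)

/-- The action on the vectors of `V_χ` attached to alcoves. -/
theorem Xi_cellVec (g : D.cuspGroup) {a b : E} (ha : valuation E a = uniformizer E)
    (hb : valuation E b = uniformizer E) (γ : D.gammaPre n m)
    (h : D.inclGL g * D.cellPoint n a ha = D.cellPoint n b hb * γ) :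
    D.Xi χ g (D.cellVec χ hn a ha) = (χ (QuotientGroup.mk γ) : k) • D.cellVec χ hn b hb := by
  rw [cellVec, Xi_tildeVec, cellVec, ← tildeVec_rightMul]
  congr 1
  exact Subtype.ext (congrArg QuotientGroup.mk h)

theorem inclGL_lowerElt (u : F) (hu : u ∈ maxPow F 1) :
    D.inclGL (lowerElt u hu : GL (Fin 2) F) = eMinus (algebraMap F E u) := by
  refine Units.ext ?_
  rw [Matrix.eta_fin_two (D.inclGL (lowerElt u hu : GL (Fin 2) F) : Matrix (Fin 2) (Fin 2) E)]
  simp [inclGL, lowerElt, eMinus, Matrix.GeneralLinearGroup.mkOfDetNeZero]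

theorem valuation_add_algebraMap (D : WildDatum F E) {a : E} (ha : valuation E a = uniformizer E) {u : F}
    (hu : u ∈ maxPow F 1) : valuation E (a + algebraMap F E u) = uniformizer E := by
  rw [Valuation.map_add_eq_of_lt_left, ha]
  rw [ha]
  refine lt_of_le_of_lt (mem_maxPow.1 (D.algebraMap_mem_maxPow (i := 2) le_rfl hu)) ?_
  rw [pow_two]
  exact mul_lt_of_lt_one_right uniformizer_pos uniformizer_lt_one

theorem valuation_algebraMap_mul (_D : WildDatum F E) {a : E} (ha : valuation E a = uniformizer E) {x : F}
    (hx : valuation F x = 1) : valuation E (algebraMap F E x * a) = uniformizer E := by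
  rw [map_mul, valuation_algebraMap_eq_one hx, one_mul, ha]

/-- The restriction of `Ξ_χ` to `N^1`. -/
noncomputable def XiLower : Representation k (lowerUnipotent F 1) (D.VSpace χ) :=
  (D.Xi χ).comp (Subgroup.inclusion D.lowerUnipotent_le_cuspGroup)

/-- The restriction of `Ξ_χ` to `B ∩ I_F`. -/
noncomputable def XiBorel : Representation k (lowerBorel F ⊓ iwahori F : Subgroup (GL (Fin 2) F))
    (D.VSpace χ) :=
  (D.Xi χ).comp (Subgroup.inclusion D.borel_inf_iwahori_le_cuspGroup)

/-- No scalar appears, because `e₋(u)` carries one chosen representative exactly to another. -/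
theorem XiLower_cellVec {u : F} (hu : u ∈ maxPow F 1) {a : E}
    (ha : valuation E a = uniformizer E) :
    D.XiLower χ (lowerElt u hu) (D.cellVec χ hn a ha) =
      D.cellVec χ hn (a + algebraMap F E u) (D.valuation_add_algebraMap ha hu) := by
  have := D.Xi_cellVec χ hn (Subgroup.inclusion D.lowerUnipotent_le_cuspGroup (lowerElt u hu)) ha
    (D.valuation_add_algebraMap ha hu) 1 (by
      rw [Subgroup.coe_one, mul_one, ← D.eMinus_mul_cellPoint n ha u]
      exact congrArg (· * _) (D.inclGL_lowerElt u hu))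
  rw [QuotientGroup.mk_one, map_one, Units.val_one, one_smul] at this
  exact this

/-- The two representatives lie in the same alcove, hence in one `Γ̃`-orbit. The scalar is a value
of `χ` that never needs to be computed. -/
theorem exists_cellVec_eq_smul {a b : E} (ha : valuation E a = uniformizer E)
    (hb : valuation E b = uniformizer E) (hab : b - a ∈ maxPow E (n + D.d + 1)) :
    ∃ c : k, D.cellVec χ hn b hb = c • D.cellVec χ hn a ha := by
  have := D.Xi_cellVec χ hn 1 hb ha
    ⟨_, D.cellPoint_inv_mul_cellPoint_mem hn ha hb hab⟩ (by
      rw [mul_inv_cancel_left, Subgroup.coe_one, map_one, one_mul])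
  rw [map_one, Module.End.one_apply] at this
  exact ⟨_, this⟩

theorem XiBorel_diagElt {x : Fˣ} (hx : valuation F (x : F) = 1) {a : E}
    (ha : valuation E a = uniformizer E) :
    ∃ c : k, c ≠ 0 ∧ D.XiBorel χ (diagElt x hx) (D.cellVec χ hn a ha) =
      c • D.cellVec χ hn (algebraMap F E x * a) (D.valuation_algebraMap_mul ha hx) := by
  have := D.Xi_cellVec χ hn (Subgroup.inclusion D.borel_inf_iwahori_le_cuspGroup (diagElt x hx)) ha
    (D.valuation_algebraMap_mul ha hx) ⟨_, D.cellPoint_inv_mul_diag_mem hn ha hx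
      (D.valuation_algebraMap_mul ha hx)⟩ (by
      rw [mul_inv_cancel_left]
      rfl)
  exact ⟨_, Units.ne_zero _, this⟩

/-- Of the two factors of the conjugate of `e₋(u)` in `Γ̃`, `χ` kills the one with `q ∈ 𝔭_E^d`; only
the torus part survives. -/
theorem XiLower_cellVec_of_mem (hmn : m + 1 = 2 * n + D.d) {u : F} (hu : u ∈ maxPow F (n + D.d))
    (hu' : u ∈ maxPow F 1) {a : E} (ha : valuation E a = uniformizer E) :
    ∃ t : Eˣ, (t : E) = 1 + algebraMap F E u / algebraMap F E (D.trace a) ∧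
      D.XiLower χ (lowerElt u hu') (D.cellVec χ hn a ha) =
        (χ (D.iDiag n m t) : k) • D.cellVec χ hn a ha := by
  obtain ⟨t, q, h0, ht, hq, h⟩ := D.eMinus_mul_cellPoint_eq hn hmn ha hu
  refine ⟨t, ht, ?_⟩
  have := D.Xi_cellVec χ hn (Subgroup.inclusion D.lowerUnipotent_le_cuspGroup (lowerElt u hu')) ha
    ha (⟨_, D.torusElt_mem n m t⟩ * ⟨_, D.quatUnit_mem hn m q h0⟩) (by
      refine Eq.trans ?_ h
      exact congrArg (· * _) (D.inclGL_lowerElt u hu'))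
  rw [QuotientGroup.mk_mul, map_mul, D.apply_quatUnit hn hmn χ hq, mul_one] at this
  exact this

theorem XiLower_cellVec_eq_self (hmn : m + 1 = 2 * n + D.d) {θ : Eˣ →* kˣ} (hθ : HasLevel θ m)
    (hθχ : ∀ t : Eˣ, χ (D.iDiag n m t) = θ t) {u : F} (hu : u ∈ maxPow F (n + D.d + 1))
    (hu' : u ∈ maxPow F 1) {a : E} (ha : valuation E a = uniformizer E) :
    D.XiLower χ (lowerElt u hu') (D.cellVec χ hn a ha) = D.cellVec χ hn a ha := by
  obtain ⟨t, ht, h⟩ := D.XiLower_cellVec_of_mem χ hn hmn (maxPow_anti (by omega) hu) hu' ha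
  have hus : algebraMap F E u / algebraMap F E (D.trace a) ∈ maxPow E (m + 1) := by
    rw [div_eq_mul_inv]
    refine mul_mem_maxPow_of_zpow (k := -((D.d : ℤ) + 1))
      (D.algebraMap_mem_maxPow le_rfl hu) ?_ (by push_cast; omega)
    rw [map_inv₀, D.valuation_trace ha, zpow_neg]
  rw [h, hθχ, hθ.1 t ⟨?_, ?_⟩, Units.val_one, one_smul]
  · rw [ht]
    exact valuation_one_add (maxPow_anti (by omega) hus)
  · rwa [ht, add_sub_cancel_left]

/-- Because `m` is even and `E / F` is totally ramified, every class of `U_E^m` modulo `U_E^(m+1)`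
contains some `1 + α` with `α ∈ F`. Such an element equals `1 + u / tr(a)` for `u = α tr(a) ∈ F`, so
the nontriviality of `θ` on `U_E^m` is seen by `N^(n+d)`. -/
theorem exists_XiLower_cellVec_ne (hm : Even m) (hm0 : 0 < m) (hmn : m + 1 = 2 * n + D.d)
    {θ : Eˣ →* kˣ}
    (hθ : HasLevel θ m) (hθχ : ∀ t : Eˣ, χ (D.iDiag n m t) = θ t) {a : E}
    (ha : valuation E a = uniformizer E) :
    ∃ (u : F) (hu : u ∈ maxPow F 1) (c : k), u ∈ maxPow F (n + D.d) ∧ c ≠ 1 ∧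
      D.XiLower χ (lowerElt u hu) (D.cellVec χ hn a ha) = c • D.cellVec χ hn a ha := by
  have h1 : ¬ ∀ u ∈ unitLevel E (m - 1 + 1), θ u = 1 := fun h => by
    have : m ≤ m - 1 := hθ.2 h
    omega
  rw [Nat.sub_add_cancel hm0] at h1
  push Not at h1
  obtain ⟨w, ⟨hw1, hw2⟩, hw3⟩ := h1
  obtain ⟨l, hl⟩ := hm
  obtain ⟨α, β, hαβ⟩ := D.exists_comb ((w : E) - 1)
  have hv := D.valuation_comb α β D.valuation_π
  rw [← hαβ] at hv
  rw [mem_maxPow, hv, max_le_iff] at hw2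
  have hα : algebraMap F E α ∈ maxPow E m := hw2.1
  -- The valuation of `βπ` is odd if `β ≠ 0`, and at least the even number `m`, hence at least `m +
  -- 1`.
  have hβ : algebraMap F E β * D.π ∈ maxPow E (m + 1) := by
    have h2 : algebraMap F E β ∈ maxPow E (m - 1) := by
      have h3 : algebraMap F E β * D.π ∈ maxPow E m := by
        rw [mem_maxPow, map_mul, D.valuation_π]; exact hw2.2
      have h4 := mul_mem_maxPow_of_zpow (y := D.π⁻¹) (k := -1) (j := m - 1) h3
        (by rw [map_inv₀, D.valuation_π, zpow_neg, zpow_one]) (by omega)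
      rwa [mul_inv_cancel_right₀ D.pi_ne_zero] at h4
    have h5 := D.algebraMap_mem_maxPow (i := m) (by omega)
      (D.mem_maxPow_of_algebraMap (j := l) (by omega) h2)
    exact maxPow_mul h5 (by rw [mem_maxPow, D.valuation_π, pow_one])
  have hα1 : valuation E (1 + algebraMap F E α) = 1 := valuation_one_add (maxPow_anti hm0 hα)
  have hα0 : 1 + algebraMap F E α ≠ 0 := by
    intro h
    rw [h, map_zero] at hα1
    exact zero_ne_one hα1
  have hs := D.trace_ne_zero ha
  set u := α * D.trace a with hu
  have hue : algebraMap F E u / algebraMap F E (D.trace a) = algebraMap F E α := by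
    rw [hu, map_mul]; field_simp
  have hun : u ∈ maxPow F (n + D.d) := by
    refine D.mem_maxPow_of_algebraMap (i := m + D.d + 1) (by omega) ?_
    rw [hu, map_mul]
    exact mul_mem_maxPow_of_zpow hα (D.valuation_trace ha) (by push_cast; omega)
  have hu1 : u ∈ maxPow F 1 := maxPow_anti (by omega) hun
  obtain ⟨t, ht, h⟩ := D.XiLower_cellVec_of_mem χ hn hmn hun hu1 ha
  refine ⟨u, hu1, _, hun, ?_, h⟩
  rw [hθχ]
  intro h6
  apply hw3
  -- The elements `w` and `t = 1 + α` differ by `βπ ∈ 𝔭_E^(m+1)`, which `θ` does not see.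
  have h7 : θ (w * t⁻¹) = 1 := by
    have e : ((w * t⁻¹ : Eˣ) : E) - 1 =
        algebraMap F E β * D.π * (1 + algebraMap F E α)⁻¹ := by
      rw [Units.val_mul, Units.val_inv_eq_inv_val, ht, hue]
      field_simp
      linear_combination hαβ
    have h8 : ((w * t⁻¹ : Eˣ) : E) - 1 ∈ maxPow E (m + 1) := by
      rw [e]
      refine mul_mem_maxPow_of_zpow (k := 0) hβ ?_ (by simp)
      rw [map_inv₀, hα1, inv_one, zpow_zero]
    refine hθ.1 _ ⟨?_, h8⟩
    have := valuation_one_add (maxPow_anti (by omega) h8)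
    rwa [add_sub_cancel] at this
  rw [map_mul, map_inv, mul_inv_eq_one] at h7
  rw [h7]
  exact Units.ext h6

end Vectors

end WildDatum
-- Spectral projections for finite abelian groups
section FiniteAbelian

theorem exists_comp_eq_of_surjective {G Q M : Type*} [Group G] [Group Q] [Monoid M] {p : G →* Q}
    (hp : Function.Surjective p) (f : G →* M) (h : ∀ g, p g = 1 → f g = 1) :
    ∃ T : Q →* M, T.comp p = f := by
  have key : ∀ g g', p g = p g' → f g = f g' := by
    intro g g' e
    have := h (g * g'⁻¹) (by rw [map_mul, map_inv, e, mul_inv_cancel])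
    rw [← inv_mul_cancel_right g g', map_mul, this, one_mul]
  let s := Function.surjInv hp
  have hs : ∀ q, p (s q) = q := Function.surjInv_eq hp
  refine ⟨{ toFun := fun q => f (s q), map_one' := h _ (hs 1), map_mul' := fun q r => ?_ }, ?_⟩
  · rw [← map_mul]
    exact key _ _ (by rw [map_mul, hs, hs, hs])
  · ext g
    exact key _ _ (hs _)

variable {k Q V : Type*} [Field k] [IsAlgClosed k] [CharZero k] [CommGroup Q] [Fintype Q]
  [AddCommGroup V] [Module k V]

/-- Multiplying by a character `μ` with `μ(q) ≠ 1` permutes the terms, so the sum equals `μ(q)`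
times itself. -/
theorem sum_char_eq_zero (q : Q) (hq : q ≠ 1) [Fintype (Q →* kˣ)] :
    ∑ ψ : Q →* kˣ, ((ψ q : kˣ) : k) = 0 := by
  obtain ⟨μ, hμ⟩ := CommGroup.exists_apply_ne_one_of_hasEnoughRootsOfUnity Q k hq
  have h : ((μ q : kˣ) : k) * ∑ ψ : Q →* kˣ, ((ψ q : kˣ) : k) =
      ∑ ψ : Q →* kˣ, ((ψ q : kˣ) : k) := by
    rw [Finset.mul_sum]
    exact Fintype.sum_equiv (Equiv.mulLeft μ) _ _ fun ψ => by simp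
  by_contra h0
  exact hμ (Units.ext ((mul_eq_right₀ h0).1 h))

variable (T : Representation k Q V)

/-- The projection to the `ψ`-eigenspace of a representation of a finite abelian group. -/
noncomputable def eigenProj (ψ : Q →* kˣ) : V →ₗ[k] V :=
  (Fintype.card Q : k)⁻¹ • ∑ q : Q, (((ψ q)⁻¹ : kˣ) : k) • T q

theorem eigenProj_apply (ψ : Q →* kˣ) (v : V) :
    eigenProj T ψ v = (Fintype.card Q : k)⁻¹ • ∑ q : Q, (((ψ q)⁻¹ : kˣ) : k) • T q v := by
  simp [eigenProj, LinearMap.sum_apply]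

theorem eigenProj_apply_map (ψ : Q →* kˣ) (q : Q) (v : V) :
    eigenProj T ψ (T q v) = ((ψ q : kˣ) : k) • eigenProj T ψ v := by
  rw [eigenProj_apply, eigenProj_apply, smul_comm]
  congr 1
  rw [Finset.smul_sum]
  refine Fintype.sum_equiv (Equiv.mulRight q) _ _ fun r => ?_
  rw [Equiv.coe_mulRight, smul_smul, ← Units.val_mul, map_mul, map_mul, Module.End.mul_apply,
    mul_inv, mul_comm (ψ r)⁻¹, mul_inv_cancel_left]

theorem map_eigenProj (ψ : Q →* kˣ) (q : Q) (v : V) :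
    T q (eigenProj T ψ v) = ((ψ q : kˣ) : k) • eigenProj T ψ v := by
  rw [← eigenProj_apply_map, eigenProj_apply, eigenProj_apply, map_smul, map_sum]
  simp_rw [map_smul, ← Module.End.mul_apply, ← map_mul, mul_comm q]

theorem eigenProj_eq_self (ψ : Q →* kˣ) {v : V} (hv : ∀ q, T q v = ((ψ q : kˣ) : k) • v) :
    eigenProj T ψ v = v := by
  rw [eigenProj_apply]
  simp_rw [hv, smul_smul, ← Units.val_mul, inv_mul_cancel, Units.val_one, one_smul]
  rw [Finset.sum_const, Finset.card_univ, ← Nat.cast_smul_eq_nsmul k, smul_smul,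
    inv_mul_cancel₀ (by simp), one_smul]

/-- Summing over all characters isolates the term `q = 1`, whose coefficient is `1` because `Q` has
as many characters as elements. No finiteness of dimension is needed. -/
theorem sum_eigenProj [Fintype (Q →* kˣ)] (v : V) : ∑ ψ : Q →* kˣ, eigenProj T ψ v = v := by
  classical
  have h : ∀ q : Q, ∑ ψ : Q →* kˣ, (((ψ q)⁻¹ : kˣ) : k) =
      if q = 1 then (Fintype.card Q : k) else 0 := by
    intro q
    split_ifs with hq
    · subst hq
      have := CommGroup.card_monoidHom_of_hasEnoughRootsOfUnity Q k
      rw [Nat.card_eq_fintype_card, Nat.card_eq_fintype_card] at this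
      simp [this]
    · simp_rw [← map_inv]
      exact sum_char_eq_zero _ (inv_ne_one.2 hq)
  simp_rw [eigenProj_apply]
  rw [← Finset.smul_sum, Finset.sum_comm]
  simp_rw [← Finset.sum_smul, h, ite_smul, zero_smul]
  rw [Finset.sum_ite_eq' Finset.univ (1 : Q), if_pos (Finset.mem_univ _), map_one,
    Module.End.one_apply, smul_smul, inv_mul_cancel₀ (by simp), one_smul]

theorem eigenProj_mem (ψ : Q →* kˣ) {S : Submodule k V} (hS : ∀ q, ∀ v ∈ S, T q v ∈ S) {v : V}
    (hv : v ∈ S) : eigenProj T ψ v ∈ S := by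
  rw [eigenProj_apply]
  exact S.smul_mem _ (S.sum_mem fun q _ => S.smul_mem _ (hS q v hv))

end FiniteAbelian

/-! ### Multiplicity-free restriction and irreducibility -/

section Multiplicity

variable {k V : Type*} [Field k] [AddCommGroup V] [Module k V]

/-- Eigenvectors for distinct characters are linearly independent. -/
theorem linearIndependent_of_eigenvectors {G : Type*} [Group G] (ρ : Representation k G V)
    (Ψ : Set (G →* kˣ)) (v : Ψ → V) (hv0 : ∀ ψ, v ψ ≠ 0)
    (hv : ∀ (ψ : Ψ) g, ρ g (v ψ) = ((ψ.1 g : kˣ) : k) • v ψ) : LinearIndependent k v := by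
  -- Dedekind's independence of characters, as functions on `G`.
  have hind : LinearIndependent k fun ψ : Ψ => (fun g : G => ((ψ.1 g : kˣ) : k)) := by
    have h1 := linearIndependent_monoidHom G k
    refine h1.comp (fun ψ : Ψ => (Units.coeHom k).comp ψ.1) fun ψ φ h => ?_
    refine Subtype.ext (MonoidHom.ext fun g => Units.ext ?_)
    exact DFunLike.congr_fun h g
  rw [linearIndependent_iff']
  intro s c hs ψ hψ
  by_contra hc
  -- Applying `ρ g` and then a functional `f` to the relation gives, as `g` varies, a linear
  -- relation between characters; hence `c ψ * f (v ψ) = 0` for every `f`.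
  refine hv0 ψ ((Module.forall_dual_apply_eq_zero_iff k _).1 fun f => ?_)
  have := linearIndependent_iff'.1 hind s (fun φ => c φ * f (v φ)) (by
    ext g
    have := congrArg (fun x => f (ρ g x)) hs
    simp only [map_sum, map_smul, hv, map_zero, smul_eq_mul] at this
    rw [Finset.sum_apply, Pi.zero_apply, ← this]
    refine Finset.sum_congr rfl fun φ _ => ?_
    simp only [Pi.smul_apply, smul_eq_mul]
    ring) ψ hψ
  exact (mul_eq_zero.1 this).resolve_left hc

/-- A representation of `B` whose restriction to `G`, acting through a finite abelian quotient, is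
multiplicity free with the characters permuted transitively by `B`. -/
theorem equiv_directSum_and_isIrreducible [IsAlgClosed k] [CharZero k] {G B Q : Type*} [Group G]
    [Group B] [CommGroup Q] [Finite Q] {p : G →* Q} (hp : Function.Surjective p)
    (ρ : Representation k G V) (hρ : ∀ g, p g = 1 → ρ g = 1) (σ : Representation k B V)
    (hσ : ∀ g, ∃ b, σ b = ρ g) (Ψ : Set (G →* kˣ)) [Nontrivial V]
    (h1 : ∀ (ψ : G →* kˣ) (v : V), (∀ g, ρ g v = ((ψ g : kˣ) : k) • v) → v ≠ 0 → ψ ∈ Ψ)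
    (h2 : ∀ (ψ : G →* kˣ) (v w : V), (∀ g, ρ g v = ((ψ g : kˣ) : k) • v) →
      (∀ g, ρ g w = ((ψ g : kˣ) : k) • w) → v ≠ 0 → ∃ c : k, w = c • v)
    (h3 : ∀ ψ ∈ Ψ, ∀ φ ∈ Ψ, ∃ b, ∀ v : V, (∀ g, ρ g v = ((ψ g : kˣ) : k) • v) →
      ∀ g, ρ g (σ b v) = ((φ g : kˣ) : k) • σ b v) :
    Nonempty (Representation.Equiv ρ (Representation.directSum fun ψ : Ψ => charRep ψ.1)) ∧
      σ.IsIrreducible := by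
  classical
  have : Fintype Q := Fintype.ofFinite Q
  have : Fintype (Q →* kˣ) := Fintype.ofFinite _
  obtain ⟨T, rfl⟩ := exists_comp_eq_of_surjective hp ρ hρ
  have hproj : ∀ (ψ : Q →* kˣ) (v : V) g, (T.comp p) g (eigenProj T ψ v) =
      (((ψ.comp p) g : kˣ) : k) • eigenProj T ψ v := fun ψ v g => map_eigenProj T ψ _ v
  have hne : ∀ v : V, v ≠ 0 → ∃ ψ : Q →* kˣ, eigenProj T ψ v ≠ 0 := by
    intro v hv
    by_contra! h
    refine hv ?_
    rw [← sum_eigenProj (k := k) T v]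
    exact Finset.sum_eq_zero fun ψ _ => h ψ
  have hinj : ∀ b, Function.Injective (σ b) := by
    intro b
    have e : ∀ v, σ b⁻¹ (σ b v) = v := fun v => by
      rw [← Module.End.mul_apply, ← map_mul, inv_mul_cancel, map_one, Module.End.one_apply]
    exact Function.LeftInverse.injective e
  -- Some character occurs because `V ≠ 0`; transitivity moves its eigenvector to any `φ ∈ Ψ`.
  have hex : ∀ ψ : Ψ, ∃ v : V, v ≠ 0 ∧ ∀ g, (T.comp p) g v = ((ψ.1 g : kˣ) : k) • v := by
    intro φ
    obtain ⟨v, hv⟩ := exists_ne (0 : V)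
    obtain ⟨ψ, hψ⟩ := hne v hv
    obtain ⟨b, hb⟩ := h3 _ (h1 _ _ (hproj ψ v) hψ) φ φ.2
    refine ⟨_, ?_, hb _ (hproj ψ v)⟩
    rwa [Ne, map_eq_zero_iff _ (hinj b)]
  choose v hv0 hv using hex
  have hli := linearIndependent_of_eigenvectors (T.comp p) Ψ v hv0 hv
  -- Every vector is the sum of its eigencomponents, and by `h2` each component is a multiple of the
  -- chosen eigenvector. This gives both the basis and, applied to a stable subspace,
  -- irreducibility.
  have hmem : ∀ S : Submodule k V, (∀ ψ, v ψ ∈ S) → S = ⊤ := by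
    intro S hS
    rw [eq_top_iff]
    intro w _
    rw [← sum_eigenProj (k := k) T w]
    refine S.sum_mem fun ψ _ => ?_
    by_cases h0 : eigenProj T ψ w = 0
    · rw [h0]; exact S.zero_mem
    obtain ⟨c, hc⟩ := h2 _ _ _ (hv ⟨_, h1 _ _ (hproj ψ w) h0⟩) (hproj ψ w) (hv0 _)
    rw [hc]
    exact S.smul_mem _ (hS _)
  have hspan : ⊤ ≤ Submodule.span k (Set.range v) :=
    (hmem _ fun ψ => Submodule.subset_span (Set.mem_range_self ψ)).ge
  refine ⟨?_, ?_⟩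
  · let e : (DirectSum Ψ fun _ => k) ≃ₗ[k] V :=
      (finsuppLEquivDirectSum k k Ψ).symm.trans (Module.Basis.mk hli hspan).repr.symm
    have he : ∀ ψ (c : k), e (DirectSum.lof k Ψ (fun _ => k) ψ c) = c • v ψ := by
      intro ψ c
      simp only [e, LinearEquiv.trans_apply]
      rw [finsuppLEquivDirectSum_symm_lof, Module.Basis.repr_symm_single, Module.Basis.mk_apply]
    refine ⟨Representation.Equiv.symm (Representation.Equiv.mk e fun g => ?_)⟩
    refine DirectSum.linearMap_ext k fun ψ => LinearMap.ext fun c => ?_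
    simp only [LinearMap.comp_apply, LinearEquiv.coe_coe, Representation.directSum,
      MonoidHom.coe_mk, OneHom.coe_mk, DirectSum.lmap_lof, he, map_smul]
    rw [hv, smul_smul]
    simp [charRep, mul_comm]
  · have : Nontrivial (Subrepresentation σ) := by
      refine ⟨⟨⊥, ⊤, fun h => ?_⟩⟩
      exact bot_ne_top (α := Submodule k V) (congrArg Subrepresentation.toSubmodule h)
    refine ⟨fun S => or_iff_not_imp_left.2 fun hS => ?_⟩
    obtain ⟨w, hw, hw0⟩ : ∃ w ∈ S.toSubmodule, w ≠ 0 := by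
      by_contra! h
      refine hS (Subrepresentation.toSubmodule_injective ?_)
      exact (Submodule.eq_bot_iff _).2 h
    obtain ⟨ψ, hψ⟩ := hne w hw0
    -- The operators of `Q` are among those of `B`, so a `B`-stable subspace contains the
    -- eigencomponents of its vectors.
    have hQ : ∀ q, ∀ x ∈ S.toSubmodule, T q x ∈ S.toSubmodule := by
      intro q x hx
      obtain ⟨g, rfl⟩ := hp q
      obtain ⟨b, hb⟩ := hσ g
      have : T (p g) = σ b := hb.symm
      rw [this]
      exact S.apply_mem_toSubmodule b hx
    have hS1 := eigenProj_mem T ψ hQ hw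
    refine Subrepresentation.toSubmodule_injective (hmem _ fun φ => ?_)
    obtain ⟨b, hb⟩ := h3 _ (h1 _ _ (hproj ψ w) hψ) φ φ.2
    obtain ⟨c, hc⟩ := h2 _ _ _ (hb _ (hproj ψ w)) (hv φ) (by
      rwa [Ne, map_eq_zero_iff _ (hinj b)])
    rw [hc]
    exact S.toSubmodule.smul_mem _ (S.apply_mem_toSubmodule b hS1)

end Multiplicity

/-! ### Characters of `N^1` of a given conductor -/

section Characters

variable {L : Type*} [Field L] [ValuativeRel L] [TopologicalSpace L]
  [IsNonarchimedeanLocalField L]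

theorem maximalIdeal_eq_span {ϖ : 𝒪[L]} (hϖ : valuation L (ϖ : L) = uniformizer L) :
    𝓂[L] = Ideal.span {ϖ} := by
  have h0 : (ϖ : L) ≠ 0 := by
    intro h
    rw [h, map_zero] at hϖ
    exact uniformizer_ne_zero hϖ.symm
  ext x
  rw [Ideal.mem_span_singleton', IsLocalRing.mem_maximalIdeal, mem_nonunits_iff,
    Valuation.Integer.not_isUnit_iff_valuation_lt_one]
  constructor
  · intro hx
    have hx' : (x : L) ∈ maxPow L 1 := mem_maxPow_one.2 hx
    have h := mul_mem_maxPow_of_zpow (y := (ϖ : L)⁻¹) (k := -1) (j := 0) hx'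
      (by rw [map_inv₀, hϖ, zpow_neg, zpow_one]) (by simp)
    exact ⟨⟨_, mem_maxPow_zero.1 h⟩, Subtype.ext (inv_mul_cancel_right₀ h0 _)⟩
  · rintro ⟨y, rfl⟩
    exact mem_maxPow_one.1 (maxPow_mul_of_le (i := 0) (j := 1) (mem_maxPow_zero.2 y.2)
      (by rw [mem_maxPow, hϖ, pow_one]) (by omega))

/-- Identifies the valuation-theoretic `maxPow` with ideal powers, for which finiteness of the
quotients is available. -/
theorem mem_maximalIdeal_pow {ϖ : L} (hϖ : valuation L ϖ = uniformizer L) {x : 𝒪[L]} {j : ℕ} :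
    x ∈ 𝓂[L] ^ j ↔ (x : L) ∈ maxPow L j := by
  have h0 : ϖ ≠ 0 := by
    intro h
    rw [h, map_zero] at hϖ
    exact uniformizer_ne_zero hϖ.symm
  have h1 : valuation L ϖ ≤ 1 := hϖ.le.trans uniformizer_lt_one.le
  rw [maximalIdeal_eq_span (ϖ := ⟨ϖ, h1⟩) hϖ, Ideal.span_singleton_pow,
    Ideal.mem_span_singleton']
  constructor
  · rintro ⟨y, rfl⟩
    exact maxPow_mul_of_le (i := 0) (j := j) (mem_maxPow_zero.2 y.2)
      (by rw [mem_maxPow]; exact (by rw [← hϖ, ← map_pow]; rfl)) (by omega)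
  · intro hx
    have h := mul_mem_maxPow_of_zpow (y := (ϖ ^ j)⁻¹) (k := -(j : ℤ)) (j := 0) hx
      (by rw [map_inv₀, map_pow, hϖ, zpow_neg, zpow_natCast]) (by simp)
    exact ⟨⟨_, mem_maxPow_zero.1 h⟩, Subtype.ext (inv_mul_cancel_right₀ (pow_ne_zero _ h0) _)⟩

instance (j : ℕ) : Finite (𝒪[L] ⧸ 𝓂[L] ^ j) :=
  have : Finite (𝒪[L] ⧸ 𝓂[L]) := inferInstanceAs (Finite 𝓀[L])
  Ideal.finite_quotient_pow (IsNoetherian.noetherian _) j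

theorem lowerElt_mul {u v : L} (hu : u ∈ maxPow L 1) (hv : v ∈ maxPow L 1) :
    lowerElt u hu * lowerElt v hv = lowerElt (u + v) (add_mem hu hv) :=
  Subtype.ext (eMinus_add u v).symm

theorem eq_lowerElt (g : lowerUnipotent L 1) :
    g = lowerElt ((g : GL (Fin 2) L) 1 0) g.2.2.2.2 := by
  obtain ⟨g, h1, h2, h3, h4⟩ := g
  refine Subtype.ext (Units.ext ?_)
  change (g : Matrix (Fin 2) (Fin 2) L) = !![(1 : L), 0; g 1 0, 1]
  ext k l
  fin_cases k <;> fin_cases l <;> simp [h1, h2, h3]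

theorem lowerElt_mem_lowerUnipotent {u : L} (hu : u ∈ maxPow L 1) {j : ℕ} :
    (lowerElt u hu : GL (Fin 2) L) ∈ lowerUnipotent L j ↔ u ∈ maxPow L j :=
  ⟨fun h => h.2.2.2, fun h => ⟨rfl, rfl, rfl, h⟩⟩

variable {ϖ : L}


/-- Division of the lower left entry by a uniformizer identifies `N^1 / N^(j+1)` with
`𝒪 / 𝔭^j`. -/
theorem exists_lowerUnipotent_hom (hϖ : valuation L ϖ = uniformizer L) (j : ℕ) :
    ∃ p : lowerUnipotent L 1 →* Multiplicative (𝒪[L] ⧸ 𝓂[L] ^ j), Function.Surjective p ∧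
      (∀ g, p g = 1 ↔ (g : GL (Fin 2) L) ∈ lowerUnipotent L (j + 1)) ∧
      ∀ (x : 𝒪[L]) (hx : ϖ * x ∈ maxPow L 1),
        p (lowerElt (ϖ * x) hx) = Multiplicative.ofAdd (Ideal.Quotient.mk _ x) := by
  have h0 : ϖ ≠ 0 := by
    intro h
    rw [h, map_zero] at hϖ
    exact uniformizer_ne_zero hϖ.symm
  have hdiv : ∀ (u : L) (i : ℕ), u ∈ maxPow L (i + 1) ↔ u / ϖ ∈ maxPow L i := by
    intro u i
    constructor
    · intro hu
      rw [div_eq_mul_inv]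
      exact mul_mem_maxPow_of_zpow (k := -1) hu
        (by rw [map_inv₀, hϖ, zpow_neg, zpow_one]) (by simp)
    · intro hu
      have := mul_mem_maxPow_of_zpow (k := 1) (j := i + 1) hu (by rw [hϖ, zpow_one]) (by simp)
      rwa [div_mul_cancel₀ _ h0] at this
  let f : lowerUnipotent L 1 → 𝒪[L] := fun g =>
    ⟨(g : GL (Fin 2) L) 1 0 / ϖ, mem_maxPow_zero.1 ((hdiv _ 0).1 g.2.2.2.2)⟩
  have hf : ∀ g h, f (g * h) = f g + f h := by
    intro g h
    refine Subtype.ext ?_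
    rw [eq_lowerElt g, eq_lowerElt h, lowerElt_mul]
    exact add_div _ _ _
  have hfx : ∀ (x : 𝒪[L]) (hx : ϖ * x ∈ maxPow L 1), f (lowerElt (ϖ * x) hx) = x :=
    fun x hx => Subtype.ext (mul_div_cancel_left₀ _ h0)
  let p : lowerUnipotent L 1 →* Multiplicative (𝒪[L] ⧸ 𝓂[L] ^ j) :=
    MonoidHom.mk' (fun g => Multiplicative.ofAdd (Ideal.Quotient.mk _ (f g))) fun g h => by
      rw [hf, map_add, ofAdd_add]
  refine ⟨p, ?_, fun g => ?_, fun x hx => ?_⟩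
  · intro q
    obtain ⟨x, hx⟩ := Ideal.Quotient.mk_surjective q.toAdd
    have hx' : ϖ * x ∈ maxPow L 1 := by
      rw [hdiv, mul_div_cancel_left₀ _ h0, mem_maxPow_zero]
      exact x.2
    refine ⟨lowerElt _ hx', ?_⟩
    change Multiplicative.ofAdd (Ideal.Quotient.mk _ (f _)) = q
    rw [hfx, hx, ofAdd_toAdd]
  · change Multiplicative.ofAdd (Ideal.Quotient.mk _ (f g)) = 1 ↔ _
    rw [ofAdd_eq_one, Ideal.Quotient.eq_zero_iff_mem, mem_maximalIdeal_pow hϖ]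
    change (g : GL (Fin 2) L) 1 0 / ϖ ∈ maxPow L j ↔ _
    rw [← hdiv]
    exact ⟨fun h => ⟨g.2.1, g.2.2.1, g.2.2.2.1, h⟩, fun h => h.2.2.2⟩
  · change Multiplicative.ofAdd (Ideal.Quotient.mk _ (f _)) = _
    rw [hfx]

/-- The units of `𝒪` act transitively on the characters of `N^1` of a given conductor. -/
theorem exists_unit_mul_eq {k : Type*} [Field k] [IsAlgClosed k] [CharZero k]
    (hϖ : valuation L ϖ = uniformizer L) {j : ℕ} (hj : 1 ≤ j) {ψ φ : lowerUnipotent L 1 →* kˣ}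
    (hψ : ψ ∈ unipotentChars L k j) (hφ : φ ∈ unipotentChars L k j) :
    ∃ x : L, valuation L x = 1 ∧ ∀ (u : L) (hu : u ∈ maxPow L 1) (hxu : x * u ∈ maxPow L 1),
      φ (lowerElt u hu) = ψ (lowerElt (x * u) hxu) := by
  classical
  obtain ⟨p, hp, hker, hpx⟩ := exists_lowerUnipotent_hom hϖ j
  have h0 : ϖ ≠ 0 := by
    intro h
    rw [h, map_zero] at hϖ
    exact uniformizer_ne_zero hϖ.symm
  have hmul : ∀ x : 𝒪[L], ϖ * x ∈ maxPow L 1 := fun x =>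
    maxPow_mul_of_le (i := 1) (j := 0) (by rw [mem_maxPow, hϖ, pow_one])
      (mem_maxPow_zero.2 x.2) (by omega)
  have hrep : ∀ (u : L) (i : ℕ), u ∈ maxPow L (i + 1) → ∃ x : 𝒪[L], u = ϖ * x ∧
      (x : L) ∈ maxPow L i := by
    intro u i hu
    have h := mul_mem_maxPow_of_zpow (y := ϖ⁻¹) (j := i) (k := -1) hu
        (by rw [map_inv₀, hϖ, zpow_neg, zpow_one]) (by simp)
    exact ⟨⟨u * ϖ⁻¹, mem_maxPow_zero.1 (maxPow_anti (Nat.zero_le _) h)⟩, by field_simp, h⟩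
  obtain ⟨l, hl⟩ := exists_comp_eq_of_surjective hp ψ fun g hg => hψ.1 g ((hker g).1 hg)
  obtain ⟨l', hl'⟩ := exists_comp_eq_of_surjective hp φ fun g hg => hφ.1 g ((hker g).1 hg)
  have hlx : ∀ x : 𝒪[L], l (Multiplicative.ofAdd (Ideal.Quotient.mk _ x)) =
      ψ (lowerElt (ϖ * x) (hmul x)) := fun x => by
    rw [← hpx x (hmul x), ← hl]; rfl
  have hlx' : ∀ x : 𝒪[L], l' (Multiplicative.ofAdd (Ideal.Quotient.mk _ x)) =
      φ (lowerElt (ϖ * x) (hmul x)) := fun x => by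
    rw [← hpx x (hmul x), ← hl']; rfl
  have hnt : ∀ {χ : lowerUnipotent L 1 →* kˣ}, χ ∈ unipotentChars L k j →
      ¬ ∀ x : 𝒪[L], (x : L) ∈ maxPow L (j - 1) → χ (lowerElt (ϖ * x) (hmul x)) = 1 := by
    rintro χ ⟨-, g, hg, hne⟩ h
    apply hne
    rw [eq_lowerElt g] at hg ⊢
    rw [lowerElt_mem_lowerUnipotent] at hg
    obtain ⟨x, hx, hx'⟩ := hrep _ (j - 1) (by rwa [Nat.sub_add_cancel hj])
    have := h x hx'
    convert this
  set W := 𝒪[L] ⧸ 𝓂[L] ^ j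
  -- Twisting `ψ`, viewed on the finite ring `W`, by multiplication. The aim is to show that `W`
  -- thereby becomes its own character group.
  let μ : W → (Multiplicative W →* kˣ) := fun w =>
    l.comp (AddMonoidHom.toMultiplicative (AddMonoidHom.mulLeft w))
  have hμ : ∀ w y, μ w (Multiplicative.ofAdd y) = l (Multiplicative.ofAdd (w * y)) :=
    fun _ _ => rfl
  have hμ_inj : Function.Injective μ := by
    intro w w' hw
    by_contra hne
    obtain ⟨z, hz⟩ := Ideal.Quotient.mk_surjective (w - w')
    have hz0 : ¬ (z : L) ∈ maxPow L j := by
      rw [← mem_maximalIdeal_pow hϖ, ← Ideal.Quotient.eq_zero_iff_mem, hz]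
      exact sub_ne_zero.2 hne
    have hz00 : (z : L) ≠ 0 := by
      intro h
      rw [h] at hz0
      exact hz0 (zero_mem _)
    obtain ⟨c, hc⟩ := valuation_eq_zpow L hz00
    rw [mem_maxPow_iff_of_eq_zpow hc] at hz0
    -- As `z ∉ 𝔭^j` has valuation at most `j - 1`, each `x ∈ 𝔭^(j-1)` is an integral multiple of
    -- `z`. Equality of the twists by `w` and `w'` would make `ψ` trivial on all such `x`, against
    -- its exact conductor.
    refine hnt hψ fun x hx => ?_
    have hy := mul_mem_maxPow_of_zpow (y := (z : L)⁻¹) (k := -c) (j := 0) hx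
      (by rw [map_inv₀, hc, zpow_neg]) (by push_cast; omega)
    have hxy : x = z * ⟨_, mem_maxPow_zero.1 hy⟩ := by
      refine Subtype.ext ?_
      change (x : L) = z * (x * (z : L)⁻¹)
      field_simp
    have h1 := DFunLike.congr_fun hw (Multiplicative.ofAdd
      (Ideal.Quotient.mk _ ⟨_, mem_maxPow_zero.1 hy⟩))
    rw [hμ, hμ] at h1
    rw [← hlx, hxy, map_mul, hz, sub_mul, ofAdd_sub, map_div, h1, div_self']
  have hμ_surj : Function.Surjective μ := by
    have : Finite (Multiplicative W) := inferInstanceAs (Finite W)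
    have : Finite (Multiplicative W →* kˣ) := inferInstance
    refine (Function.Injective.bijective_of_nat_card_le hμ_inj ?_).2
    -- Injectivity becomes bijectivity, since `W` has as many characters as elements.
    rw [CommGroup.card_monoidHom_of_hasEnoughRootsOfUnity]
    exact le_of_eq (Nat.card_congr Multiplicative.toAdd)
  obtain ⟨w, hw⟩ := hμ_surj l'
  obtain ⟨x, rfl⟩ := Ideal.Quotient.mk_surjective w
  have key : ∀ y : 𝒪[L], φ (lowerElt (ϖ * y) (hmul y)) =
      ψ (lowerElt (ϖ * (x * y : 𝒪[L])) (hmul (x * y))) := by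
    intro y
    rw [← hlx, ← hlx', ← hw, hμ, map_mul (Ideal.Quotient.mk _)]
  refine ⟨x, ?_, fun u hu hxu => ?_⟩
  -- If `x` were in `𝔭`, then `x y ∈ 𝔭^j` for `y ∈ 𝔭^(j-1)`, and `φ` would be trivial on `N^j`.
  · by_contra hx
    have hx1 : (x : L) ∈ maxPow L 1 := mem_maxPow_one.2 (lt_of_le_of_ne x.2 hx)
    refine hnt hφ fun y hy => ?_
    rw [key]
    refine hψ.1 _ ((lowerElt_mem_lowerUnipotent _).2 ?_)
    have h2 : ((x * y : 𝒪[L]) : L) ∈ maxPow L j :=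
      maxPow_mul_of_le hx1 hy (by omega)
    exact maxPow_mul_of_le (i := 1) (by rw [mem_maxPow, hϖ, pow_one]) h2 (by omega)
  · obtain ⟨y, rfl, -⟩ := hrep u 0 hu
    rw [key]
    congr 1
    refine Subtype.ext ?_
    change eMinus _ = eMinus _
    congr 1
    change ϖ * ((x : L) * y) = x * (ϖ * y)
    ring

end Characters

/-- A nonzero `ψ`-eigenvector forces `ψ` to be trivial on the kernel of `p`, so `ψ` comes from the
finite group `Q` and its spectral projection can be used. -/
theorem exists_eigenProj {k V G Q : Type*} [Field k] [IsAlgClosed k] [CharZero k] [AddCommGroup V]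
    [Module k V] [Group G] [CommGroup Q] [Finite Q] {p : G →* Q} (hp : Function.Surjective p)
    (ρ : Representation k G V) (hρ : ∀ g, p g = 1 → ρ g = 1) {ψ : G →* kˣ} {v : V} (hv0 : v ≠ 0)
    (hv : ∀ g, ρ g v = ((ψ g : kˣ) : k) • v) :
    ∃ P : V →ₗ[k] V, (∀ g w, P (ρ g w) = ((ψ g : kˣ) : k) • P w) ∧
      ∀ w, (∀ g, ρ g w = ((ψ g : kˣ) : k) • w) → P w = w := by
  have : Fintype Q := Fintype.ofFinite Q
  obtain ⟨T, rfl⟩ := exists_comp_eq_of_surjective hp ρ hρ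
  obtain ⟨l, rfl⟩ := exists_comp_eq_of_surjective hp ψ fun g hg => by
    have h := hv g
    rw [hρ g hg, Module.End.one_apply] at h
    refine Units.ext (smul_left_injective k hv0 ?_)
    simpa using h.symm
  refine ⟨eigenProj T l, fun g w => eigenProj_apply_map T l _ w, fun w hw => ?_⟩
  refine eigenProj_eq_self T l fun q => ?_
  obtain ⟨g, rfl⟩ := hp q
  exact hw g

/-! ### Multiplicity one and the conclusion -/

namespace WildDatum

variable {F E : Type*} [Field F] [ValuativeRel F] [TopologicalSpace F]
  [IsNonarchimedeanLocalField F] [Field E] [ValuativeRel E] [TopologicalSpace E]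
  [IsNonarchimedeanLocalField E] [Algebra F E] [ValuativeExtension F E]
  [CharP F 2] (D : WildDatum F E)

/-- The trace of `α + βπ` is `βΔ` in characteristic 2, so its kernel is exactly `F`. -/
theorem exists_algebraMap_eq_of_trace_eq_zero {z : E} (hz : D.trace z = 0) :
    ∃ u : F, z = algebraMap F E u := by
  have h := (D.exists_comb z).choose_spec.choose_spec
  rw [trace, mul_eq_zero] at hz
  have hΔ : D.Δ ≠ 0 := by
    intro h
    have := D.valuation_algebraMap_delta
    rw [h, map_zero, map_zero] at this
    exact zpow_ne_zero _ uniformizer_ne_zero this.symm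
  rw [hz.resolve_right hΔ, map_zero, zero_mul, add_zero] at h
  exact ⟨_, h⟩

theorem trace_add (a b : E) : D.trace (a + b) = D.trace a + D.trace b := by
  apply (algebraMap F E).injective
  rw [map_add, algebraMap_trace, algebraMap_trace, algebraMap_trace, map_add]
  ring

/-- Two uniformizers of `E` differ by an affine transformation over `F`. -/
theorem exists_affine (D : WildDatum F E) {a b : E} (ha : valuation E a = uniformizer E)
    (hb : valuation E b = uniformizer E) : ∃ (x : Fˣ) (u : F), valuation F (x : F) = 1 ∧
      u ∈ maxPow F 1 ∧ algebraMap F E x * a = b + algebraMap F E u := by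
  have ha0 : D.trace a ≠ 0 := fun h => D.trace_ne_zero ha (by rw [h, map_zero])
  have hb0 : D.trace b ≠ 0 := fun h => D.trace_ne_zero hb (by rw [h, map_zero])
  have hx1 : valuation F (D.trace b / D.trace a) = 1 := by
    obtain ⟨k, hk⟩ := valuation_eq_zpow F (div_ne_zero hb0 ha0)
    have h := D.valuation_algebraMap_zpow hk
    rw [map_div₀, map_div₀, D.valuation_trace ha, D.valuation_trace hb,
      div_self (zpow_ne_zero _ uniformizer_ne_zero), ← zpow_zero (uniformizer E)] at h
    have := zpow_uniformizer_inj h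
    rw [hk, show k = 0 by omega, zpow_zero]
  refine ⟨Units.mk0 _ (div_ne_zero hb0 ha0), ?_⟩
  rw [Units.val_mk0]
  set x := D.trace b / D.trace a with hx
  obtain ⟨u, hu⟩ := D.exists_algebraMap_eq_of_trace_eq_zero (z := algebraMap F E x * a + b) (by
    rw [trace_add, trace_algebraMap_mul, hx, div_mul_cancel₀ _ ha0, CharTwo.add_self_eq_zero])
  refine ⟨u, hx1, D.mem_maxPow_of_algebraMap (i := 1) (by omega) ?_, ?_⟩
  · rw [← hu]
    exact add_mem (uniformizer_mem (D.valuation_algebraMap_mul ha hx1)).1 (uniformizer_mem hb).1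
  · rw [← hu]
    linear_combination -b * D.two_eq_zero

section

variable {k : Type*} [Field k] {n m : ℕ} (χ : D.Gamma n m →* kˣ)

/-- Conjugation by `diag(1, x)` multiplies the lower left entry by `x`. -/
theorem XiBorel_XiLower {x : Fˣ} (hx : valuation F (x : F) = 1) {u : F} (hu : u ∈ maxPow F 1)
    (hxu : x * u ∈ maxPow F 1) (v : D.VSpace χ) :
    D.XiBorel χ (diagElt x hx) (D.XiLower χ (lowerElt u hu) v) =
      D.XiLower χ (lowerElt (x * u) hxu) (D.XiBorel χ (diagElt x hx) v) := by
  change D.Xi χ _ (D.Xi χ _ v) = D.Xi χ _ (D.Xi χ _ v)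
  rw [← Module.End.mul_apply, ← Module.End.mul_apply, ← map_mul, ← map_mul]
  congr 2
  refine Subtype.ext (Units.ext ?_)
  change (eZero 1 x : Matrix (Fin 2) (Fin 2) F) * (eMinus u : Matrix (Fin 2) (Fin 2) F) =
    (eMinus (x * u) : Matrix (Fin 2) (Fin 2) F) * (eZero 1 x : Matrix (Fin 2) (Fin 2) F)
  rw [eMinus, eMinus, eZero, mkOfDetNeZero_coe, mkOfDetNeZero_coe, mkOfDetNeZero_coe,
    Matrix.mul_fin_two, Matrix.mul_fin_two]
  simp

variable {ψ : lowerUnipotent F 1 →* kˣ} {P : D.VSpace χ →ₗ[k] D.VSpace χ}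

/-- Such an `e₋(u)` fixes the alcove, so the vector is already an eigenvector of it; a nonzero image
under `P` identifies the eigenvalue as `ψ`. -/
theorem XiLower_cellVec_of_proj_ne_zero (hn : 1 ≤ n)
    (hP : ∀ g w, P (D.XiLower χ g w) = ((ψ g : kˣ) : k) • P w) {a : E}
    (ha : valuation E a = uniformizer E) (h : P (D.cellVec χ hn a ha) ≠ 0) {u : F}
    (hu : u ∈ maxPow F 1) (hu' : algebraMap F E u ∈ maxPow E (n + D.d + 1)) :
    D.XiLower χ (lowerElt u hu) (D.cellVec χ hn a ha) =
      ((ψ (lowerElt u hu) : kˣ) : k) • D.cellVec χ hn a ha := by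
  obtain ⟨c, hc⟩ := D.exists_cellVec_eq_smul χ hn ha (D.valuation_add_algebraMap ha hu)
    (by rwa [add_sub_cancel_left])
  rw [← D.XiLower_cellVec χ hn hu ha] at hc
  have h1 := hP (lowerElt u hu) (D.cellVec χ hn a ha)
  rw [hc, map_smul] at h1
  rw [hc, smul_left_injective k h h1]

/-- The `ψ`-components of the vectors attached to alcoves are proportional. -/
theorem exists_proj_cellVec_eq_smul (hn : 1 ≤ n)
    (hP : ∀ g w, P (D.XiLower χ g w) = ((ψ g : kˣ) : k) • P w)
    (hψ : ψ ∈ unipotentChars F k (n + D.d)) {a b : E}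
    (ha : valuation E a = uniformizer E) (hb : valuation E b = uniformizer E)
    (h : P (D.cellVec χ hn a ha) ≠ 0) :
    ∃ c : k, P (D.cellVec χ hn b hb) = c • P (D.cellVec χ hn a ha) := by
  by_cases hb0 : P (D.cellVec χ hn b hb) = 0
  · exact ⟨0, by rw [hb0, zero_smul]⟩
  obtain ⟨x, u, hx, hu, hxu⟩ := D.exists_affine ha hb
  have hxa := D.valuation_algebraMap_mul ha hx
  have e1 : D.XiLower χ (lowerElt u hu) (D.cellVec χ hn b hb) =
      D.cellVec χ hn (algebraMap F E x * a) hxa := by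
    rw [XiLower_cellVec]
    congr 1
    exact hxu.symm
  have e2 : P (D.cellVec χ hn (algebraMap F E x * a) hxa) =
      ((ψ (lowerElt u hu) : kˣ) : k) • P (D.cellVec χ hn b hb) := by
    rw [← e1, hP]
  have hxa0 : P (D.cellVec χ hn (algebraMap F E x * a) hxa) ≠ 0 := by
    rw [e2]
    exact smul_ne_zero (Units.ne_zero _) hb0
  -- The main point: if both `P[a]` and `P[xa]` are nonzero, then `[a]` and `[xa]` must belong to
  -- the same alcove.
  have hclose : algebraMap F E x * a - a ∈ maxPow E (n + D.d + 1) := by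
    by_contra hfar
    have hx1 : (x : F) - 1 ≠ 0 := by
      intro h0
      rw [sub_eq_zero.1 h0, map_one, one_mul, sub_self] at hfar
      exact hfar (zero_mem _)
    obtain ⟨j, hj⟩ := valuation_eq_zpow F hx1
    have hfar' : ¬ ((n + D.d + 1 : ℕ) : ℤ) ≤ 2 * j + 1 := by
      rwa [← mem_maxPow_iff_of_eq_zpow (x := algebraMap F E x * a - a)]
      rw [show algebraMap F E x * a - a = algebraMap F E ((x : F) - 1) * a by
        rw [map_sub, map_one]; ring, map_mul, ha, D.valuation_algebraMap_zpow hj,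
        zpow_add_one₀ uniformizer_ne_zero]
    obtain ⟨g, hg, hg1⟩ := hψ.2
    rw [eq_lowerElt g] at hg hg1
    have hw := g.2.2.2.2
    rw [lowerElt_mem_lowerUnipotent] at hg
    set w := (g : GL (Fin 2) F) 1 0
    have hd := D.odd_d.pos
    -- For `j = ord(x - 1)`, failure of the congruence means `2j + 1 ≤ n + d`. So `y` has valuation
    -- at least `n + d - j ≥ (n + d + 1)/2`, just enough for `e₋(y)` and `e₋(xy)` to fix the two
    -- alcoves.
    have hy : w / ((x : F) - 1) ∈ maxPow F ((n + D.d + 2) / 2) := by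
      rw [div_eq_mul_inv]
      refine mul_mem_maxPow_of_zpow (k := -j) hg (by rw [map_inv₀, hj, zpow_neg]) ?_
      push_cast at *
      omega
    set y := w / ((x : F) - 1) with hy_def
    have hy1 : y ∈ maxPow F 1 := maxPow_anti (by omega) hy
    have hyE : algebraMap F E y ∈ maxPow E (n + D.d + 1) :=
      D.algebraMap_mem_maxPow (by omega) hy
    have hxy : (x : F) * y ∈ maxPow F ((n + D.d + 2) / 2) := by
      rwa [mem_maxPow, map_mul, hx, one_mul]
    have hxy1 : (x : F) * y ∈ maxPow F 1 := maxPow_anti (by omega) hxy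
    have hxyE : algebraMap F E (x * y) ∈ maxPow E (n + D.d + 1) :=
      D.algebraMap_mem_maxPow (by omega) hxy
    obtain ⟨c, hc0, hc⟩ := D.XiBorel_diagElt χ hn hx ha
    have h1 := D.XiBorel_XiLower χ hx hy1 hxy1 (D.cellVec χ hn a ha)
    rw [D.XiLower_cellVec_of_proj_ne_zero χ hn hP ha h hy1 hyE, map_smul, hc, map_smul,
      D.XiLower_cellVec_of_proj_ne_zero χ hn hP hxa hxa0 hxy1 hxyE, smul_comm] at h1
    have h2 := smul_right_injective _ hc0 h1
    -- Conjugation by `diag(1, x)` matches the two eigenvalues. Since `xy = y + w`, this gives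
    -- `ψ(e₋(w)) = 1`, against the choice of `w`.
    have h3 : ψ (lowerElt y hy1) = ψ (lowerElt (x * y) hxy1) :=
      Units.ext (smul_left_injective k (D.tildeVec_ne_zero χ _) h2)
    apply hg1
    have h4 : lowerElt y hy1 * lowerElt w hw = lowerElt (x * y) hxy1 := by
      rw [lowerElt_mul]
      congr 1
      rw [hy_def]
      field_simp
      ring
    rw [← h4, map_mul, left_eq_mul] at h3
    exact h3
  obtain ⟨c, hc⟩ := D.exists_cellVec_eq_smul χ hn ha hxa hclose
  refine ⟨((ψ (lowerElt u hu))⁻¹ : kˣ) * c, ?_⟩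
  rw [mul_smul, ← map_smul, ← hc, e2, smul_smul, ← Units.val_mul, inv_mul_cancel, Units.val_one,
    one_smul]

theorem proj_eq_zero (hn : 1 ≤ n) (h : ∀ a ha, P (D.cellVec χ hn a ha) = 0) : P = 0 := by
  refine LinearMap.ext_on (D.span_cellVec χ hn) ?_
  rintro _ ⟨a, ha, rfl⟩
  exact h a ha

theorem Xi_equiv_and_isIrreducible [IsAlgClosed k] [CharZero k] (hn : 1 ≤ n) (hm : Even m)
    (hm0 : 0 < m)
    (hmn : m + 1 = 2 * n + D.d) {θ : Eˣ →* kˣ} (hθ : HasLevel θ m)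
    (hθχ : ∀ t : Eˣ, χ (D.iDiag n m t) = θ t) :
    Nonempty (Representation.Equiv (D.XiLower χ)
        (Representation.directSum
          fun ψ : unipotentChars F k (n + D.d) => charRep ψ.1)) ∧
      Representation.IsIrreducible (D.XiBorel χ) := by
  obtain ⟨p, hp, hker, -⟩ := exists_lowerUnipotent_hom D.valuation_ϖ (n + D.d)
  have hρ : ∀ g, p g = 1 → D.XiLower χ g = 1 := by
    intro g hg
    rw [hker, eq_lowerElt g, lowerElt_mem_lowerUnipotent] at hg
    refine LinearMap.ext_on (D.span_cellVec χ hn) ?_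
    rintro _ ⟨a, ha, rfl⟩
    rw [eq_lowerElt g, D.XiLower_cellVec_eq_self χ hn hmn hθ hθχ hg, Module.End.one_apply]
  have : Nontrivial (D.VSpace χ) :=
    ⟨D.cellVec χ hn D.π D.valuation_π, 0, D.tildeVec_ne_zero χ _⟩
  have h1 : ∀ (ψ : lowerUnipotent F 1 →* kˣ) (v : D.VSpace χ),
      (∀ g, D.XiLower χ g v = ((ψ g : kˣ) : k) • v) → v ≠ 0 →
      ψ ∈ unipotentChars F k (n + D.d) := by
    intro ψ v hv hv0
    refine ⟨fun g hg => ?_, ?_⟩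
    · have h := hv g
      rw [hρ g ((hker g).2 hg), Module.End.one_apply] at h
      refine Units.ext (smul_left_injective k hv0 ?_)
      simpa using h.symm
    · obtain ⟨P, hP, hP'⟩ := exists_eigenProj hp _ hρ hv0 hv
      by_contra! h
      -- If `ψ` were trivial on `N^(n+d)`, `P` would kill every spanning vector, since each is an
      -- eigenvector of some `e₋(u)`, `u ∈ 𝔭_F^(n+d)`, with eigenvalue different from `1`.
      have hP0 : P = 0 := by
        refine D.proj_eq_zero χ hn fun a ha => ?_
        obtain ⟨u, hu, c, hun, hc, e⟩ := D.exists_XiLower_cellVec_ne χ hn hm hm0 hmn hθ hθχ ha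
        have h2 := hP (lowerElt u hu) (D.cellVec χ hn a ha)
        rw [e, h _ ((lowerElt_mem_lowerUnipotent hu).2 hun), map_smul] at h2
        by_contra h0
        exact hc (smul_left_injective k h0 h2)
      exact hv0 (by rw [← hP' v hv, hP0, LinearMap.zero_apply])
  refine equiv_directSum_and_isIrreducible hp _ hρ _
    (fun g => ⟨⟨g, g.2.2.2.1, lowerUnipotent_le_iwahori g.2⟩, rfl⟩) _ h1 ?_ ?_
  · intro ψ v w hv hw hv0
    obtain ⟨P, hP, hP'⟩ := exists_eigenProj hp _ hρ hv0 hv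
    obtain ⟨a, ha, h⟩ : ∃ a ha, P (D.cellVec χ hn a ha) ≠ 0 := by
      by_contra! h
      exact hv0 (by rw [← hP' v hv, D.proj_eq_zero χ hn h, LinearMap.zero_apply])
    -- The image of `P` contains the `ψ`-eigenspace and is spanned by the proportional vectors
    -- `P[b]`, hence is a line.
    have hrange : LinearMap.range P ≤ Submodule.span k {P (D.cellVec χ hn a ha)} := by
      rw [LinearMap.range_eq_map, ← D.span_cellVec χ hn, Submodule.map_span, Submodule.span_le]
      rintro _ ⟨_, ⟨b, hb, rfl⟩, rfl⟩
      obtain ⟨c, hc⟩ := D.exists_proj_cellVec_eq_smul χ hn hP (h1 ψ v hv hv0) ha hb h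
      exact Submodule.mem_span_singleton.2 ⟨c, hc.symm⟩
    obtain ⟨c, hc⟩ := Submodule.mem_span_singleton.1 (hrange ⟨v, hP' v hv⟩)
    obtain ⟨c', hc'⟩ := Submodule.mem_span_singleton.1 (hrange ⟨w, hP' w hw⟩)
    have hc0 : c ≠ 0 := by
      rintro rfl
      exact hv0 (by rw [← hc, zero_smul])
    exact ⟨c' / c, by rw [← hc, ← hc', smul_smul, div_mul_cancel₀ _ hc0]⟩
  · intro ψ hψ φ hφ
    have hd := D.odd_d.pos
    obtain ⟨x, hx, hxψ⟩ := exists_unit_mul_eq D.valuation_ϖ (j := n + D.d) (by omega) hψ hφ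
    have hx0 : x ≠ 0 := by
      rintro rfl
      rw [map_zero] at hx
      exact zero_ne_one hx
    have hx' : valuation F (((Units.mk0 x hx0)⁻¹ : Fˣ) : F) = 1 := by
      rw [Units.val_inv_eq_inv_val, Units.val_mk0, map_inv₀, hx, inv_one]
    -- The inverse occurs because `e₋(u) diag(1, x⁻¹) = diag(1, x⁻¹) e₋(xu)`, and `φ(e₋(u)) =
    -- ψ(e₋(xu))`.
    refine ⟨diagElt (Units.mk0 x hx0)⁻¹ hx', fun v hv g => ?_⟩
    rw [eq_lowerElt g]
    have hu := g.2.2.2.2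
    have hxu : x * (g : GL (Fin 2) F) 1 0 ∈ maxPow F 1 := by
      rwa [mem_maxPow, map_mul, hx, one_mul]
    have e : (((Units.mk0 x hx0)⁻¹ : Fˣ) : F) * (x * (g : GL (Fin 2) F) 1 0) =
        (g : GL (Fin 2) F) 1 0 := by
      rw [Units.val_inv_eq_inv_val, Units.val_mk0, inv_mul_cancel_left₀ hx0]
    have h := D.XiBorel_XiLower χ hx' hxu (by rwa [e]) v
    simp only [e] at h
    rw [← h, hv, map_smul, hxψ _ hu hxu]

end

end WildDatum
end WildGL2

theorem mainTheorem11
    {F E : Type*} [Field F] [ValuativeRel F] [TopologicalSpace F]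
    [IsNonarchimedeanLocalField F] [CharP F 2]
    [Field E] [ValuativeRel E] [TopologicalSpace E] [IsNonarchimedeanLocalField E]
    [Algebra F E] [ValuativeExtension F E]
    (D : WildGL2.WildDatum F E)
    (ℓ : ℕ) [Fact ℓ.Prime]
    (n m : ℕ) (hm : Even m) (hdm : D.d < m) (hmn : m + 1 = 2 * n + D.d) (hdn : D.d < 2 * n)
    (θ : Eˣ →* (PadicAlgCl ℓ)ˣ) (hθ : WildGL2.HasLevel θ m)
    (θt : D.Gamma n m →* (PadicAlgCl ℓ)ˣ)
    (hθt : ∀ t : Eˣ, θt (D.iDiag n m t) = θ t) :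
    Nonempty (Representation.Equiv
        ((D.Xi θt).comp (Subgroup.inclusion D.lowerUnipotent_le_cuspGroup))
        (Representation.directSum
          fun ψ : WildGL2.unipotentChars F (PadicAlgCl ℓ) (n + D.d) => WildGL2.charRep ψ.1)) ∧
      Representation.IsIrreducible
        ((D.Xi θt).comp (Subgroup.inclusion D.borel_inf_iwahori_le_cuspGroup)) :=
  D.Xi_equiv_and_isIrreducible θt (by omega) hm (by omega) hmn hθ hθt
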